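/- **Theorem (Shifted-Sums, classical).** An instance of Shifted-Sums consists of positive integers $a_1,\dots,a_n$ and an integer $0\le s<\sum_{i=1}^n a_i$; a solution is a pair of distinct subsets $S_1\neq S_2$ of $\{1,\dots,n\}$ with $\sum_{i\in S_1}a_i=s+\sum_{i\in S_2}a_i$. The maximum solution ratio of an instance that has a solution is the number $\ell\in(0,1]$ such that $\ell n$ is the largest value of $|S_1|+|S_2|$ over all solutions with $S_1\cap S_2=\emptyset$. Let $L$ denote the bit length of the instance (one unit per item plus the lengths of all the numbers), let $h(x)=-x\log_2x-(1-x)\log_2(1-x)$ (with $0\log_2 0=0$), and let $$\gamma(\ell)=\begin{cases}1/2&\text{if }\ell_1\le\ell<1/2,\\ \ell&\text{if }1/2\le\ell<\ell_2,\\ (h(\ell)+\ell)/2&\text{otherwise,}\end{cases}$$ where $\ell_1\approx0.227$ and $\ell_2\approx0.773$ (each within $0.0005$) are solutions of $(h(\ell)+\ell)/2=1/2$ and $(h(\ell)+\ell)/2=\ell$, respectively. There are such $\ell_1,\ell_2$, a single probabilistic classical algorithm (a random access machine program with fair coin flips, in which each operation is charged the bit length of the numbers and of the memory address involved) that receives only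 $n$, $a_1,\dots,a_n$ and $s$, and a constant $C\ge1$ such that the following holds. 1. On every instance with maximum solution ratio $\ell$, the algorithm outputs a solution within time $C\,(L^{C}+n^{C}\,2^{\gamma(\ell)n})$ with probability at least $1/(Cn^{C})$. That is, after polynomial-time processing of the input, the time is $\widetilde O(2^{\gamma(\ell)n})$ and the success probability is at least inverse polynomial in $n$. 2. In particular, the worst-case complexity is $O(2^{0.773n})$ up to polynomial-time processing of the input: on every instance, every run of the algorithm halts within time $C\,(L^{C}+2^{0.773n})$, and on every instance that has a solution the algorithm outputs a solution within this time with probability at least $1/(Cn^{C})$. -/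

import Mathlib

/-! ## The Shifted-Sums problem -/

/-- `(S₁, S₂)` is a solution of the Shifted-Sums instance `(a, s)`: the two subsets are distinct
and `∑_{i ∈ S₁} a i = s + ∑_{i ∈ S₂} a i`. -/
def IsSolution {n : ℕ} (a : Fin n → ℕ) (s : ℕ) (S₁ S₂ : Finset (Fin n)) : Prop :=
  S₁ ≠ S₂ ∧ ∑ i ∈ S₁, a i = s + ∑ i ∈ S₂, a i

/-- The real number `ℓ` is the maximum solution ratio of `(a, s)`: the largest value of
`|S₁| + |S₂|` over all disjoint solutions `(S₁, S₂)` exists and equals `ℓ * n`. -/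
def IsMaxSolutionRatio {n : ℕ} (a : Fin n → ℕ) (s : ℕ) (ℓ : ℝ) : Prop :=
  IsGreatest {x : ℝ | ∃ S₁ S₂ : Finset (Fin n), IsSolution a s S₁ S₂ ∧ Disjoint S₁ S₂ ∧
    x = ((S₁.card + S₂.card : ℕ) : ℝ)} (ℓ * n)

/-- The bit length of the instance `(a, s)` (with one extra unit per item). -/
def inputLength {n : ℕ} (a : Fin n → ℕ) (s : ℕ) : ℕ :=
  n + Nat.size s + ∑ i, Nat.size (a i)

/-! ## Probabilistic random access machines with logarithmic cost

A machine has registers `reg 0, reg 1, …` (a program mentions finitely many of them), a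
random access memory `mem 0, mem 1, …`, both holding natural numbers, and a tape of coins.
Every instruction is charged the bit lengths of the numbers and of the memory address that it
works with. -/

/-- The arithmetic operations of the machine (truncated subtraction, division with rounding down). -/
inductive BinOp : Type
  | add
  | sub
  | mul
  | div

/-- The value of an arithmetic operation. -/
def BinOp.eval : BinOp → ℕ → ℕ → ℕ
  | .add, x, y => x + y
  | .sub, x, y => x - y
  | .mul, x, y => x * y
  | .div, x, y => x / y

/-- Programs. -/
inductive Prog : Type
  /-- `reg d := c`. -/
  | const (d c : ℕ)
  /-- `reg d := reg x ∘ reg y` for an arithmetic operation `∘`. -/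
  | arith (o : BinOp) (d x y : ℕ)
  /-- `reg d := mem (reg x)`. -/
  | load (d x : ℕ)
  /-- `mem (reg x) := reg y`. -/
  | store (x y : ℕ)
  /-- `reg d :=` the next coin, as `0` or `1`. -/
  | flip (d : ℕ)
  /-- First `c₁`, then `c₂`. -/
  | seq (c₁ c₂ : Prog)
  /-- If `reg x ≠ 0` then `c₁` else `c₂`. -/
  | ite (x : ℕ) (c₁ c₂ : Prog)
  /-- While `reg x ≠ 0` do `c`. -/
  | loop (x : ℕ) (c : Prog)

/-- Configurations; `coins` is the number of coins used so far. -/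
structure Config : Type where
  reg : ℕ → ℕ
  mem : ℕ → ℕ
  coins : ℕ

/-- `Exec tape c σ t τ`: with the coins `tape`, the program `c` started in the configuration `σ`
halts in the configuration `τ`, and the total cost of this run is `t`. -/
inductive Exec (tape : ℕ → Bool) : Prog → Config → ℕ → Config → Prop
  | const (d c : ℕ) (σ : Config) :
      Exec tape (.const d c) σ (1 + Nat.size c)
        { σ with reg := Function.update σ.reg d c }
  | arith (o : BinOp) (d x y : ℕ) (σ : Config) :
      Exec tape (.arith o d x y) σ (1 + Nat.size (σ.reg x) + Nat.size (σ.reg y))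
        { σ with reg := Function.update σ.reg d (o.eval (σ.reg x) (σ.reg y)) }
  | load (d x : ℕ) (σ : Config) :
      Exec tape (.load d x) σ (1 + Nat.size (σ.reg x) + Nat.size (σ.mem (σ.reg x)))
        { σ with reg := Function.update σ.reg d (σ.mem (σ.reg x)) }
  | store (x y : ℕ) (σ : Config) :
      Exec tape (.store x y) σ (1 + Nat.size (σ.reg x) + Nat.size (σ.reg y))
        { σ with mem := Function.update σ.mem (σ.reg x) (σ.reg y) }
  | flip (d : ℕ) (σ : Config) :
      Exec tape (.flip d) σ 1
        { σ with reg := Function.update σ.reg d (tape σ.coins).toNat, coins := σ.coins + 1 }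
  | seq (c₁ c₂ : Prog) (σ τ ρ : Config) (t₁ t₂ : ℕ) :
      Exec tape c₁ σ t₁ τ → Exec tape c₂ τ t₂ ρ → Exec tape (.seq c₁ c₂) σ (t₁ + t₂) ρ
  | ite_true (x : ℕ) (c₁ c₂ : Prog) (σ τ : Config) (t : ℕ) :
      σ.reg x ≠ 0 → Exec tape c₁ σ t τ →
      Exec tape (.ite x c₁ c₂) σ (1 + Nat.size (σ.reg x) + t) τ
  | ite_false (x : ℕ) (c₁ c₂ : Prog) (σ τ : Config) (t : ℕ) :
      σ.reg x = 0 → Exec tape c₂ σ t τ →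
      Exec tape (.ite x c₁ c₂) σ (1 + Nat.size (σ.reg x) + t) τ
  | loop_true (x : ℕ) (c : Prog) (σ τ ρ : Config) (t₁ t₂ : ℕ) :
      σ.reg x ≠ 0 → Exec tape c σ t₁ τ → Exec tape (.loop x c) τ t₂ ρ →
      Exec tape (.loop x c) σ (1 + Nat.size (σ.reg x) + t₁ + t₂) ρ
  | loop_false (x : ℕ) (c : Prog) (σ : Config) :
      σ.reg x = 0 → Exec tape (.loop x c) σ (1 + Nat.size (σ.reg x)) σ

/-- The initial configuration on input `(a, s)`: register `0` holds `n`, register `1` holds `s`,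
the memory cells `0, …, n - 1` hold the items, and everything else is `0`. -/
def initConfig {n : ℕ} (a : Fin n → ℕ) (s : ℕ) : Config where
  reg := fun i => if i = 0 then n else if i = 1 then s else 0
  mem := fun i => if h : i < n then a ⟨i, h⟩ else 0
  coins := 0

/-- The subset of the `n` indices that a halted machine stores as an array of `n` memory cells
from the address `base` on (zero means absent, nonzero means present). -/
def Config.outSet (τ : Config) (n base : ℕ) : Finset (Fin n) :=
  Finset.univ.filter fun i => τ.mem (base + i) ≠ 0

/-- With the coins `tape`, the program `P` halts on `(a, s)` at cost at most `T`. -/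
def HaltsWithin (P : Prog) {n : ℕ} (a : Fin n → ℕ) (s : ℕ) (tape : ℕ → Bool) (T : ℕ) : Prop :=
  ∃ t τ, Exec tape P (initConfig a s) t τ ∧ t ≤ T

/-- With the coins `tape`, the program `P` halts on `(a, s)` at cost at most `T` and outputs
a solution `(S₁, S₂)`; the arrays of `S₁` and `S₂` start at the addresses `0` and `n`. -/
def SolvesWithin (P : Prog) {n : ℕ} (a : Fin n → ℕ) (s : ℕ) (tape : ℕ → Bool) (T : ℕ) : Prop :=
  ∃ t τ, Exec tape P (initConfig a s) t τ ∧ t ≤ T ∧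
    IsSolution a s (τ.outSet n 0) (τ.outSet n n)

/-- A string of `T` coins as a tape. A run of cost at most `T` uses at most `T` coins, so the
padding is never read in such a run. -/
def padTape {T : ℕ} (r : Fin T → Bool) : ℕ → Bool :=
  fun i => if h : i < T then r ⟨i, h⟩ else false

/-- The probability, over independent fair coins, that `P` outputs a solution of `(a, s)` at cost
at most `T`. -/
noncomputable def successProb (P : Prog) {n : ℕ} (a : Fin n → ℕ) (s : ℕ) (T : ℕ) : ℝ :=
  ({r : Fin T → Bool | SolvesWithin P a s (padTape r) T}.ncard : ℝ) / 2 ^ T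

/-! ## The exponent -/

/-- The binary entropy function. -/
noncomputable def entropy₂ (x : ℝ) : ℝ :=
  -x * Real.logb 2 x - (1 - x) * Real.logb 2 (1 - x)

/-- The exponent `γ(ℓ)` with the thresholds `ℓ₁` and `ℓ₂`. -/
noncomputable def gammaExp (ℓ₁ ℓ₂ ℓ : ℝ) : ℝ :=
  if ℓ₁ ≤ ℓ ∧ ℓ < 1 / 2 then 1 / 2
  else if 1 / 2 ≤ ℓ ∧ ℓ < ℓ₂ then ℓ
  else (entropy₂ ℓ + ℓ) / 2

/-! Let $(M_1, M_2)$ be a disjoint solution of the largest total size $m = \ell n$. The algorithm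
runs one of two list-merging searches. It guesses uniformly which one, and also every number that
the search needs. Each guess is suitable with at least inverse polynomial probability, and
`drawProb` is the product of these bounds. The enumerations are cut off after a number of steps
fixed by the guessed exponent `g`, so apart from the preparation a run costs polynomially many times
`2 ^ g`, however unlucky the other guesses are.

Residue search. If $Y$ avoids $M_1 \cup M_2$, then $(M_1 \cup X, M_2 \cup X)$ is a solution for
every $X \subseteq Y$. By maximality different $X$ have different sums (`IsMaxPair.sum_injOn`):
otherwise $X \setminus X'$ and $X' \setminus X$ could be adjoined to the two sides. With $|Y| = e$
this gives $2^e$ solutions. Modulo many primes $p \le 2^e$ their sums still occupy a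
$1/\mathrm{poly}(n)$ fraction of $2^e$ residues (`frac_prime`), and all but few residues are hit by
at most $\mathrm{poly}(n) 2^{n-e}$ subsets (`frac_target`). So a random residue often leads to two
lists of about $2^g$ sets, $g = n - e$, that contain a matching pair (`good_of_residue`,
`frac_residue`). The conditions are $e \le n - m$, and $e \le g$ because a table with about $p$
columns is needed. This gives the exponents $1/2$ and $\ell$.

Split search. There are $\binom{n}{m} 2^m$ signed sets of size $m$. The items are cut at a position
where the numbers of signed sets with the right cardinality on both sides are at most about the
square root of this (`exists_split`), and the two sides are matched (`good_of_split`). This gives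
the exponent $(h(\ell) + \ell)/2$.

Enumeration. Dynamic programming counts the completions of each prefix. Keeping only the prefixes
that have a completion, the search tree is at most $n + 1$ times larger than the list
(`Par.treeSize_le`). One completion per key is stored in memory at an address computed from the key.
The stored one need not be the intended one, so `Search.Good` asks for a match with distinct sets
whatever has been stored.

Long numbers. The input length may enter only additively. Hence the items are reduced modulo a
random $q \le 2^{16 n}$, and with sufficient probability $q$ is a prime that creates no new
equations (`frac_goodMod`). If the sum of the items is at least $2^{2^n}$, the differences may have
too many prime factors for this argument; but then $2^n$ is less than the input length, and $q$ is
taken larger than twice the sum.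

Exponents. $\ell_2$ is a root of $h(x) = x$ between $17/22$ and $143/185$, and $\ell_1 = 1 - \ell_2$
by the symmetry of $h$. Since $h(x) + x$ increases up to $2/3$ and decreases afterwards, no $g$
above $143 n / 185 + 1$ is ever needed (`exists_lucky`); the gap between $143/185$ and $0.773$
absorbs the polynomial factor. -/

namespace ShiftedSums

set_option linter.constructorNameAsVariable false

/-! ### Expressions and their compilation -/

/-- The variables of the high-level programs. -/
inductive Var : Type
  | n | s | sum | big | rnd | modM | q | p | al | be | lo | hi | f1 | f2 | k | k1 | k2 | md | g | e
  | j | c | cap | pe | pg | i | x | res | key | code | res' | w | b | head | tail | done | diff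
  | c1 | c2 | xp | xk
  deriving DecidableEq

/-- The register that holds a variable. -/
def Var.idx (x : Var) : ℕ := x.ctorIdx

theorem Var.idx_lt (x : Var) : x.idx < 41 := by cases x <;> decide

theorem Var.idx_injective : Function.Injective Var.idx := by
  intro x y h
  have := congrArg Var.ofNat h
  simpa [Var.idx, Var.ofNat_ctorIdx] using this

/-- States of the high-level programs. -/
@[ext] structure St : Type where
  v : Var → ℕ
  m : ℕ → ℕ
  coins : ℕ

/-- Expressions. -/
inductive Expr : Type
  | var (x : Var)
  | const (c : ℕ)
  | op (o : BinOp) (e₁ e₂ : Expr)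
  | load (e : Expr)

instance : Coe Var Expr := ⟨Expr.var⟩
instance (c : ℕ) : OfNat Expr c := ⟨Expr.const c⟩
instance : Add Expr := ⟨Expr.op .add⟩
instance : Sub Expr := ⟨Expr.op .sub⟩
instance : Mul Expr := ⟨Expr.op .mul⟩
instance : Div Expr := ⟨Expr.op .div⟩
instance : Mod Expr := ⟨fun a b => a - a / b * b⟩

/-- The value of an expression. -/
def Expr.eval (S : St) : Expr → ℕ
  | .var x => S.v x
  | .const c => c
  | .op o e₁ e₂ => o.eval (e₁.eval S) (e₂.eval S)
  | .load e => S.m (e.eval S)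

section
variable (S : St) (a b : Expr) (c : ℕ)
@[simp] theorem Expr.eval_var (x : Var) : (Expr.var x).eval S = S.v x := rfl
@[simp] theorem Expr.eval_ofNat : Expr.eval S (no_index (OfNat.ofNat c)) = (OfNat.ofNat c : ℕ) := rfl
@[simp] theorem Expr.eval_load : (Expr.load a).eval S = S.m (a.eval S) := rfl
@[simp] theorem Expr.eval_add : (a + b).eval S = a.eval S + b.eval S := rfl
@[simp] theorem Expr.eval_sub : (a - b).eval S = a.eval S - b.eval S := rfl
@[simp] theorem Expr.eval_mul : (a * b).eval S = a.eval S * b.eval S := rfl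
@[simp] theorem Expr.eval_div : (a / b).eval S = a.eval S / b.eval S := rfl
@[simp] theorem Expr.eval_mod : (a % b).eval S = a.eval S % b.eval S := by
  change a.eval S - a.eval S / b.eval S * b.eval S = _
  rw [Nat.mod_eq_sub_div_mul]
end

/-- The code that evaluates an expression into the register `d`, using registers from `d` on. -/
def Expr.compile : Expr → ℕ → Prog
  | .var x, d => .seq (.const d 0) (.arith .add d x.idx d)
  | .const c, d => .const d c
  | .op o e₁ e₂, d => .seq (e₁.compile d) (.seq (e₂.compile (d + 1)) (.arith o d d (d + 1)))
  | .load e, d => .seq (e.compile d) (.load d d)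

/-- The cost of the code of an expression. -/
def Expr.cost (S : St) : Expr → ℕ
  | .var x => 1 + (1 + Nat.size (S.v x))
  | .const c => 1 + Nat.size c
  | .op _ e₁ e₂ =>
    e₁.cost S + (e₂.cost S + (1 + Nat.size (e₁.eval S) + Nat.size (e₂.eval S)))
  | .load e => e.cost S + (1 + Nat.size (e.eval S) + Nat.size (S.m (e.eval S)))

/-- The configuration `σ` of the machine represents the state `S`. -/
structure Rel (σ : Config) (S : St) : Prop where
  reg : ∀ x : Var, σ.reg x.idx = S.v x
  mem : σ.mem = S.m
  coins : σ.coins = S.coins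

/-- The registers from `d` on serve as a stack: the value of the first operand stays in `d` while
the second operand is evaluated above it, which is why preservation of all registers below `d`
belongs to the induction. -/
theorem Expr.compile_correct (tape : ℕ → Bool) (e : Expr) : ∀ (d : ℕ) (σ : Config) (S : St),
    41 ≤ d → Rel σ S → ∃ τ, Exec tape (e.compile d) σ (e.cost S) τ ∧ τ.reg d = e.eval S ∧
      (∀ r < d, τ.reg r = σ.reg r) ∧ τ.mem = σ.mem ∧ τ.coins = σ.coins := by
  induction e with
  | var x =>
    intro d σ S hd hσ
    have hne : x.idx ≠ d := by have := x.idx_lt; omega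
    have h := Exec.seq (.const d 0) (.arith .add d x.idx d) σ _ _ _ _
      (Exec.const (tape := tape) d 0 σ) (Exec.arith .add d x.idx d _)
    simp only [Function.update_self, Function.update_of_ne hne, hσ.reg, Nat.size_zero,
      add_zero] at h
    refine ⟨_, h, ?_, ?_, rfl, rfl⟩
    · simp [BinOp.eval, Expr.eval]
    · intro r hr
      simp [Function.update_of_ne hr.ne]
  | const c =>
    intro d σ S hd hσ
    refine ⟨_, Exec.const d c σ, by simp [Expr.eval], ?_, rfl, rfl⟩
    intro r hr
    simp [Function.update_of_ne hr.ne]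
  | op o e₁ e₂ ih₁ ih₂ =>
    intro d σ S hd hσ
    obtain ⟨τ₁, hx₁, hv₁, hr₁, hm₁, hc₁⟩ := ih₁ d σ S hd hσ
    have hσ₁ : Rel τ₁ S := ⟨fun x => by
      rw [hr₁ _ (by have := x.idx_lt; omega), hσ.reg], hm₁.trans hσ.mem, hc₁.trans hσ.coins⟩
    obtain ⟨τ₂, hx₂, hv₂, hr₂, hm₂, hc₂⟩ := ih₂ (d + 1) τ₁ S (by omega) hσ₁
    have hvd : τ₂.reg d = e₁.eval S := by rw [hr₂ d (by omega), hv₁]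
    have h := Exec.seq _ _ σ _ _ _ _ hx₁ (Exec.seq _ _ τ₁ _ _ _ _ hx₂
      (Exec.arith o d d (d + 1) τ₂))
    rw [hvd, hv₂] at h
    refine ⟨_, h, ?_, ?_, ?_, ?_⟩
    · simp [Expr.eval]
    · intro r hr
      simp [Function.update_of_ne hr.ne, hr₂ r (by omega), hr₁ r hr]
    · simp [hm₂, hm₁]
    · simp [hc₂, hc₁]
  | load e ih =>
    intro d σ S hd hσ
    obtain ⟨τ₁, hx₁, hv₁, hr₁, hm₁, hc₁⟩ := ih d σ S hd hσ
    have h := Exec.seq _ _ σ _ _ _ _ hx₁ (Exec.load d d τ₁)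
    rw [hv₁, hm₁, hσ.mem] at h
    refine ⟨_, h, ?_, ?_, ?_, ?_⟩
    · simp [Expr.eval]
    · intro r hr
      simp [Function.update_of_ne hr.ne, hr₁ r hr]
    · exact hσ.mem.symm
    · simp [hc₁]

/-! ### High-level programs with bounded loops, their cost and their compilation -/

/-- High-level programs. -/
inductive Cmd : Type
  | skip
  | assign (x : Var) (e : Expr)
  | store (a e : Expr)
  | flip (x : Var)
  | seq (c₁ c₂ : Cmd)
  | ite (e : Expr) (c₁ c₂ : Cmd)
  /-- Evaluate `e` once and run `c` that many times. -/
  | rep (e : Expr) (c : Cmd)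

/-- Assign to a variable. -/
def St.set (S : St) (x : Var) (a : ℕ) : St := { S with v := Function.update S.v x a }

/-- Write to a memory cell. -/
def St.write (S : St) (a y : ℕ) : St := { S with m := Function.update S.m a y }

/-- Consume a coin. -/
def St.tick (S : St) : St := { S with coins := S.coins + 1 }

section
variable (S : St) (x y : Var) (a z w : ℕ)
@[simp] theorem St.set_v : (S.set x a).v y = if y = x then a else S.v y := by
  simp [St.set, Function.update_apply]
@[simp] theorem St.set_m : (S.set x a).m = S.m := rfl
@[simp] theorem St.set_coins : (S.set x a).coins = S.coins := rfl
@[simp] theorem St.write_v : (S.write a z).v = S.v := rfl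
@[simp] theorem St.write_m : (S.write a z).m w = if w = a then z else S.m w := by
  simp [St.write, Function.update_apply]
@[simp] theorem St.write_coins : (S.write a z).coins = S.coins := rfl
@[simp] theorem St.tick_v : S.tick.v = S.v := rfl
@[simp] theorem St.tick_m : S.tick.m = S.m := rfl
@[simp] theorem St.tick_coins : S.tick.coins = S.coins + 1 := rfl
end

/-- The final state of a high-level program. -/
def Cmd.eval (tape : ℕ → Bool) : Cmd → St → St
  | .skip, S => S
  | .assign x e, S => S.set x (e.eval S)
  | .store a e, S => S.write (a.eval S) (e.eval S)
  | .flip x, S => (S.set x (tape S.coins).toNat).tick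
  | .seq c₁ c₂, S => c₂.eval tape (c₁.eval tape S)
  | .ite e c₁ c₂, S => if e.eval S ≠ 0 then c₁.eval tape S else c₂.eval tape S
  | .rep e c, S => (c.eval tape)^[e.eval S] S

/-- The cost of a loop with `k` iterations. -/
def repCost (f : St → St) (cost : St → ℕ) : ℕ → St → ℕ
  | 0, _ => 1
  | k + 1, S => 1 + Nat.size (k + 1) + (cost S + (2 + (2 + Nat.size (k + 1)))) +
    repCost f cost k (f S)

/-- The cost of the code of a high-level program. -/
def Cmd.cost (tape : ℕ → Bool) : Cmd → St → ℕ
  | .skip, _ => 1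
  | .assign _ e, S => e.cost S + (1 + (1 + Nat.size (e.eval S)))
  | .store a e, S => a.cost S + (e.cost S + (1 + Nat.size (a.eval S) + Nat.size (e.eval S)))
  | .flip _, _ => 1
  | .seq c₁ c₂, S => c₁.cost tape S + c₂.cost tape (c₁.eval tape S)
  | .ite e c₁ c₂, S => e.cost S + (1 + Nat.size (e.eval S) +
      if e.eval S ≠ 0 then c₁.cost tape S else c₂.cost tape S)
  | .rep e c, S => e.cost S + repCost (c.eval tape) (c.cost tape) (e.eval S) S

/-- The code of a high-level program, with the registers from `d` on for intermediate values. -/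
def Cmd.compile : Cmd → ℕ → Prog
  | .skip, d => .const d 0
  | .assign x e, d => .seq (e.compile d) (.seq (.const (d + 1) 0) (.arith .add x.idx d (d + 1)))
  | .store a e, d => .seq (a.compile d) (.seq (e.compile (d + 1)) (.store d (d + 1)))
  | .flip x, _ => .flip x.idx
  | .seq c₁ c₂, d => .seq (c₁.compile d) (c₂.compile d)
  | .ite e c₁ c₂, d => .seq (e.compile d) (.ite d (c₁.compile d) (c₂.compile d))
  | .rep e c, d => .seq (e.compile d)
      (.loop d (.seq (c.compile (d + 1)) (.seq (.const (d + 1) 1) (.arith .sub d d (d + 1)))))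

theorem Rel.of_agree {σ τ : Config} {S : St} {d : ℕ} (h : Rel σ S) (hd : 41 ≤ d)
    (hr : ∀ r < d, τ.reg r = σ.reg r) (hm : τ.mem = σ.mem) (hc : τ.coins = σ.coins) : Rel τ S :=
  ⟨fun x => by rw [hr _ (by have := x.idx_lt; omega), h.reg], hm.trans h.mem, hc.trans h.coins⟩

/-- The last clause protects the counters of the enclosing loops, which live in the registers from
41 up to `d`. -/
theorem Cmd.compile_correct (tape : ℕ → Bool) (c : Cmd) : ∀ (d : ℕ) (σ : Config) (S : St),
    41 ≤ d → Rel σ S → ∃ τ, Exec tape (c.compile d) σ (c.cost tape S) τ ∧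
      Rel τ (c.eval tape S) ∧ (∀ r, 41 ≤ r → r < d → τ.reg r = σ.reg r) := by
  induction c with
  | skip =>
    intro d σ S hd hσ
    refine ⟨_, Exec.const d 0 σ, ?_, ?_⟩
    · refine hσ.of_agree hd ?_ rfl rfl
      intro r hr
      simp [Function.update_of_ne hr.ne]
    · intro r _ hr
      simp [Function.update_of_ne hr.ne]
  | assign x e =>
    intro d σ S hd hσ
    obtain ⟨τ₁, hx₁, hv₁, hr₁, hm₁, hc₁⟩ := e.compile_correct tape d σ S hd hσ
    have hx := x.idx_lt
    have h := Exec.seq _ _ σ _ _ _ _ hx₁ (Exec.seq _ _ τ₁ _ _ _ _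
      (Exec.const (tape := tape) (d + 1) 0 τ₁) (Exec.arith .add x.idx d (d + 1) _))
    simp only [Function.update_self, Function.update_of_ne (show d ≠ d + 1 by omega), hv₁,
      Nat.size_zero, add_zero] at h
    refine ⟨_, h, ?_, ?_⟩
    · refine ⟨fun y => ?_, ?_, ?_⟩
      · have hy := y.idx_lt
        by_cases hxy : y = x
        · subst hxy
          simp [Cmd.eval, BinOp.eval]
        · have hne : y.idx ≠ x.idx := fun h => hxy (Var.idx_injective h)
          simp [Cmd.eval, hxy, Function.update_of_ne hne,
            Function.update_of_ne (show y.idx ≠ d + 1 by omega), hr₁ y.idx (by omega), hσ.reg]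
      · simp [Cmd.eval, hm₁, hσ.mem]
      · simp [Cmd.eval, hc₁, hσ.coins]
    · intro r h1 h2
      simp [Function.update_of_ne (show r ≠ x.idx by omega),
        Function.update_of_ne (show r ≠ d + 1 by omega), hr₁ r h2]
  | store a e =>
    intro d σ S hd hσ
    obtain ⟨τ₁, hx₁, hv₁, hr₁, hm₁, hc₁⟩ := a.compile_correct tape d σ S hd hσ
    have hσ₁ := hσ.of_agree hd hr₁ hm₁ hc₁
    obtain ⟨τ₂, hx₂, hv₂, hr₂, hm₂, hc₂⟩ := e.compile_correct tape (d + 1) τ₁ S (by omega) hσ₁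
    have hσ₂ := hσ₁.of_agree (by omega) hr₂ hm₂ hc₂
    have hvd : τ₂.reg d = a.eval S := by rw [hr₂ d (by omega), hv₁]
    have h := Exec.seq _ _ σ _ _ _ _ hx₁ (Exec.seq _ _ τ₁ _ _ _ _ hx₂
      (Exec.store d (d + 1) τ₂))
    rw [hvd, hv₂] at h
    refine ⟨_, h, ?_, ?_⟩
    · exact ⟨fun y => by simp [Cmd.eval, hσ₂.reg], by simp [Cmd.eval, St.write, hσ₂.mem],
        by simp [Cmd.eval, hσ₂.coins]⟩
    · intro r h1 h2
      simp [hr₂ r (by omega), hr₁ r h2]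
  | flip x =>
    intro d σ S hd hσ
    refine ⟨_, Exec.flip x.idx σ, ⟨fun y => ?_, ?_, ?_⟩, ?_⟩
    · by_cases hxy : y = x
      · subst hxy
        simp [Cmd.eval, hσ.coins]
      · have hne : y.idx ≠ x.idx := fun h => hxy (Var.idx_injective h)
        simp [Cmd.eval, hxy, Function.update_of_ne hne, hσ.reg]
    · simp [Cmd.eval, hσ.mem]
    · simp [Cmd.eval, hσ.coins]
    · intro r h1 h2
      have := x.idx_lt
      simp [Function.update_of_ne (show r ≠ x.idx by omega)]
  | seq c₁ c₂ ih₁ ih₂ =>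
    intro d σ S hd hσ
    obtain ⟨τ₁, hx₁, hσ₁, hr₁⟩ := ih₁ d σ S hd hσ
    obtain ⟨τ₂, hx₂, hσ₂, hr₂⟩ := ih₂ d τ₁ _ hd hσ₁
    exact ⟨τ₂, Exec.seq _ _ _ _ _ _ _ hx₁ hx₂, hσ₂, fun r h1 h2 => by
      rw [hr₂ r h1 h2, hr₁ r h1 h2]⟩
  | ite e c₁ c₂ ih₁ ih₂ =>
    intro d σ S hd hσ
    obtain ⟨τ₁, hx₁, hv₁, hr₁, hm₁, hc₁⟩ := e.compile_correct tape d σ S hd hσ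
    have hσ₁ := hσ.of_agree hd hr₁ hm₁ hc₁
    by_cases he : e.eval S ≠ 0
    · obtain ⟨τ₂, hx₂, hσ₂, hr₂⟩ := ih₁ d τ₁ S hd hσ₁
      refine ⟨τ₂, ?_, ?_, fun r h1 h2 => by rw [hr₂ r h1 h2, hr₁ r h2]⟩
      · have h := Exec.seq _ _ _ _ _ _ _ hx₁
          (Exec.ite_true d _ (c₂.compile d) _ _ _ (by rwa [hv₁]) hx₂)
        rw [hv₁] at h
        simpa only [Cmd.cost, Cmd.compile, if_pos he] using h
      · simpa only [Cmd.eval, if_pos he] using hσ₂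
    · obtain ⟨τ₂, hx₂, hσ₂, hr₂⟩ := ih₂ d τ₁ S hd hσ₁
      refine ⟨τ₂, ?_, ?_, fun r h1 h2 => by rw [hr₂ r h1 h2, hr₁ r h2]⟩
      · have h := Exec.seq _ _ _ _ _ _ _ hx₁
          (Exec.ite_false d (c₁.compile d) _ _ _ _ (by rw [hv₁]; exact not_not.mp he) hx₂)
        rw [hv₁] at h
        simpa only [Cmd.cost, Cmd.compile, if_neg he] using h
      · simpa only [Cmd.eval, if_neg he] using hσ₂
  | rep e c ih =>
    intro d σ S hd hσ
    obtain ⟨τ₁, hx₁, hv₁, hr₁, hm₁, hc₁⟩ := e.compile_correct tape d σ S hd hσ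
    have hσ₁ := hσ.of_agree hd hr₁ hm₁ hc₁
    have key : ∀ (k : ℕ) (σ : Config) (S : St), Rel σ S → σ.reg d = k → ∃ τ,
        Exec tape (.loop d (.seq (c.compile (d + 1))
          (.seq (.const (d + 1) 1) (.arith .sub d d (d + 1))))) σ
          (repCost (c.eval tape) (c.cost tape) k S) τ ∧
        Rel τ ((c.eval tape)^[k] S) ∧ (∀ r, 41 ≤ r → r < d → τ.reg r = σ.reg r) := by
      intro k
      induction k with
      | zero =>
        intro σ S hσ hk
        refine ⟨σ, ?_, hσ, fun _ _ _ => rfl⟩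
        have h := Exec.loop_false (tape := tape) d (.seq (c.compile (d + 1))
          (.seq (.const (d + 1) 1) (.arith .sub d d (d + 1)))) σ hk
        simpa [hk, repCost] using h
      | succ k ihk =>
        intro σ S hσ hk
        obtain ⟨τ₂, hx₂, hσ₂, hr₂⟩ := ih (d + 1) σ S (by omega) hσ
        have hd₂ : τ₂.reg d = k + 1 := by rw [hr₂ d hd (by omega), hk]
        have hy := Exec.seq _ _ _ _ _ _ _ hx₂ (Exec.seq _ _ _ _ _ _ _
          (Exec.const (tape := tape) (d + 1) 1 τ₂) (Exec.arith .sub d d (d + 1) _))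
        simp only [Function.update_self, Function.update_of_ne (show d ≠ d + 1 by omega), hd₂,
          Nat.size_one] at hy
        obtain ⟨τ₃, hx₃, hσ₃, hr₃⟩ := ihk _ (c.eval tape S)
          (hσ₂.of_agree (τ := ⟨Function.update (Function.update τ₂.reg (d + 1) 1) d
            (BinOp.sub.eval (k + 1) 1), τ₂.mem, τ₂.coins⟩) hd (fun r hr => by
              simp [Function.update_of_ne hr.ne, Function.update_of_ne (show r ≠ d + 1 by omega)])
            rfl rfl) (by simp [BinOp.eval])
        refine ⟨τ₃, ?_, by simpa using hσ₃, fun r h1 h2 => ?_⟩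
        · have h := Exec.loop_true d _ _ _ _ _ _ (by omega) hy hx₃
          rw [hk] at h
          convert h using 1
          simp only [repCost]
          ring
        · rw [hr₃ r h1 h2, ← hr₂ r h1 (by omega)]
          simp [Function.update_of_ne h2.ne, Function.update_of_ne (show r ≠ d + 1 by omega)]
    obtain ⟨τ₂, hx₂, hσ₂, hr₂⟩ := key _ τ₁ S hσ₁ hv₁
    exact ⟨τ₂, Exec.seq _ _ _ _ _ _ _ hx₁ hx₂, hσ₂, fun r h1 h2 => by
      rw [hr₂ r h1 h2, hr₁ r h2]⟩

/-! ### Word lengths, cost bounds and the loop rule -/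

/-- All variables and all memory cells hold numbers of at most `W` bits. -/
structure Bdd (W : ℕ) (S : St) : Prop where
  v : ∀ x, S.v x < 2 ^ W
  m : ∀ a, S.m a < 2 ^ W

theorem Bdd.mono {W W' : ℕ} {S : St} (h : Bdd W S) (hW : W ≤ W') : Bdd W' S :=
  ⟨fun x => (h.v x).trans_le (Nat.pow_le_pow_right two_pos hW),
    fun a => (h.m a).trans_le (Nat.pow_le_pow_right two_pos hW)⟩

theorem Bdd.set {W : ℕ} {S : St} (h : Bdd W S) (x : Var) {a : ℕ} (ha : a < 2 ^ W) :
    Bdd W (S.set x a) :=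
  ⟨fun y => by rw [St.set_v]; split_ifs <;> [exact ha; exact h.v y], fun b => h.m b⟩

theorem Bdd.write {W : ℕ} {S : St} (h : Bdd W S) (a : ℕ) {y : ℕ} (hy : y < 2 ^ W) :
    Bdd W (S.write a y) :=
  ⟨fun x => h.v x, fun b => by rw [St.write_m]; split_ifs <;> [exact hy; exact h.m b]⟩

theorem Bdd.tick {W : ℕ} {S : St} (h : Bdd W S) : Bdd W S.tick := ⟨h.v, h.m⟩

theorem BinOp.size_eval_le (o : BinOp) (x y : ℕ) :
    Nat.size (o.eval x y) ≤ Nat.size x + Nat.size y + 1 := by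
  have hx := Nat.lt_size_self x
  have hy := Nat.lt_size_self y
  have hx' : x ≤ 2 ^ (x.size + y.size) := hx.le.trans (Nat.pow_le_pow_right two_pos (by omega))
  have hy' : y ≤ 2 ^ (x.size + y.size) := hy.le.trans (Nat.pow_le_pow_right two_pos (by omega))
  have hxl : x < 2 ^ (x.size + y.size) := hx.trans_le (Nat.pow_le_pow_right two_pos (by omega))
  rw [Nat.size_le, pow_succ]
  cases o with
  | add => simp only [BinOp.eval]; omega
  | sub => simp only [BinOp.eval]; omega
  | mul =>
    simp only [BinOp.eval]
    calc x * y < 2 ^ x.size * 2 ^ y.size := Nat.mul_lt_mul'' hx hy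
      _ = 2 ^ (x.size + y.size) := (pow_add _ _ _).symm
      _ ≤ _ := by omega
  | div =>
    simp only [BinOp.eval]
    have := Nat.div_le_self x y
    omega

/-- A factor for the cost of an expression. -/
def Expr.K : Expr → ℕ
  | .var _ => 2
  | .const c => 1 + Nat.size c
  | .op _ e₁ e₂ => 2 * (e₁.K + e₂.K) + 1
  | .load e => 2 * e.K + 1

/-- The two bounds go together: the cost of an operation involves the lengths of the values of its
operands. -/
theorem Expr.size_le_and_cost_le {W : ℕ} {S : St} (h : Bdd W S) (e : Expr) :
    Nat.size (e.eval S) ≤ e.K * (W + 1) ∧ e.cost S ≤ e.K * (W + 1) := by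
  induction e with
  | var x =>
    have := Nat.size_le.2 (h.v x)
    simp only [Expr.eval, Expr.cost, Expr.K]
    omega
  | const c =>
    simp only [Expr.eval, Expr.cost, Expr.K]
    constructor <;> nlinarith
  | op o e₁ e₂ ih₁ ih₂ =>
    have := BinOp.size_eval_le o (e₁.eval S) (e₂.eval S)
    simp only [Expr.eval, Expr.cost, Expr.K]
    constructor <;> nlinarith
  | load e ih =>
    have := Nat.size_le.2 (h.m (e.eval S))
    simp only [Expr.eval, Expr.cost, Expr.K]
    constructor <;> nlinarith

theorem Expr.size_le {W : ℕ} {S : St} (h : Bdd W S) (e : Expr) :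
    Nat.size (e.eval S) ≤ e.K * (W + 1) := (e.size_le_and_cost_le h).1

theorem Expr.cost_le {W : ℕ} {S : St} (h : Bdd W S) (e : Expr) :
    e.cost S ≤ e.K * (W + 1) := (e.size_le_and_cost_le h).2

theorem Expr.one_le_K (e : Expr) : 1 ≤ e.K := by
  cases e <;> simp only [Expr.K] <;> omega

/-- Programs without loops. -/
def Cmd.Straight : Cmd → Bool
  | .seq c₁ c₂ => c₁.Straight && c₂.Straight
  | .ite _ c₁ c₂ => c₁.Straight && c₂.Straight
  | .rep _ _ => false
  | _ => true

/-- A factor for the cost of a program without loops. -/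
def Cmd.K : Cmd → ℕ
  | .skip => 1
  | .assign _ e => 2 * e.K + 2
  | .store a e => 2 * (a.K + e.K) + 1
  | .flip _ => 1
  | .seq c₁ c₂ => c₁.K + c₂.K * (c₁.K + 1)
  | .ite e c₁ c₂ => 2 * e.K + 1 + c₁.K + c₂.K
  | .rep _ _ => 0

/-- Each operation at most adds up word lengths, so without loops the word length grows only by a
constant factor. Under iteration this factor would compound; therefore loops are treated with
invariants that keep a fixed `W`. -/
theorem Cmd.bdd_and_cost_le (tape : ℕ → Bool) (c : Cmd) (hc : c.Straight) : ∀ {W : ℕ} {S : St},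
    Bdd W S → Bdd (c.K * (W + 1)) (c.eval tape S) ∧ c.cost tape S ≤ c.K * (W + 1) := by
  induction c with
  | skip =>
    intro W S h
    exact ⟨h.mono (by simp [Cmd.K]), by simp [Cmd.cost, Cmd.K]⟩
  | assign x e =>
    intro W S h
    have h1 := e.size_le h
    have h2 := e.cost_le h
    have h3 := e.one_le_K
    refine ⟨(h.mono (by simp only [Cmd.K]; nlinarith)).set x (Nat.size_le.1 ?_), ?_⟩
    · exact h1.trans (Nat.mul_le_mul_right _ (by simp only [Cmd.K]; omega))
    · simp only [Cmd.cost, Cmd.K]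
      nlinarith
  | store a e =>
    intro W S h
    have h1 := e.size_le h
    have h2 := e.cost_le h
    have h3 := a.size_le h
    have h4 := a.cost_le h
    refine ⟨(h.mono (by simp only [Cmd.K]; nlinarith)).write _ (Nat.size_le.1 ?_), ?_⟩
    · exact h1.trans (Nat.mul_le_mul_right _ (by simp only [Cmd.K]; omega))
    · simp only [Cmd.cost, Cmd.K]
      nlinarith
  | flip x =>
    intro W S h
    refine ⟨((h.mono (by simp [Cmd.K])).set x ?_).tick, by simp [Cmd.cost, Cmd.K]⟩
    calc (tape S.coins).toNat < 2 := by cases tape S.coins <;> simp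
      _ = 2 ^ 1 := rfl
      _ ≤ 2 ^ (Cmd.K (.flip x) * (W + 1)) := Nat.pow_le_pow_right two_pos (by simp [Cmd.K])
  | seq c₁ c₂ ih₁ ih₂ =>
    intro W S h
    simp only [Cmd.Straight, Bool.and_eq_true] at hc
    obtain ⟨h1, h2⟩ := ih₁ hc.1 h
    obtain ⟨h3, h4⟩ := ih₂ hc.2 h1
    have h5 : c₂.K * (c₁.K * (W + 1) + 1) ≤ c₂.K * (c₁.K + 1) * (W + 1) := by
      rw [mul_assoc]
      exact Nat.mul_le_mul_left _ (by nlinarith)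
    refine ⟨h3.mono (h5.trans (Nat.mul_le_mul_right _ ?_)), ?_⟩
    · simp only [Cmd.K]
      omega
    · simp only [Cmd.cost, Cmd.K]
      nlinarith
  | ite e c₁ c₂ ih₁ ih₂ =>
    intro W S h
    simp only [Cmd.Straight, Bool.and_eq_true] at hc
    have h1 := e.size_le h
    have h2 := e.cost_le h
    obtain ⟨h3, h4⟩ := ih₁ hc.1 h
    obtain ⟨h5, h6⟩ := ih₂ hc.2 h
    simp only [Cmd.cost, Cmd.K, Cmd.eval]
    split_ifs
    · exact ⟨h3.mono (Nat.mul_le_mul_right _ (by omega)), by nlinarith⟩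
    · exact ⟨h5.mono (Nat.mul_le_mul_right _ (by omega)), by nlinarith⟩
  | rep e c => simp [Cmd.Straight] at hc

theorem Cmd.cost_le (tape : ℕ → Bool) (c : Cmd) (hc : c.Straight) {W : ℕ} {S : St}
    (h : Bdd W S) : c.cost tape S ≤ c.K * (W + 1) := (c.bdd_and_cost_le tape hc h).2

theorem repCost_le {f : St → St} {cost : St → ℕ} {A B : ℕ} {I : ℕ → St → Prop} (N : ℕ)
    (hs : ∀ t < N, ∀ S, I t S → I (t + 1) (f S)) (hcost : ∀ t < N, ∀ S, I t S → cost S ≤ A)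
    (hB : Nat.size N ≤ B) : ∀ k t S, t + k = N → I t S →
      repCost f cost k S ≤ 1 + k * (A + 2 * B + 5) := by
  intro k
  induction k with
  | zero => intro t S _ _; simp [repCost]
  | succ k ih =>
    intro t S htk hI
    have h1 := ih (t + 1) (f S) (by omega) (hs t (by omega) S hI)
    have h2 := hcost t (by omega) S hI
    have h3 : Nat.size (k + 1) ≤ B := (Nat.size_le_size (by omega)).trans hB
    simp only [repCost]
    nlinarith

theorem iterate_inv {f : St → St} {I : ℕ → St → Prop} {N : ℕ} {S : St} (h0 : I 0 S)
    (hs : ∀ t < N, ∀ S, I t S → I (t + 1) (f S)) : I N (f^[N] S) := by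
  induction N with
  | zero => simpa using h0
  | succ N ih =>
    rw [Function.iterate_succ_apply']
    exact hs N (by omega) _ (ih fun t ht => hs t (by omega))

/-- The rule for loops. -/
theorem Cmd.rep_rule {tape : ℕ → Bool} {e : Expr} {c : Cmd} {S : St} (I : ℕ → St → Prop)
    {N A W : ℕ} (hN : e.eval S = N) (hW : Bdd W S) (h0 : I 0 S)
    (hs : ∀ t < N, ∀ S, I t S → I (t + 1) (c.eval tape S) ∧ c.cost tape S ≤ A) :
    I N ((Cmd.rep e c).eval tape S) ∧
      (Cmd.rep e c).cost tape S ≤ (N + 1) * (A + (3 * e.K + 6) * (W + 1)) := by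
  constructor
  · simp only [Cmd.eval, hN]
    exact iterate_inv h0 fun t ht S hS => (hs t ht S hS).1
  · have h1 := e.size_le hW
    have h2 := e.cost_le hW
    have h3 := repCost_le (f := c.eval tape) (cost := c.cost tape) (A := A) (I := I) N
      (fun t ht S hS => (hs t ht S hS).1) (fun t ht S hS => (hs t ht S hS).2) (hN ▸ h1) N 0 S
      (by omega) h0
    simp only [Cmd.cost, hN]
    nlinarith

/-- The variables that a program may modify. -/
def Cmd.mods : Cmd → List Var
  | .assign x _ => [x]
  | .flip x => [x]
  | .seq c₁ c₂ => c₁.mods ++ c₂.mods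
  | .ite _ c₁ c₂ => c₁.mods ++ c₂.mods
  | .rep _ c => c.mods
  | _ => []

/-- The frame rule. For concrete programs the hypothesis is settled by `decide`. -/
theorem Cmd.eval_v_of_notMem (tape : ℕ → Bool) (c : Cmd) {x : Var} (hx : x ∉ c.mods) (S : St) :
    (c.eval tape S).v x = S.v x := by
  induction c generalizing S with
  | assign y e => simp only [Cmd.mods, List.mem_singleton] at hx; simp [Cmd.eval, hx]
  | flip y => simp only [Cmd.mods, List.mem_singleton] at hx; simp [Cmd.eval, hx]
  | seq c₁ c₂ ih₁ ih₂ =>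
    simp only [Cmd.mods, List.mem_append, not_or] at hx
    simp [Cmd.eval, ih₁ hx.1, ih₂ hx.2]
  | ite e c₁ c₂ ih₁ ih₂ =>
    simp only [Cmd.mods, List.mem_append, not_or] at hx
    simp only [Cmd.eval]
    split_ifs <;> simp [ih₁ hx.1, ih₂ hx.2]
  | rep e c ih =>
    simp only [Cmd.eval]
    exact iterate_inv (I := fun _ S' => S'.v x = S.v x) rfl fun t _ S' h => (ih hx S').trans h
  | _ => rfl

/-- A sequence of programs. -/
def block : List Cmd → Cmd
  | [] => .skip
  | c :: l => .seq c (block l)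

section
variable (tape : ℕ → Bool) (S : St)
@[simp] theorem eval_skip : Cmd.eval tape .skip S = S := rfl
@[simp] theorem eval_assign (x : Var) (e : Expr) :
    Cmd.eval tape (.assign x e) S = S.set x (e.eval S) := rfl
@[simp] theorem eval_store (a e : Expr) :
    Cmd.eval tape (.store a e) S = S.write (a.eval S) (e.eval S) := rfl
@[simp] theorem eval_seq (c₁ c₂ : Cmd) :
    Cmd.eval tape (.seq c₁ c₂) S = c₂.eval tape (c₁.eval tape S) := rfl
@[simp] theorem eval_block_nil : Cmd.eval tape (block []) S = S := rfl
@[simp] theorem eval_block_cons (c : Cmd) (l : List Cmd) :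
    Cmd.eval tape (block (c :: l)) S = (block l).eval tape (c.eval tape S) := rfl
theorem eval_ite_pos {e : Expr} (c₁ c₂ : Cmd) (h : e.eval S ≠ 0) :
    Cmd.eval tape (.ite e c₁ c₂) S = c₁.eval tape S := if_pos h
theorem eval_ite_neg {e : Expr} (c₁ c₂ : Cmd) (h : e.eval S = 0) :
    Cmd.eval tape (.ite e c₁ c₂) S = c₂.eval tape S := if_neg (not_not.2 h)
end

/-! ### Counting completions by dynamic programming -/

/-- The parameters of an enumeration: `n` items with the values `b`, keys modulo `q`, residues
modulo `p`, item `i` having the residue `b i * al + be`. Only the items from `lo` up to `hi` may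
have nonzero digits; the digits `1` and `2` are allowed if `f1` and `f2`, respectively, are `1`.
The total residue has to be `k`. -/
structure Par : Type where
  (n p q al be lo hi f1 f2 k : ℕ)
  b : ℕ → ℕ

namespace Par
variable (P : Par)

/-- Whether the item `i` is active. -/
def act (i : ℕ) : ℕ := (1 - (P.lo - i)) * (1 - (i + 1 - P.hi))

/-- The residue after a nonzero digit at `i`. -/
def step (i r : ℕ) : ℕ := (r + (P.b i * P.al + P.be)) % P.p

/-- The number of ways to complete a residue with the last `u` digits. -/
def count : ℕ → ℕ → ℕ
  | 0, r => 1 - ((r - P.k) + (P.k - r))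
  | u + 1, r => count u r +
      P.act (P.n - (u + 1)) * (P.f1 + P.f2) * count u (P.step (P.n - (u + 1)) r)

theorem act_le_one (i : ℕ) : P.act i ≤ 1 := by
  unfold act
  calc _ ≤ 1 * 1 := Nat.mul_le_mul (Nat.sub_le _ _) (Nat.sub_le _ _)
    _ = 1 := rfl

theorem act_eq_one_iff (i : ℕ) : P.act i = 1 ↔ P.lo ≤ i ∧ i < P.hi := by
  unfold act
  rw [mul_eq_one]
  omega

/-- A crude bound, needed only for the table entries to fit into a word. -/
theorem count_le (h : P.f1 + P.f2 ≤ 2) (u r : ℕ) : P.count u r ≤ 3 ^ u := by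
  induction u generalizing r with
  | zero => simp [count]
  | succ u ih =>
    simp only [count, pow_succ]
    have h1 := ih r
    have h2 : P.act (P.n - (u + 1)) * (P.f1 + P.f2) * P.count u (P.step (P.n - (u + 1)) r)
        ≤ 1 * 2 * 3 ^ u := Nat.mul_le_mul (Nat.mul_le_mul (P.act_le_one _) h) (ih _)
    omega

/-- The state `S` holds the parameters. -/
structure Vars (S : St) : Prop where
  n : S.v .n = P.n
  p : S.v .p = P.p
  q : S.v .q = P.q
  al : S.v .al = P.al
  be : S.v .be = P.be
  lo : S.v .lo = P.lo
  hi : S.v .hi = P.hi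
  f1 : S.v .f1 = P.f1
  f2 : S.v .f2 = P.f2
  k : S.v .k = P.k
  b : ∀ i < P.n, S.m i = P.b i

end Par

/-- The address of an entry of the array with the number `t`. -/
def cell (t e : Expr) : Expr := 2 * Var.n + (6 * e + t)

/-- One entry of the table of the numbers of completions. -/
def tableBody : Cmd := block [
  .assign .x (Var.x - 1),
  .assign .i (Var.x / Var.p),
  .assign .res (Var.x % Var.p),
  .ite (Var.n - Var.i)
    (block [
      .assign .b (.load Var.i),
      .assign .res' ((Var.res + (Var.b * Var.al + Var.be)) % Var.p),
      .assign .w ((1 - (Var.lo - Var.i)) * (1 - (Var.i + 1 - Var.hi))),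
      .store (cell 0 Var.x) (.load (cell 0 (Var.x + Var.p)) +
        Var.w * (Var.f1 + Var.f2) * .load (cell 0 ((Var.i + 1) * Var.p + Var.res')))])
    (.store (cell 0 Var.x) (1 - ((Var.res - Var.k) + (Var.k - Var.res))))]

/-- Compute the table of the numbers of completions. -/
def table : Cmd := block [
  .assign .x ((Var.n + 1) * Var.p),
  .rep ((Var.n + 1) * Var.p) tableBody]

/-- Bounds for the parameters. -/
structure Par.Fits (P : Par) (W : ℕ) : Prop where
  p_pos : 0 < P.p
  q_pos : 0 < P.q
  f1_le : P.f1 ≤ 1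
  f2_le : P.f2 ≤ 1
  table : (P.n + 1) * P.p < 2 ^ W
  q_lt : P.q < 2 ^ W
  codes : 3 ^ P.n < 2 ^ W
  n_lt : 4 * P.n + 4 < 2 ^ W

/-- The loop invariant of `table`. -/
structure TableInv (P : Par) (W : ℕ) (S₀ : St) (t : ℕ) (S : St) : Prop where
  bdd : Bdd W S
  x : S.v .x = (P.n + 1) * P.p - t
  frame : ∀ x ∉ tableBody.mods, S.v x = S₀.v x
  done : ∀ y < (P.n + 1) * P.p, (P.n + 1) * P.p - t ≤ y →
    S.m (2 * P.n + 6 * y) = P.count (P.n - y / P.p) (y % P.p)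
  rest : ∀ a, (∀ y, a ≠ 2 * P.n + 6 * y) → S.m a = S₀.m a

/-- The cell `y = i * p + r` belongs to stage `i` and residue `r`. The index runs downwards, so both
entries of stage `i + 1` that the recursion for stage `i` reads are already present. -/
theorem tableBody_spec {P : Par} {W : ℕ} (hP : P.Fits W) {S₀ : St} (h₀ : P.Vars S₀)
    {tape : ℕ → Bool} {t : ℕ} (ht : t < (P.n + 1) * P.p) {S : St} (h : TableInv P W S₀ t S) :
    TableInv P W S₀ (t + 1) (tableBody.eval tape S) := by
  obtain ⟨y, hy⟩ : ∃ y, y = (P.n + 1) * P.p - (t + 1) := ⟨_, rfl⟩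
  have hfr : ∀ x ∉ tableBody.mods, (tableBody.eval tape S).v x = S₀.v x := fun x hx => by
    rw [Cmd.eval_v_of_notMem tape _ hx, h.frame x hx]
  have hn : S.v .n = P.n := (h.frame _ (by decide)).trans h₀.n
  have hp : S.v .p = P.p := (h.frame _ (by decide)).trans h₀.p
  have hal : S.v .al = P.al := (h.frame _ (by decide)).trans h₀.al
  have hbe : S.v .be = P.be := (h.frame _ (by decide)).trans h₀.be
  have hlo : S.v .lo = P.lo := (h.frame _ (by decide)).trans h₀.lo
  have hhi : S.v .hi = P.hi := (h.frame _ (by decide)).trans h₀.hi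
  have hf1 : S.v .f1 = P.f1 := (h.frame _ (by decide)).trans h₀.f1
  have hf2 : S.v .f2 = P.f2 := (h.frame _ (by decide)).trans h₀.f2
  have hk : S.v .k = P.k := (h.frame _ (by decide)).trans h₀.k
  have hb : ∀ i < P.n, S.m i = P.b i := fun i hi => by
    rw [h.rest i (by omega), h₀.b i hi]
  have hx : S.v .x - 1 = y := by rw [h.x]; omega
  have hyN : y < (P.n + 1) * P.p := by omega
  have hyW : y < 2 ^ W := hyN.trans hP.table
  have hpW : P.p < 2 ^ W := by rw [← hp]; exact h.bdd.v _
  have hr : y % P.p < P.p := Nat.mod_lt _ hP.p_pos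
  have hi : y / P.p < P.n + 1 := Nat.div_lt_of_lt_mul (by rwa [mul_comm])
  have key : ∃ T : St, tableBody.eval tape S =
      T.write (2 * P.n + 6 * y) (P.count (P.n - y / P.p) (y % P.p)) ∧ Bdd W T ∧ T.v .x = y ∧
      T.m = S.m := by
    have b1 : Bdd W (((S.set .x y).set .i (y / P.p)).set .res (y % P.p)) :=
      ((h.bdd.set _ hyW).set _ ((Nat.div_le_self _ _).trans_lt hyW)).set _ (hr.trans hpW)
    by_cases hin : P.n - y / P.p ≠ 0
    · have e1 : (y + P.p) / P.p = y / P.p + 1 := Nat.add_div_right _ hP.p_pos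
      have hst : P.step (y / P.p) (y % P.p) < P.p := Nat.mod_lt _ hP.p_pos
      have e2 : ((y / P.p + 1) * P.p + P.step (y / P.p) (y % P.p)) / P.p = y / P.p + 1 := by
        rw [add_comm, Nat.add_mul_div_right _ _ hP.p_pos, Nat.div_eq_of_lt hst, zero_add]
      have e3 : ((y / P.p + 1) * P.p + P.step (y / P.p) (y % P.p)) % P.p =
          P.step (y / P.p) (y % P.p) := by
        rw [add_comm, Nat.add_mul_mod_self_right, Nat.mod_eq_of_lt hst]
      have hyd := Nat.div_add_mod y P.p
      have hle : (y / P.p + 1) * P.p + P.p ≤ (P.n + 1) * P.p := by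
        calc _ = (y / P.p + 2) * P.p := by ring
          _ ≤ _ := Nat.mul_le_mul_right _ (by omega)
      have hyd' : (y / P.p + 1) * P.p = P.p * (y / P.p) + P.p := by ring

      have d1 := h.done (y + P.p) (by nlinarith) (by have hpp := hP.p_pos; omega)
      have d2 := h.done ((y / P.p + 1) * P.p + P.step (y / P.p) (y % P.p)) (by omega)
        (by have hpp := hP.p_pos; rw [hyd']; omega)
      rw [e1, Nat.add_mod_right] at d1
      rw [e2, e3] at d2
      obtain ⟨u, hu⟩ : ∃ u, P.n - y / P.p = u + 1 := ⟨P.n - y / P.p - 1, by omega⟩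
      have hu' : P.n - (y / P.p + 1) = u := by omega
      have hu'' : P.n - (u + 1) = y / P.p := by rw [← hu]; exact Nat.sub_sub_self (by omega)
      refine ⟨(((((S.set .x y).set .i (y / P.p)).set .res (y % P.p)).set .b
        (P.b (y / P.p))).set .res' (P.step (y / P.p) (y % P.p))).set .w (P.act (y / P.p)),
        ?_, ?_, by simp, by simp⟩
      · simp only [tableBody, eval_block_cons, eval_block_nil, eval_assign, Expr.eval_sub,
          Expr.eval_var, Expr.eval_ofNat, hx, Expr.eval_div, Expr.eval_mod, St.set_v, hp, if_true,
          reduceCtorEq, if_false]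
        rw [eval_ite_pos _ _ _ _ (by simpa [hn] using hin)]
        simp [-Nat.mod_add_mod, cell, hn, hp, hal, hbe, hlo, hhi, hf1, hf2, hb _ (show y / P.p < P.n by omega),
          hu, Par.count, hu'']
        rw [hu'] at d1 d2
        simp only [Par.step, Par.act] at d2 ⊢
        rw [d1, d2]
      · refine ((b1.set _ ?_).set _ (hst.trans hpW)).set _ ?_
        · rw [← hb _ (show y / P.p < P.n by omega)]
          exact h.bdd.m _
        · exact (P.act_le_one _).trans_lt (Nat.lt_of_le_of_lt hP.p_pos hpW)
    · refine ⟨_, ?_, b1, by simp, by simp⟩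
      simp only [tableBody, eval_block_cons, eval_block_nil, eval_assign, Expr.eval_sub,
        Expr.eval_var, Expr.eval_ofNat, hx, Expr.eval_div, Expr.eval_mod, St.set_v, hp, if_true,
        reduceCtorEq, if_false]
      rw [eval_ite_neg _ _ _ _ (by simpa [hn] using hin)]
      simp [cell, hn, hk, not_not.1 hin, Par.count]
  obtain ⟨T, hT, hTb, hTx, hTm⟩ := key
  have hcW : P.count (P.n - y / P.p) (y % P.p) < 2 ^ W :=
    ((P.count_le (Nat.add_le_add hP.f1_le hP.f2_le) _ _).trans (Nat.pow_le_pow_right (by norm_num) (Nat.sub_le _ _))).trans_lt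
      hP.codes
  refine ⟨?_, ?_, hfr, ?_, ?_⟩
  · rw [hT]
    exact hTb.write _ hcW
  · rw [hT, St.write_v, hTx, hy]
  · intro z hz htz
    rw [hT, St.write_m]
    split_ifs with hzy
    · have : z = y := by omega
      rw [this]
    · rw [hTm]
      exact h.done z hz (by omega)
  · intro a ha
    rw [hT, St.write_m, if_neg (ha y), hTm, h.rest a ha]

theorem cost_block_nil (tape : ℕ → Bool) (S : St) : (block []).cost tape S = 1 := rfl

theorem cost_block_cons (tape : ℕ → Bool) (S : St) (c : Cmd) (l : List Cmd) :
    (block (c :: l)).cost tape S = c.cost tape S + (block l).cost tape (c.eval tape S) := rfl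

theorem loop_cost_le {a b k k' k'' W N M : ℕ} (ha : a ≤ k'' * (W + 1))
    (hb : b ≤ (N + 1) * (k' * (W + 1) + k * (W + 1))) (hN : N ≤ M) :
    a + (b + 1) ≤ (k'' + 1 + (k' + k)) * ((M + 1) * (W + 1)) := by
  have h1 : (N + 1) * (k' * (W + 1) + k * (W + 1)) ≤ (M + 1) * (k' * (W + 1) + k * (W + 1)) :=
    Nat.mul_le_mul_right _ (by omega)
  have h2 : k'' * (W + 1) ≤ k'' * ((M + 1) * (W + 1)) :=
    Nat.mul_le_mul_left _ (Nat.le_mul_of_pos_left _ (by omega))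
  have h3 : 1 ≤ (M + 1) * (W + 1) := Nat.mul_pos (by omega) (by omega)
  calc a + (b + 1) ≤ k'' * ((M + 1) * (W + 1)) +
        ((M + 1) * (k' * (W + 1) + k * (W + 1)) + (M + 1) * (W + 1)) := by omega
    _ = _ := by ring

theorem Par.Vars.of_frame {P : Par} {S S' : St} (h : P.Vars S) {c : Cmd}
    (hv : ∀ x ∉ c.mods, S'.v x = S.v x) (hb : ∀ i < P.n, S'.m i = S.m i)
    (hc : ∀ x ∈ [Var.n, .p, .q, .al, .be, .lo, .hi, .f1, .f2, .k], x ∉ c.mods := by decide) :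
    P.Vars S' where
  n := (hv _ (hc _ (by simp))).trans h.n
  p := (hv _ (hc _ (by simp))).trans h.p
  q := (hv _ (hc _ (by simp))).trans h.q
  al := (hv _ (hc _ (by simp))).trans h.al
  be := (hv _ (hc _ (by simp))).trans h.be
  lo := (hv _ (hc _ (by simp))).trans h.lo
  hi := (hv _ (hc _ (by simp))).trans h.hi
  f1 := (hv _ (hc _ (by simp))).trans h.f1
  f2 := (hv _ (hc _ (by simp))).trans h.f2
  k := (hv _ (hc _ (by simp))).trans h.k
  b := fun i hi => (hb i hi).trans (h.b i hi)

/-- The table of the numbers of completions is in the memory. -/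
def Par.Table (P : Par) (S : St) : Prop :=
  ∀ i ≤ P.n, ∀ r < P.p, S.m (2 * P.n + 6 * (i * P.p + r)) = P.count (P.n - i) r

theorem table_spec : ∃ K : ℕ, ∀ {P : Par} {W : ℕ} {S : St} {tape : ℕ → Bool}, P.Fits W →
    P.Vars S → Bdd W S →
      Bdd W (table.eval tape S) ∧ P.Table (table.eval tape S) ∧
      (∀ a, (∀ y, a ≠ 2 * P.n + 6 * y) → (table.eval tape S).m a = S.m a) ∧
      table.cost tape S ≤ K * (((P.n + 1) * P.p + 1) * (W + 1)) := by
  obtain ⟨c, hc⟩ : ∃ c : Cmd, c = .assign .x ((Var.n + 1) * Var.p) := ⟨_, rfl⟩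
  refine ⟨c.K + 1 + (tableBody.K + (3 * ((Var.n + 1) * Var.p : Expr).K + 6)), ?_⟩
  intro P W S tape hP hS hW
  have h1 : c.eval tape S = S.set .x ((P.n + 1) * P.p) := by simp [hc, hS.n, hS.p]
  have hW1 : Bdd W (c.eval tape S) := by rw [h1]; exact hW.set _ hP.table
  have hc1 : c.cost tape S ≤ c.K * (W + 1) := Cmd.cost_le tape c (by rw [hc]; rfl) hW
  have hfr : ∀ x ∉ tableBody.mods, (c.eval tape S).v x = S.v x := fun x hx => by
    rw [h1, St.set_v, if_neg]; rintro rfl; exact hx (by decide)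
  have hV : P.Vars (c.eval tape S) := hS.of_frame hfr (fun i _ => by rw [h1]; rfl)
  have hrep := Cmd.rep_rule (tape := tape) (e := (Var.n + 1) * Var.p) (c := tableBody)
    (S := c.eval tape S) (TableInv P W (c.eval tape S)) (N := (P.n + 1) * P.p)
    (A := tableBody.K * (W + 1)) (W := W) (by simp [hV.n, hV.p]) hW1
    ⟨hW1, by simp [h1], fun _ _ => rfl, fun y hy hy' => by omega, fun _ _ => rfl⟩
    (fun t ht T hT => ⟨tableBody_spec hP hV ht hT, Cmd.cost_le tape _ rfl hT.bdd⟩)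
  have hev : table.eval tape S =
      (Cmd.rep ((Var.n + 1) * Var.p) tableBody).eval tape (c.eval tape S) := by rw [hc]; rfl
  have hco : table.cost tape S = c.cost tape S +
      ((Cmd.rep ((Var.n + 1) * Var.p) tableBody).cost tape (c.eval tape S) + 1) := by rw [hc]; rfl
  obtain ⟨hI, hcost⟩ := hrep
  rw [← hev] at hI
  refine ⟨hI.bdd, ?_, ?_, ?_⟩
  · intro i hi r hr
    have hlt : i * P.p + r < (P.n + 1) * P.p := by
      calc i * P.p + r < i * P.p + P.p := by omega
        _ = (i + 1) * P.p := by ring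
        _ ≤ _ := Nat.mul_le_mul_right _ (by omega)
    rw [hI.done _ hlt (by omega), add_comm (i * P.p), Nat.add_mul_div_right _ _ hP.p_pos,
      Nat.div_eq_of_lt hr, zero_add, Nat.add_mul_mod_self_right, Nat.mod_eq_of_lt hr]
  · intro a ha
    rw [hI.rest a ha, h1]
    rfl
  · rw [hco]
    exact loop_cost_le hc1 hcost le_rfl

/-! ### The tree of prefixes that can be completed -/

/-- Nodes of the enumeration tree. -/
@[ext] structure Node : Type where
  (stage res key code : ℕ)

namespace Par
variable (P : Par)

/-- The residue of the first `i` digits. -/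
def resOf (f : ℕ → ℕ) : ℕ → ℕ
  | 0 => 0
  | i + 1 => if f i = 0 then resOf f i else P.step i (resOf f i)

/-- The key of the first `i` digits. -/
def keyOf (f : ℕ → ℕ) : ℕ → ℕ
  | 0 => 0
  | i + 1 => if f i = 0 then keyOf f i else
      if f i = 1 then (keyOf f i + P.b i) % P.q else (keyOf f i + (P.q - P.b i)) % P.q

/-- The first `i` digits as a number. -/
def codeOf (f : ℕ → ℕ) : ℕ → ℕ
  | 0 => 0
  | i + 1 => 3 * codeOf f i + f i

/-- The first `i` digits are admissible. -/
def Adm (f : ℕ → ℕ) (i : ℕ) : Prop :=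
  ∀ j < i, f j = 0 ∨ P.act j ≠ 0 ∧ (f j = 1 ∧ P.f1 ≠ 0 ∨ f j = 2 ∧ P.f2 ≠ 0)

/-- The node of the first `i` digits. -/
def node (f : ℕ → ℕ) (i : ℕ) : Node := ⟨i, P.resOf f i, P.keyOf f i, codeOf f i⟩

theorem node_congr {f g : ℕ → ℕ} {i : ℕ} (h : ∀ j < i, f j = g j) : P.node f i = P.node g i := by
  have : P.resOf f i = P.resOf g i ∧ P.keyOf f i = P.keyOf g i ∧ codeOf f i = codeOf g i := by
    induction i with
    | zero => exact ⟨rfl, rfl, rfl⟩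
    | succ i ih =>
      obtain ⟨h1, h2, h3⟩ := ih fun j hj => h j (by omega)
      simp only [resOf, keyOf, codeOf, h1, h2, h3, h i (by omega), and_self]
  simp [node, this]

theorem Adm.digit_lt {P : Par} {f : ℕ → ℕ} {i j : ℕ} (h : P.Adm f i) (hj : j < i) : f j < 3 := by
  have := h j hj
  omega

theorem codeOf_lt {f : ℕ → ℕ} {i : ℕ} (h : ∀ j < i, f j < 3) : codeOf f i < 3 ^ i := by
  induction i with
  | zero => simp [codeOf]
  | succ i ih =>
    have h1 := ih fun j hj => h j (by omega)
    have h2 := h i (by omega)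
    simp only [codeOf, pow_succ]
    omega

theorem resOf_lt (hp : 0 < P.p) (f : ℕ → ℕ) (i : ℕ) : P.resOf f i < P.p := by
  induction i with
  | zero => simpa [resOf] using hp
  | succ i ih =>
    simp only [resOf]
    split_ifs
    · exact ih
    · exact Nat.mod_lt _ hp

theorem keyOf_lt (hq : 0 < P.q) (f : ℕ → ℕ) (i : ℕ) : P.keyOf f i < P.q := by
  induction i with
  | zero => simpa [keyOf] using hq
  | succ i ih =>
    simp only [keyOf]
    split_ifs
    · exact ih
    · exact Nat.mod_lt _ hq
    · exact Nat.mod_lt _ hq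

/-- The extension of a node by the digit `0`. -/
def child0 (x : Node) : Node := ⟨x.stage + 1, x.res, x.key, 3 * x.code⟩

/-- The extension of a node by the digit `1`. -/
def child1 (x : Node) : Node :=
  ⟨x.stage + 1, P.step x.stage x.res, (x.key + P.b x.stage) % P.q, 3 * x.code + 1⟩

/-- The extension of a node by the digit `2`. -/
def child2 (x : Node) : Node :=
  ⟨x.stage + 1, P.step x.stage x.res, (x.key + (P.q - P.b x.stage)) % P.q, 3 * x.code + 2⟩

/-- The number of completions of a node. -/
def ways (x : Node) : ℕ := P.count (P.n - x.stage) x.res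

/-- The children of a node that can be completed. -/
def children (x : Node) : List Node :=
  if P.n - x.stage = 0 then [] else
    (if P.ways (child0 x) ≠ 0 then [child0 x] else []) ++
    (if P.act x.stage * P.f1 * P.ways (P.child1 x) ≠ 0 then [P.child1 x] else []) ++
    (if P.act x.stage * P.f2 * P.ways (P.child2 x) ≠ 0 then [P.child2 x] else [])

/-- A node that comes from admissible digits. -/
def Sound (x : Node) : Prop := ∃ f, ∃ i ≤ P.n, P.Adm f i ∧ x = P.node f i

theorem Adm.extend {P : Par} {f : ℕ → ℕ} {i d : ℕ} (h : P.Adm f i)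
    (hd : d = 0 ∨ P.act i ≠ 0 ∧ (d = 1 ∧ P.f1 ≠ 0 ∨ d = 2 ∧ P.f2 ≠ 0)) :
    P.Adm (Function.update f i d) (i + 1) := by
  intro j hj
  rcases Nat.lt_succ_iff_lt_or_eq.1 hj with hj | rfl
  · rw [Function.update_of_ne hj.ne]
    exact h j hj
  · rwa [Function.update_self]

theorem node_update (f : ℕ → ℕ) (i d : ℕ) : P.node (Function.update f i d) (i + 1) =
    if d = 0 then child0 (P.node f i) else
      if d = 1 then P.child1 (P.node f i) else
      ⟨i + 1, P.step i (P.resOf f i), (P.keyOf f i + (P.q - P.b i)) % P.q,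
        3 * codeOf f i + d⟩ := by
  have h : P.node (Function.update f i d) i = P.node f i :=
    P.node_congr fun j hj => Function.update_of_ne hj.ne _ _
  simp only [node, Node.mk.injEq, true_and] at h
  obtain ⟨h1, h2, h3⟩ := h
  simp only [node, resOf, keyOf, codeOf, Function.update_self, h1, h2, h3]
  split_ifs with h4 h5 <;> simp [child0, child1, *]

theorem Sound.children {P : Par} {x y : Node} (hx : P.Sound x) (hy : y ∈ P.children x) :
    P.Sound y := by
  obtain ⟨f, i, hi, hf, rfl⟩ := hx
  unfold Par.children at hy
  by_cases h0 : P.n - (P.node f i).stage = 0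
  · simp [h0] at hy
  rw [if_neg h0] at hy
  have hi' : i + 1 ≤ P.n := by simp only [node] at h0; omega
  simp only [List.mem_append] at hy
  rcases hy with (hy | hy) | hy <;> split_ifs at hy with h1 <;> simp at hy <;> subst hy
  · exact ⟨_, i + 1, hi', hf.extend (d := 0) (Or.inl rfl), by rw [node_update, if_pos rfl]⟩
  · refine ⟨_, i + 1, hi', hf.extend (d := 1) (Or.inr ⟨?_, Or.inl ⟨rfl, ?_⟩⟩), ?_⟩
    · rintro h; simp [node, h] at h1
    · rintro h; simp [h] at h1
    · rw [node_update, if_neg (by simp), if_pos rfl]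
  · refine ⟨_, i + 1, hi', hf.extend (d := 2) (Or.inr ⟨?_, Or.inr ⟨rfl, ?_⟩⟩), ?_⟩
    · rintro h; simp [node, h] at h1
    · rintro h; simp [h] at h1
    · rw [node_update, if_neg (by simp), if_neg (by simp)]; rfl

/-- The size of the tree of the completions of a residue. -/
def treeSize : ℕ → ℕ → ℕ
  | 0, r => if P.count 0 r = 0 then 0 else 1
  | u + 1, r => if P.count (u + 1) r = 0 then 0 else 1 + (treeSize u r +
      P.act (P.n - (u + 1)) * (P.f1 + P.f2) * treeSize u (P.step (P.n - (u + 1)) r))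

/-- Every node of the tree is a prefix of some completion, so each of the `u + 1` levels has at most
as many nodes as there are completions. The test for a nonzero count in `treeSize` is essential: it
supplies the 1 that pays for the node itself. -/
theorem treeSize_le (u r : ℕ) : P.treeSize u r ≤ (u + 1) * P.count u r := by
  induction u generalizing r with
  | zero => simp only [treeSize]; split_ifs <;> omega
  | succ u ih =>
    simp only [treeSize]
    split_ifs with h
    · omega
    · have h1 := ih r
      have h2 := Nat.mul_le_mul_left (P.act (P.n - (u + 1)) * (P.f1 + P.f2))
        (ih (P.step (P.n - (u + 1)) r))
      simp only [count] at h ⊢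
      nlinarith [Nat.pos_of_ne_zero h]

theorem treeSize_eq_zero_iff (u r : ℕ) : P.treeSize u r = 0 ↔ P.count u r = 0 := by
  cases u <;> simp only [treeSize] <;> split_ifs <;> simp_all

/-- The size of the tree below a node. -/
def weight (x : Node) : ℕ := P.treeSize (P.n - x.stage) x.res

/-- This identity makes the number of processed nodes plus the total weight of the waiting ones an
invariant of the breadth-first search. With `f1, f2 ≤ 1` a nonzero product of flags equals 1, so
each permitted child is counted exactly once. -/
theorem weight_eq {x : Node} (hx : P.ways x ≠ 0) (h1 : P.f1 ≤ 1) (h2 : P.f2 ≤ 1) :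
    P.weight x = 1 + ((P.children x).map P.weight).sum := by
  unfold children
  by_cases h0 : P.n - x.stage = 0
  · rw [if_pos h0]
    simp only [weight, ways, h0] at *
    simp [treeSize, hx]
  · rw [if_neg h0]
    obtain ⟨u, hu⟩ : ∃ u, P.n - x.stage = u + 1 := ⟨P.n - x.stage - 1, by omega⟩
    have hu' : P.n - (x.stage + 1) = u := by omega
    have hs : P.n - (u + 1) = x.stage := by omega
    have e0 : ((if P.ways (child0 x) ≠ 0 then [child0 x] else []).map P.weight).sum =
        P.treeSize u x.res := by
      split_ifs with h
      · simp [weight, child0, hu']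
      · simp only [ways, child0, hu', not_not] at h
        simpa using ((P.treeSize_eq_zero_iff _ _).2 h).symm
    have e1 : ((if P.act x.stage * P.f1 * P.ways (P.child1 x) ≠ 0 then [P.child1 x]
        else []).map P.weight).sum = P.act x.stage * P.f1 * P.treeSize u (P.step x.stage x.res) := by
      split_ifs with h
      · have ha := P.act_le_one x.stage
        have ha1 : P.act x.stage = 1 := by
          by_contra hne
          exact h (by simp [show P.act x.stage = 0 by omega])
        have hf1 : P.f1 = 1 := by
          by_contra hne
          exact h (by simp [show P.f1 = 0 by omega])
        simp [weight, child1, hu', ha1, hf1]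
      · simp only [ways, child1, hu', not_not, mul_eq_zero, ← P.treeSize_eq_zero_iff] at h
        symm
        simpa [mul_eq_zero] using h
    have e2 : ((if P.act x.stage * P.f2 * P.ways (P.child2 x) ≠ 0 then [P.child2 x]
        else []).map P.weight).sum = P.act x.stage * P.f2 * P.treeSize u (P.step x.stage x.res) := by
      split_ifs with h
      · have ha := P.act_le_one x.stage
        have ha1 : P.act x.stage = 1 := by
          by_contra hne
          exact h (by simp [show P.act x.stage = 0 by omega])
        have hf2 : P.f2 = 1 := by
          by_contra hne
          exact h (by simp [show P.f2 = 0 by omega])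
        simp [weight, child2, hu', ha1, hf2]
      · simp only [ways, child2, hu', not_not, mul_eq_zero, ← P.treeSize_eq_zero_iff] at h
        symm
        simpa [mul_eq_zero] using h
    rw [List.map_append, List.map_append, List.sum_append, List.sum_append, e0, e1, e2]
    simp only [ways, hu] at hx
    simp only [weight, hu, treeSize, hx, if_false, hs]
    ring

theorem ways_of_mem_children {x y : Node} (hy : y ∈ P.children x) : P.ways y ≠ 0 := by
  unfold children at hy
  by_cases h0 : P.n - x.stage = 0
  · simp [h0] at hy
  rw [if_neg h0] at hy
  simp only [List.mem_append] at hy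
  rcases hy with (hy | hy) | hy <;> split_ifs at hy with h1 <;> simp at hy <;> subst hy
  · exact h1
  · exact fun h => h1 (by simp [h])
  · exact fun h => h1 (by simp [h])

/-- The remaining digits of a completion are themselves one way to continue its prefix; hence no
prefix of a completion is pruned. -/
theorem count_ne_zero_of_adm {f : ℕ → ℕ} (hf : P.Adm f P.n) (hk : P.resOf f P.n = P.k)
    (u : ℕ) (hu : u ≤ P.n) : P.count u (P.resOf f (P.n - u)) ≠ 0 := by
  induction u with
  | zero => simp [count, hk]
  | succ u ih =>
    have h1 := ih (by omega)
    have hs : P.n - u = P.n - (u + 1) + 1 := by omega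
    rw [hs] at h1
    simp only [resOf] at h1
    simp only [count]
    split_ifs at h1 with h0
    · omega
    · rcases hf (P.n - (u + 1)) (by omega) with h2 | ⟨h2, h3⟩
      · exact absurd h2 h0
      · have h4 : P.act (P.n - (u + 1)) * (P.f1 + P.f2) ≠ 0 := mul_ne_zero h2 (by omega)
        have := mul_ne_zero h4 h1
        omega

/-- A list of nodes that is closed under children contains all completions. -/
theorem node_mem_of_closed {l : List Node} (h0 : P.node (fun _ => 0) 0 ∈ l)
    (hl : ∀ x ∈ l, ∀ y ∈ P.children x, y ∈ l) {f : ℕ → ℕ} (hf : P.Adm f P.n)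
    (hk : P.resOf f P.n = P.k) : P.node f P.n ∈ l := by
  have : ∀ i ≤ P.n, P.node f i ∈ l := by
    intro i hi
    induction i with
    | zero => exact h0
    | succ i ih =>
      refine hl _ (ih (by omega)) _ ?_
      have hw := P.count_ne_zero_of_adm hf hk (P.n - (i + 1)) (by omega)
      rw [show P.n - (P.n - (i + 1)) = i + 1 by omega] at hw
      unfold children
      rw [if_neg (by simp only [node]; omega)]
      have hu := P.node_update f i (f i)
      rw [Function.update_eq_self] at hu
      have hw' : P.ways (P.node f (i + 1)) ≠ 0 := hw
      rw [hu] at hw' ⊢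
      rcases hf i (by omega) with h1 | ⟨h1, ⟨h2, h3⟩ | ⟨h2, h3⟩⟩
      · rw [if_pos h1] at hw' ⊢
        simp [hw']
      · have h4 : f i ≠ 0 := by rw [h2]; decide
        rw [if_neg h4, if_pos h2] at hw' ⊢
        have : P.act (P.node f i).stage * P.f1 * P.ways (P.child1 (P.node f i)) ≠ 0 :=
          mul_ne_zero (mul_ne_zero h1 h3) hw'
        simp only [if_pos this]
        simp
      · have h4 : f i ≠ 0 := by rw [h2]; decide
        have h5 : f i ≠ 1 := by rw [h2]; decide
        rw [if_neg h4, if_neg h5, h2] at hw' ⊢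
        have : P.act (P.node f i).stage * P.f2 * P.ways (P.child2 (P.node f i)) ≠ 0 :=
          mul_ne_zero (mul_ne_zero h1 h3) hw'
        simp only [if_pos this]
        simp [child2, node]
  exact this _ le_rfl

end Par

/-! ### Breadth-first enumeration with a bounded number of steps -/

/-- Append a node of the next stage to the queue if `g` is not zero. -/
def push (g r k c : Expr) : Cmd := .ite g (block [
  .store (cell 1 Var.tail) (Var.i + 1),
  .store (cell 2 Var.tail) r,
  .store (cell 3 Var.tail) k,
  .store (cell 4 Var.tail) c,
  .assign .tail (Var.tail + 1)]) .skip

/-- Process one node of the queue. -/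
def bfsBody : Cmd := .ite (Var.tail - Var.head) (block [
  .assign .i (.load (cell 1 Var.head)),
  .assign .res (.load (cell 2 Var.head)),
  .assign .key (.load (cell 3 Var.head)),
  .assign .code (.load (cell 4 Var.head)),
  .assign .head (Var.head + 1),
  .ite (Var.n - Var.i) (block [
    .assign .b (.load Var.i),
    .assign .res' ((Var.res + (Var.b * Var.al + Var.be)) % Var.p),
    .assign .w ((1 - (Var.lo - Var.i)) * (1 - (Var.i + 1 - Var.hi))),
    push (.load (cell 0 ((Var.i + 1) * Var.p + Var.res))) Var.res Var.key (3 * Var.code),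
    push (Var.w * Var.f1 * .load (cell 0 ((Var.i + 1) * Var.p + Var.res'))) Var.res'
      ((Var.key + Var.b) % Var.q) (3 * Var.code + 1),
    push (Var.w * Var.f2 * .load (cell 0 ((Var.i + 1) * Var.p + Var.res'))) Var.res'
      ((Var.key + (Var.q - Var.b)) % Var.q) (3 * Var.code + 2)]) .skip]) .skip

/-- Enumerate the nodes of the tree of completions, at most `cap` of them with their children. -/
def bfs : Cmd := block [
  .store (cell 1 0) 0, .store (cell 2 0) 0, .store (cell 3 0) 0, .store (cell 4 0) 0,
  .assign .head 0, .assign .tail 1, .rep Var.cap bfsBody]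

/-- The memory holds a list of nodes. -/
def QRep (n : ℕ) (m : ℕ → ℕ) (l : List Node) : Prop :=
  ∀ j x, l[j]? = some x → m (2 * n + (6 * j + 1)) = x.stage ∧ m (2 * n + (6 * j + 2)) = x.res ∧
    m (2 * n + (6 * j + 3)) = x.key ∧ m (2 * n + (6 * j + 4)) = x.code

/-- The addresses outside the queue. -/
def Outside (n a : ℕ) : Prop := a < 2 * n ∨ ∃ y, a = 2 * n + 6 * y ∨ a = 2 * n + (6 * y + 5)

/-- The queue of the state `S` is `l`, and outside the queue the memory is as in `S₀`. -/
structure Queue (P : Par) (W : ℕ) (S₀ : St) (l : List Node) (S : St) : Prop where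
  bdd : Bdd W S
  rep : QRep P.n S.m l
  tail : S.v .tail = l.length
  rest : ∀ a, Outside P.n a → S.m a = S₀.m a

/-- The fields are evaluated after earlier fields have been written to the memory. The hypotheses on
`r`, `k`, `c` say that their values depend on the variables only, so these writes do no harm. -/
theorem Queue.push {P : Par} {W : ℕ} {S₀ S : St} {l : List Node} (h : Queue P W S₀ l S)
    {tape : ℕ → Bool} {g r k c : Expr} {x : Node} (hn : S.v .n = P.n)
    (hi : S.v .i + 1 = x.stage)
    (hr : ∀ T : St, T.v = S.v → r.eval T = x.res) (hk : ∀ T : St, T.v = S.v → k.eval T = x.key)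
    (hc : ∀ T : St, T.v = S.v → c.eval T = x.code)
    (hx : x.stage < 2 ^ W ∧ x.res < 2 ^ W ∧ x.key < 2 ^ W ∧ x.code < 2 ^ W)
    (ht : l.length + 1 < 2 ^ W) :
    Queue P W S₀ (l ++ if g.eval S ≠ 0 then [x] else []) ((ShiftedSums.push g r k c).eval tape S) ∧
      ∀ y ≠ Var.tail, ((ShiftedSums.push g r k c).eval tape S).v y = S.v y := by
  by_cases hg : g.eval S ≠ 0
  · have e : (ShiftedSums.push g r k c).eval tape S = ((((S.write (2 * P.n + (6 * l.length + 1)) x.stage).write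
        (2 * P.n + (6 * l.length + 2)) x.res).write (2 * P.n + (6 * l.length + 3)) x.key).write
        (2 * P.n + (6 * l.length + 4)) x.code).set .tail (l.length + 1) := by
      rw [ShiftedSums.push, eval_ite_pos _ _ _ _ hg]
      simp [cell, hn, h.tail, hi]
      rw [hr (S.write _ _) rfl, hk ((S.write _ _).write _ _) rfl,
        hc (((S.write _ _).write _ _).write _ _) rfl]
    rw [if_pos hg, e]
    refine ⟨⟨?_, ?_, by simp, ?_⟩, fun y hy => by simp [hy]⟩
    · exact ((((h.bdd.write _ hx.1).write _ hx.2.1).write _ hx.2.2.1).write _ hx.2.2.2).set _ ht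
    · intro j y hy
      simp only [St.set_m, St.write_m]
      rcases lt_trichotomy j l.length with hj | hj | hj
      · rw [List.getElem?_append_left hj] at hy
        obtain ⟨h1, h2, h3, h4⟩ := h.rep j y hy
        repeat rw [if_neg (by omega)]
        exact ⟨h1, h2, h3, h4⟩
      · subst hj
        have : x = y := by simpa using hy
        subst this
        refine ⟨?_, ?_, ?_, ?_⟩
        · rw [if_neg (by omega), if_neg (by omega), if_neg (by omega), if_pos rfl]
        · rw [if_neg (by omega), if_neg (by omega), if_pos rfl]
        · rw [if_neg (by omega), if_pos rfl]
        · rw [if_pos rfl]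
      · rw [List.getElem?_eq_none (by simp; omega)] at hy
        simp at hy
    · intro a ha
      simp only [St.set_m, St.write_m]
      rw [if_neg, if_neg, if_neg, if_neg, h.rest a ha]
      all_goals
        rintro rfl
        rcases ha with ha | ⟨y, ha | ha⟩ <;> omega
  · have e : (ShiftedSums.push g r k c).eval tape S = S := by
      rw [ShiftedSums.push, eval_ite_neg _ _ _ _ (not_not.1 hg)]
      rfl
    rw [if_neg hg, e, List.append_nil]
    exact ⟨h, fun _ _ => rfl⟩

/-- The loop invariant of `bfs`: the nodes in `d` have been processed, those in `u` not yet. -/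
structure BfsInv (P : Par) (W : ℕ) (S₀ : St) (t : ℕ) (S : St) (d u : List Node) : Prop where
  queue : Queue P W S₀ (d ++ u) S
  frame : ∀ x ∉ bfsBody.mods, S.v x = S₀.v x
  head : S.v .head = d.length
  length : (d ++ u).length ≤ 1 + 3 * t
  sound : ∀ x ∈ d ++ u, P.Sound x
  root : P.node (fun _ => 0) 0 ∈ d ++ u
  closed : ∀ x ∈ d, ∀ y ∈ P.children x, y ∈ d ++ u
  ways : P.count P.n 0 ≠ 0 → ∀ x ∈ d ++ u, P.ways x ≠ 0
  weight : P.count P.n 0 ≠ 0 → d.length + (u.map P.weight).sum = P.treeSize P.n 0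
  progress : d.length = t ∨ u = []

theorem Par.Sound.bounds {P : Par} {W : ℕ} (hP : P.Fits W) {x : Node} (hx : P.Sound x) :
    x.stage ≤ P.n ∧ x.res < P.p ∧ x.key < P.q ∧ x.code < 3 ^ x.stage := by
  obtain ⟨f, i, hi, hf, rfl⟩ := hx
  exact ⟨hi, P.resOf_lt hP.p_pos f i, P.keyOf_lt hP.q_pos f i,
    Par.codeOf_lt fun j hj => hf.digit_lt hj⟩

theorem Par.length_children_le (P : Par) (x : Node) : (P.children x).length ≤ 3 := by
  unfold Par.children
  split_ifs <;> simp

theorem bfsBody_spec {P : Par} {W : ℕ} (hP : P.Fits W) {S₀ : St} (h₀ : P.Vars S₀)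
    (hT : P.Table S₀) {cap : ℕ} (hcap : 3 * cap + 8 < 2 ^ W) {tape : ℕ → Bool} {t : ℕ}
    (ht : t < cap) {S : St} {d u : List Node} (h : BfsInv P W S₀ t S d u) :
    ∃ d' u', BfsInv P W S₀ (t + 1) (bfsBody.eval tape S) d' u' := by
  have hfr : ∀ x ∉ bfsBody.mods, (bfsBody.eval tape S).v x = S₀.v x := fun x hx => by
    rw [Cmd.eval_v_of_notMem tape _ hx, h.frame x hx]
  cases u with
  | nil =>
    -- The loop always runs `cap` times; once the queue is exhausted the remaining rounds do
    -- nothing.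
    have e : bfsBody.eval tape S = S := by
      rw [bfsBody, eval_ite_neg _ _ _ _ (by simp [h.queue.tail, h.head])]
      rfl
    rw [e]
    exact ⟨d, [], { h with length := h.length.trans (by omega), progress := Or.inr rfl }⟩
  | cons x u =>
    have hn : S.v .n = P.n := (h.frame _ (by decide)).trans h₀.n
    have hp : S.v .p = P.p := (h.frame _ (by decide)).trans h₀.p
    have hq : S.v .q = P.q := (h.frame _ (by decide)).trans h₀.q
    have hal : S.v .al = P.al := (h.frame _ (by decide)).trans h₀.al
    have hbe : S.v .be = P.be := (h.frame _ (by decide)).trans h₀.be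
    have hlo : S.v .lo = P.lo := (h.frame _ (by decide)).trans h₀.lo
    have hhi : S.v .hi = P.hi := (h.frame _ (by decide)).trans h₀.hi
    have hf1 : S.v .f1 = P.f1 := (h.frame _ (by decide)).trans h₀.f1
    have hf2 : S.v .f2 = P.f2 := (h.frame _ (by decide)).trans h₀.f2
    have hb : ∀ i < P.n, S.m i = P.b i := fun i hi => by
      rw [h.queue.rest i (Or.inl (by omega)), h₀.b i hi]
    have hsx := h.sound x (by simp)
    obtain ⟨hx1, hx2, hx3, hx4⟩ := hsx.bounds hP
    obtain ⟨m1, m2, m3, m4⟩ := h.queue.rep d.length x (by simp)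
    have hlen := h.length
    have hlen' : (d ++ x :: u).length = d.length + 1 + u.length := by simp; omega
    have hprog : d.length = t := by simpa using h.progress
    -- the state after the node has been loaded
    obtain ⟨T, hTdef⟩ : ∃ T, T = ((((S.set .i x.stage).set .res x.res).set .key x.key).set .code
      x.code).set .head (d.length + 1) := ⟨_, rfl⟩
    have hpW : P.p < 2 ^ W := by rw [← hp]; exact h.queue.bdd.v _
    have hnW : P.n < 2 ^ W := by rw [← hn]; exact h.queue.bdd.v _
    have hTb : Bdd W T := by
      rw [hTdef]
      exact ((((h.queue.bdd.set _ (by omega)).set _ (by omega)).set _ (hx3.trans hP.q_lt)).set _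
        (hx4.trans_le (Nat.pow_le_pow_right (by norm_num) hx1) |>.trans hP.codes)).set _ (by omega)
    have e1 : bfsBody.eval tape S = Cmd.eval tape (.ite (Var.n - Var.i) (block [
        .assign .b (.load Var.i),
        .assign .res' ((Var.res + (Var.b * Var.al + Var.be)) % Var.p),
        .assign .w ((1 - (Var.lo - Var.i)) * (1 - (Var.i + 1 - Var.hi))),
        push (.load (cell 0 ((Var.i + 1) * Var.p + Var.res))) Var.res Var.key (3 * Var.code),
        push (Var.w * Var.f1 * .load (cell 0 ((Var.i + 1) * Var.p + Var.res'))) Var.res'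
          ((Var.key + Var.b) % Var.q) (3 * Var.code + 1),
        push (Var.w * Var.f2 * .load (cell 0 ((Var.i + 1) * Var.p + Var.res'))) Var.res'
          ((Var.key + (Var.q - Var.b)) % Var.q) (3 * Var.code + 2)]) .skip) T := by
      rw [bfsBody, eval_ite_pos _ _ _ _ (by simp [h.queue.tail, h.head])]
      simp [cell, hn, h.head, m1, m2, m3, m4, hTdef]
    have key : Queue P W S₀ ((d ++ x :: u) ++ P.children x) (bfsBody.eval tape S) ∧
        (bfsBody.eval tape S).v .head = d.length + 1 := by
      by_cases h0 : P.n - x.stage = 0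
      · have e2 : bfsBody.eval tape S = T := by
          rw [e1, eval_ite_neg _ _ _ _ (by simp [hTdef, hn, h0])]
          rfl
        rw [e2, Par.children, if_pos h0, List.append_nil]
        exact ⟨⟨hTb, by rw [hTdef]; exact h.queue.rep, by rw [hTdef]; simp [h.queue.tail],
          by rw [hTdef]; exact h.queue.rest⟩, by simp [hTdef]⟩
      · have hst : P.step x.stage x.res < P.p := Nat.mod_lt _ hP.p_pos
        have hbW : P.b x.stage < 2 ^ W := by
          rw [← hb x.stage (by omega)]
          exact h.queue.bdd.m _
        obtain ⟨U, hU⟩ : ∃ U, U = ((T.set .b (P.b x.stage)).set .res' (P.step x.stage x.res)).set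
          .w (P.act x.stage) := ⟨_, rfl⟩
        have hUb : Bdd W U := by
          rw [hU]
          exact ((hTb.set _ hbW).set _ (hst.trans hpW)).set _ ((P.act_le_one _).trans_lt
            (Nat.lt_of_le_of_lt hP.p_pos hpW))
        have hUm : U.m = S.m := by rw [hU, hTdef]; rfl
        have e2 : bfsBody.eval tape S = Cmd.eval tape (block [
            push (.load (cell 0 ((Var.i + 1) * Var.p + Var.res))) Var.res Var.key (3 * Var.code),
            push (Var.w * Var.f1 * .load (cell 0 ((Var.i + 1) * Var.p + Var.res'))) Var.res'
              ((Var.key + Var.b) % Var.q) (3 * Var.code + 1),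
            push (Var.w * Var.f2 * .load (cell 0 ((Var.i + 1) * Var.p + Var.res'))) Var.res'
              ((Var.key + (Var.q - Var.b)) % Var.q) (3 * Var.code + 2)]) U := by
          have hUe : Cmd.eval tape (block [.assign .b (.load Var.i),
              .assign .res' ((Var.res + (Var.b * Var.al + Var.be)) % Var.p),
              .assign .w ((1 - (Var.lo - Var.i)) * (1 - (Var.i + 1 - Var.hi)))]) T = U := by
            simp [-Nat.mod_add_mod, hU, hTdef, hal, hbe, hp, hlo, hhi, 
              hb _ (show x.stage < P.n by omega), Par.step, Par.act]
          rw [e1, eval_ite_pos _ _ _ _ (by simpa [hTdef, hn] using h0), ← hUe]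
          rfl
        have hUv : U.v .n = P.n ∧ U.v .i = x.stage ∧ U.v .res = x.res ∧ U.v .key = x.key ∧
            U.v .code = x.code ∧ U.v .b = P.b x.stage ∧ U.v .res' = P.step x.stage x.res ∧
            U.v .w = P.act x.stage ∧ U.v .p = P.p ∧ U.v .q = P.q ∧ U.v .f1 = P.f1 ∧
            U.v .f2 = P.f2 ∧ U.v .head = d.length + 1 ∧ U.v .tail = (d ++ x :: u).length := by
          simp [hU, hTdef, hn, hp, hq, hf1, hf2, h.queue.tail]
        obtain ⟨un, ui, ures, ukey, ucode, ub, ures', uw, up, uq, uf1, uf2, uhead, utail⟩ := hUv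
        have q0 : Queue P W S₀ (d ++ x :: u) U := ⟨hUb, by rw [hUm]; exact h.queue.rep, utail,
          fun a ha => by rw [hUm]; exact h.queue.rest a ha⟩
        have hcode : 3 * x.code + 2 < 2 ^ W := by
          refine lt_of_lt_of_le ?_ ((Nat.pow_le_pow_right (by norm_num)
            (show x.stage + 1 ≤ P.n by omega)).trans hP.codes.le)
          rw [pow_succ]
          omega
        have hkey : ∀ z, z % P.q < 2 ^ W := fun z => (Nat.mod_lt _ hP.q_pos).trans hP.q_lt
        have htab : ∀ r < P.p, ∀ V : St, (∀ a, Outside P.n a → V.m a = S₀.m a) →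
            V.m (2 * P.n + (6 * ((x.stage + 1) * P.p + r))) = P.count (P.n - (x.stage + 1)) r :=
          fun r hr V hV => by
            rw [hV _ (Or.inr ⟨_, Or.inl rfl⟩), hT (x.stage + 1) (by omega) r hr]
        obtain ⟨q1, v1⟩ := q0.push (tape := tape)
          (g := .load (cell 0 ((Var.i + 1) * Var.p + Var.res))) (r := Var.res) (k := Var.key)
          (c := 3 * Var.code) (x := Par.child0 x) un (by rw [ui]; rfl)
          (fun T hT => by simp [hT, ures, Par.child0]) (fun T hT => by simp [hT, ukey, Par.child0])
          (fun T hT => by simp [hT, ucode, Par.child0])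
          ⟨by simp only [Par.child0]; omega, hx2.trans hpW, hx3.trans hP.q_lt,
            by simp only [Par.child0]; omega⟩ (by omega)
        have g1 : Expr.eval U (.load (cell 0 ((Var.i + 1) * Var.p + Var.res))) =
            P.ways (Par.child0 x) := by
          simp only [cell, Expr.eval_load, Expr.eval_add, Expr.eval_mul, Expr.eval_ofNat,
            Expr.eval_var, un, ui, up, ures, add_zero]
          exact htab _ hx2 _ q0.rest
        rw [g1] at q1
        obtain ⟨V, hV⟩ : ∃ V, V = (push (.load (cell 0 ((Var.i + 1) * Var.p + Var.res))) Var.res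
          Var.key (3 * Var.code)).eval tape U := ⟨_, rfl⟩
        rw [← hV] at q1 v1
        have l1 : ((d ++ x :: u) ++ if P.ways (Par.child0 x) ≠ 0 then [Par.child0 x]
            else []).length ≤ d.length + u.length + 2 := by
          rw [List.length_append, hlen']; split_ifs <;> simp <;> omega
        obtain ⟨q2, v2⟩ := q1.push (tape := tape)
          (g := Var.w * Var.f1 * .load (cell 0 ((Var.i + 1) * Var.p + Var.res'))) (r := Var.res')
          (k := (Var.key + Var.b) % Var.q) (c := 3 * Var.code + 1) (x := P.child1 x)
          ((v1 _ (by decide)).trans un) (by rw [v1 _ (by decide), ui]; rfl)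
          (fun T hT => by simp [hT, v1, ures', Par.child1])
          (fun T hT => by simp [hT, v1, ukey, ub, uq, Par.child1])
          (fun T hT => by simp [hT, v1, ucode, Par.child1])
          ⟨by simp only [Par.child1]; omega, hst.trans hpW, hkey _,
            by simp only [Par.child1]; omega⟩ (by omega)
        have g2 : Expr.eval V (Var.w * Var.f1 * .load (cell 0 ((Var.i + 1) * Var.p + Var.res'))) =
            P.act x.stage * P.f1 * P.ways (P.child1 x) := by
          simp only [cell, Expr.eval_load, Expr.eval_add, Expr.eval_mul, Expr.eval_ofNat,
            Expr.eval_var, v1 _ (show Var.n ≠ .tail by decide), v1 _ (show Var.i ≠ .tail by decide),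
            v1 _ (show Var.p ≠ .tail by decide), v1 _ (show Var.res' ≠ .tail by decide),
            v1 _ (show Var.w ≠ .tail by decide), v1 _ (show Var.f1 ≠ .tail by decide),
            un, ui, up, ures', uw, uf1, add_zero]
          rw [htab _ hst _ q1.rest]
          rfl
        rw [g2] at q2
        obtain ⟨V', hV'⟩ : ∃ V', V' = (push
          (Var.w * Var.f1 * .load (cell 0 ((Var.i + 1) * Var.p + Var.res'))) Var.res'
          ((Var.key + Var.b) % Var.q) (3 * Var.code + 1)).eval tape V := ⟨_, rfl⟩
        rw [← hV'] at q2 v2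
        replace v2 : ∀ y ≠ Var.tail, V'.v y = U.v y := fun y hy => (v2 y hy).trans (v1 y hy)
        have l2 : (((d ++ x :: u) ++ if P.ways (Par.child0 x) ≠ 0 then [Par.child0 x]
            else []) ++ if P.act x.stage * P.f1 * P.ways (P.child1 x) ≠ 0 then [P.child1 x]
            else []).length ≤ d.length + u.length + 3 := by
          rw [List.length_append]; split_ifs at l1 ⊢ <;> simp at l1 ⊢ <;> omega
        obtain ⟨q3, v3⟩ := q2.push (tape := tape)
          (g := Var.w * Var.f2 * .load (cell 0 ((Var.i + 1) * Var.p + Var.res'))) (r := Var.res')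
          (k := (Var.key + (Var.q - Var.b)) % Var.q) (c := 3 * Var.code + 2) (x := P.child2 x)
          ((v2 _ (by decide)).trans un) (by rw [v2 _ (by decide), ui]; rfl)
          (fun T hT => by simp [hT, v2, ures', Par.child2])
          (fun T hT => by simp [hT, v2, ukey, ub, uq, Par.child2])
          (fun T hT => by simp [hT, v2, ucode, Par.child2])
          ⟨by simp only [Par.child2]; omega, hst.trans hpW, hkey _,
            by simp only [Par.child2]; omega⟩ (by omega)
        have g3 : Expr.eval V' (Var.w * Var.f2 * .load (cell 0 ((Var.i + 1) * Var.p + Var.res'))) =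
            P.act x.stage * P.f2 * P.ways (P.child2 x) := by
          simp only [cell, Expr.eval_load, Expr.eval_add, Expr.eval_mul, Expr.eval_ofNat,
            Expr.eval_var, v2 _ (show Var.n ≠ .tail by decide), v2 _ (show Var.i ≠ .tail by decide),
            v2 _ (show Var.p ≠ .tail by decide), v2 _ (show Var.res' ≠ .tail by decide),
            v2 _ (show Var.w ≠ .tail by decide), v2 _ (show Var.f2 ≠ .tail by decide),
            un, ui, up, ures', uw, uf2, add_zero]
          rw [htab _ hst _ q2.rest]
          rfl
        rw [g3] at q3
        have e3 : bfsBody.eval tape S = (push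
            (Var.w * Var.f2 * .load (cell 0 ((Var.i + 1) * Var.p + Var.res'))) Var.res'
            ((Var.key + (Var.q - Var.b)) % Var.q) (3 * Var.code + 2)).eval tape V' := by
          rw [e2, hV', hV]
          rfl
        rw [← e3] at q3 v3
        refine ⟨?_, by rw [v3 _ (by decide), v2 _ (by decide), uhead]⟩
        rw [Par.children, if_neg h0]
        simpa only [List.append_assoc] using q3
    obtain ⟨k1, k2⟩ := key
    have hch := P.length_children_le x
    refine ⟨d ++ [x], u ++ P.children x, ⟨?_, hfr, by simp [k2], ?_, ?_, ?_, ?_, ?_, ?_, ?_⟩⟩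
    · convert k1 using 1
      simp
    · simp only [List.length_append, List.length_cons, List.length_nil] at hlen ⊢
      omega
    · intro y hy
      have : y ∈ d ++ x :: u ∨ y ∈ P.children x := by
        simp only [List.mem_append, List.mem_cons, List.not_mem_nil, or_false] at hy ⊢; tauto
      rcases this with hy | hy
      · exact h.sound y hy
      · exact hsx.children hy
    · have := h.root
      simp only [List.mem_append, List.mem_cons, List.not_mem_nil, or_false] at this ⊢; tauto
    · intro y hy z hz
      rw [List.mem_append, List.mem_singleton] at hy
      rcases hy with hy | rfl
      · have := h.closed y hy z hz
        simp only [List.mem_append, List.mem_cons, List.not_mem_nil, or_false] at this ⊢; tauto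
      · simp [hz]
    · intro hw y hy
      have : y ∈ d ++ x :: u ∨ y ∈ P.children x := by
        simp only [List.mem_append, List.mem_cons, List.not_mem_nil, or_false] at hy ⊢; tauto
      rcases this with hy | hy
      · exact h.ways hw y hy
      · exact P.ways_of_mem_children hy
    · intro hw
      -- Processing `x` trades its weight for one processed node and the weights of its children.
      rw [← h.weight hw, List.map_cons, List.sum_cons,
        P.weight_eq (h.ways hw x (by simp)) hP.f1_le hP.f2_le]
      simp only [List.map_append, List.sum_append, List.length_append, List.length_cons,
        List.length_nil]
      omega
    · left
      simp [hprog]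

/-- The queue of the state `S` holds the list `l` of nodes of the tree, which contains all
completions if the tree is small enough. -/
structure Enumerated (P : Par) (cap : ℕ) (S : St) (l : List Node) : Prop where
  rep : QRep P.n S.m l
  tail : S.v .tail = l.length
  length : l.length ≤ 1 + 3 * cap
  sound : ∀ x ∈ l, P.Sound x
  ways : P.count P.n 0 ≠ 0 → ∀ x ∈ l, P.ways x ≠ 0
  complete : P.treeSize P.n 0 ≤ cap → ∀ f, P.Adm f P.n → P.resOf f P.n = P.k → P.node f P.n ∈ l

theorem bfs_spec : ∃ K : ℕ, ∀ {P : Par} {W cap : ℕ} {S : St} {tape : ℕ → Bool}, P.Fits W →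
    P.Vars S → P.Table S → S.v .cap = cap → 3 * cap + 8 < 2 ^ W → Bdd W S →
      Bdd W (bfs.eval tape S) ∧ (∃ l, Enumerated P cap (bfs.eval tape S) l) ∧
      (∀ a, Outside P.n a → (bfs.eval tape S).m a = S.m a) ∧
      bfs.cost tape S ≤ K * ((cap + 1) * (W + 1)) := by
  obtain ⟨c, hc⟩ : ∃ c : Cmd, c = block [.store (cell 1 0) 0, .store (cell 2 0) 0,
    .store (cell 3 0) 0, .store (cell 4 0) 0, .assign .head 0, .assign .tail 1] := ⟨_, rfl⟩
  refine ⟨c.K + 1 + (bfsBody.K + (3 * (Var.cap : Expr).K + 6)), ?_⟩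
  intro P W cap S tape hP hS hT hcap hW hB
  have hc1 : c.cost tape S ≤ c.K * (W + 1) := Cmd.cost_le tape c (by rw [hc]; rfl) hB
  obtain ⟨T, hTdef⟩ : ∃ T, T = c.eval tape S := ⟨_, rfl⟩
  have hTe : T = (((((S.write (2 * P.n + 1) 0).write (2 * P.n + 2) 0).write (2 * P.n + 3) 0).write
      (2 * P.n + 4) 0).set .head 0).set .tail 1 := by
    rw [hTdef, hc]
    simp [cell, hS.n]
  have h1 : 1 < 2 ^ W := by omega
  have hTb : Bdd W T := by
    rw [hTe]
    exact (((((hB.write _ (by omega)).write _ (by omega)).write _ (by omega)).write _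
      (by omega)).set _ (by omega)).set _ h1
  have hTm : ∀ a, Outside P.n a → T.m a = S.m a := by
    intro a ha
    rw [hTe]
    simp only [St.set_m, St.write_m]
    rw [if_neg, if_neg, if_neg, if_neg]
    all_goals
      rintro rfl
      rcases ha with ha | ⟨y, ha | ha⟩ <;> omega
  have hTv : ∀ x ∉ bfs.mods, T.v x = S.v x := by
    intro x hx
    have h1 : x ≠ .head := by rintro rfl; exact hx (by decide)
    have h2 : x ≠ .tail := by rintro rfl; exact hx (by decide)
    rw [hTe]
    simp [h1, h2]
  have hV : P.Vars T := hS.of_frame hTv (fun i hi => hTm i (Or.inl (by omega)))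
  have hTT : P.Table T := fun i hi r hr => by
    rw [hTm _ (Or.inr ⟨_, Or.inl rfl⟩), hT i hi r hr]
  have h0 : BfsInv P W T 0 T [] [P.node (fun _ => 0) 0] := by
    refine ⟨⟨hTb, ?_, by simp [hTe], fun _ _ => rfl⟩, fun _ _ => rfl, by simp [hTe], by simp, ?_,
      by simp, by simp, ?_, ?_, Or.inl rfl⟩
    · intro j x hx
      cases j with
      | zero =>
        simp only [List.nil_append, List.getElem?_cons_zero, Option.some.injEq] at hx
        subst hx
        simp [hTe, Par.node, Par.resOf, Par.keyOf, Par.codeOf]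
      | succ j => simp at hx
    · intro x hx
      simp only [List.nil_append, List.mem_singleton] at hx
      exact ⟨_, 0, Nat.zero_le _, fun j hj => by omega, hx⟩
    · intro hw x hx
      simp only [List.nil_append, List.mem_singleton] at hx
      subst hx
      exact hw
    · intro _
      simp [Par.weight, Par.node, Par.resOf]
  obtain ⟨hI, hcost⟩ := Cmd.rep_rule (tape := tape) (e := Var.cap) (c := bfsBody) (S := T)
    (fun t S' => ∃ d u, BfsInv P W T t S' d u) (N := cap) (A := bfsBody.K * (W + 1)) (W := W)
    (by simpa [hTe] using hcap) hTb ⟨_, _, h0⟩ (fun t ht S' hS' => by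
      obtain ⟨d, u, h⟩ := hS'
      exact ⟨bfsBody_spec hP hV hTT hW ht h, Cmd.cost_le tape _ rfl h.queue.bdd⟩)
  have hev : bfs.eval tape S = (Cmd.rep Var.cap bfsBody).eval tape T := by rw [hTdef, hc]; rfl
  obtain ⟨d, u, hI⟩ := hI
  rw [← hev] at hI
  refine ⟨hI.queue.bdd, ⟨d ++ u, hI.queue.rep, hI.queue.tail, hI.length, hI.sound, hI.ways, ?_⟩,
    fun a ha => (hI.queue.rest a ha).trans (hTm a ha), ?_⟩
  · intro hsize f hf hk
    have hw : P.count P.n 0 ≠ 0 := by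
      have := P.count_ne_zero_of_adm hf hk P.n le_rfl
      simpa [Par.resOf] using this
    have hwt := hI.weight hw
    -- After `cap` processed nodes the invariant leaves total weight 0 for the waiting ones when the
    -- tree has at most `cap` nodes; but every waiting node has positive weight.
    have hu : u = [] := by
      rcases hI.progress with h | h
      · cases u with
        | nil => rfl
        | cons x u =>
          have h1 : P.weight x ≠ 0 := by
            rw [Par.weight, Ne, P.treeSize_eq_zero_iff]
            exact hI.ways hw x (by simp)
          simp only [List.map_cons, List.sum_cons] at hwt
          omega
      · exact h
    subst hu
    have hcl := hI.closed
    have hroot := hI.root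
    rw [List.append_nil] at hcl hroot ⊢
    exact P.node_mem_of_closed hroot hcl hf hk
  · have hco : bfs.cost tape S ≤ c.cost tape S + (Cmd.rep Var.cap bfsBody).cost tape T + 1 := by
      rw [hTdef, hc]
      simp only [bfs, cost_block_cons, cost_block_nil, eval_block_cons, eval_block_nil]
      omega
    have := loop_cost_le hc1 hcost le_rfl
    omega

/-! ### The dictionary of the first list -/

/-- Enter one completion into the dictionary. -/
def saveBody : Cmd := block [
  .ite (Var.n - .load (cell 1 Var.x)) .skip
    (.store (cell 5 (.load (cell 3 Var.x))) (.load (cell 4 Var.x) + 1)),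
  .assign .x (Var.x + 1)]

/-- Enter all completions in the queue into the dictionary. -/
def save : Cmd := block [.assign .x 0, .rep Var.tail saveBody]

/-- The address of a dictionary entry. -/
def dict (n κ : ℕ) : ℕ := 2 * n + (6 * κ + 5)

/-- The loop invariant of `save`. -/
structure SaveInv (P : Par) (W : ℕ) (S₀ : St) (l : List Node) (t : ℕ) (S : St) : Prop where
  bdd : Bdd W S
  x : S.v .x = t
  frame : ∀ x ∉ saveBody.mods, S.v x = S₀.v x
  rest : ∀ a, (∀ κ, a ≠ dict P.n κ) → S.m a = S₀.m a
  found : ∀ j < t, ∀ x, l[j]? = some x → x.stage = P.n → S.m (dict P.n x.key) ≠ 0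
  sound : ∀ κ, S.m (dict P.n κ) ≠ 0 →
    ∃ x ∈ l, x.stage = P.n ∧ x.key = κ ∧ S.m (dict P.n κ) = x.code + 1

theorem dict_inj {n κ κ' : ℕ} (h : dict n κ = dict n κ') : κ = κ' := by
  unfold dict at h
  omega

theorem Par.code_add_one_lt {P : Par} {W : ℕ} (hP : P.Fits W) {x : Node} (hx : P.Sound x) :
    x.code + 1 < 2 ^ W := by
  obtain ⟨h1, -, -, h4⟩ := hx.bounds hP
  have := Nat.pow_le_pow_right (show 0 < 3 by norm_num) h1
  have := hP.codes
  omega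

/-- Completions with equal keys overwrite each other. What survives is an entry for every key that
occurs, which belongs to some completion with this key. Codes are stored increased by 1, so that 0
marks an empty entry. -/
theorem saveBody_spec {P : Par} {W cap : ℕ} (hP : P.Fits W) (hcap : 3 * cap + 8 < 2 ^ W)
    {S₀ : St} {l : List Node} (hn₀ : S₀.v .n = P.n) (hl : Enumerated P cap S₀ l)
    {tape : ℕ → Bool} {t : ℕ} (ht : t < l.length) {S : St} (h : SaveInv P W S₀ l t S) :
    SaveInv P W S₀ l (t + 1) (saveBody.eval tape S) := by
  have hn : S.v .n = P.n := (h.frame _ (by decide)).trans hn₀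
  have hfr : ∀ x ∉ saveBody.mods, (saveBody.eval tape S).v x = S₀.v x := fun x hx => by
    rw [Cmd.eval_v_of_notMem tape _ hx, h.frame x hx]
  obtain ⟨x, hx⟩ : ∃ x, l[t]? = some x := ⟨_, List.getElem?_eq_getElem ht⟩
  have hxl : x ∈ l := List.mem_of_getElem? hx
  have hsx := hl.sound x hxl
  obtain ⟨hx1, hx2, hx3, hx4⟩ := hsx.bounds hP
  have hlen := hl.length
  have hm : ∀ j < 5, S.m (2 * P.n + (6 * t + j)) = S₀.m (2 * P.n + (6 * t + j)) := fun j hj =>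
    h.rest _ (fun κ => by unfold dict; omega)
  obtain ⟨m1, m2, m3, m4⟩ := hl.rep t x hx
  rw [← hm _ (by norm_num)] at m1 m3 m4
  have htW : t + 1 < 2 ^ W := by omega
  have hxlt : S.v .x + 1 < 2 ^ W := by rw [h.x]; exact htW
  by_cases hst : P.n - x.stage = 0
  · have hst' : x.stage = P.n := by omega
    have e : saveBody.eval tape S = (S.write (dict P.n x.key) (x.code + 1)).set .x (t + 1) := by
      rw [saveBody, eval_block_cons, eval_ite_neg _ _ _ _ (by simp [cell, hn, h.x, m1, hst])]
      simp [cell, hn, h.x, m3, m4, dict]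
    rw [e] at hfr ⊢
    refine ⟨(h.bdd.write _ (P.code_add_one_lt hP hsx)).set _ htW, by simp, hfr, ?_, ?_, ?_⟩
    · intro a ha
      rw [St.set_m, St.write_m, if_neg (ha _), h.rest a ha]
    · intro j hj y hy hys
      rw [St.set_m, St.write_m]
      split_ifs with hd
      · omega
      · rcases Nat.lt_succ_iff_lt_or_eq.1 hj with hj | rfl
        · exact h.found j hj y hy hys
        · rw [hx, Option.some.injEq] at hy
          exact absurd (by rw [hy]) hd
    · intro κ hκ
      rw [St.set_m, St.write_m] at hκ ⊢
      split_ifs at hκ ⊢ with hd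
      · exact ⟨x, hxl, hst', (dict_inj hd).symm, rfl⟩
      · exact h.sound κ hκ
  · have e : saveBody.eval tape S = S.set .x (t + 1) := by
      rw [saveBody, eval_block_cons, eval_ite_pos _ _ _ _ (by simp [cell, hn, h.x, m1, hst])]
      simp [h.x]
    rw [e] at hfr ⊢
    refine ⟨h.bdd.set _ htW, by simp, hfr, h.rest, ?_, h.sound⟩
    intro j hj y hy hys
    rcases Nat.lt_succ_iff_lt_or_eq.1 hj with hj | rfl
    · exact h.found j hj y hy hys
    · rw [hx, Option.some.injEq] at hy
      subst hy
      omega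

/-- The dictionary of the state `S` holds completions, at least one for every key that occurs
in `l`. -/
structure Saved (P : Par) (S : St) : Prop where
  sound : ∀ κ, S.m (dict P.n κ) ≠ 0 → ∃ f, P.Adm f P.n ∧ P.keyOf f P.n = κ ∧
    (P.count P.n 0 ≠ 0 → P.resOf f P.n = P.k) ∧ S.m (dict P.n κ) = Par.codeOf f P.n + 1

/-- The dictionary has an entry for the key of every completion. -/
def Par.SavedAll (P : Par) (S : St) : Prop :=
  ∀ f, P.Adm f P.n → P.resOf f P.n = P.k → S.m (dict P.n (P.keyOf f P.n)) ≠ 0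

theorem Par.resOf_eq_of_ways {P : Par} {f : ℕ → ℕ} (h : P.ways (P.node f P.n) ≠ 0) :
    P.resOf f P.n = P.k := by
  simp only [Par.ways, Par.node, Nat.sub_self, Par.count] at h
  omega

theorem save_spec : ∃ K : ℕ, ∀ {P : Par} {W cap : ℕ} {S : St} {l : List Node} {tape : ℕ → Bool},
    P.Fits W → 3 * cap + 8 < 2 ^ W → S.v .n = P.n → Enumerated P cap S l → Bdd W S →
    (∀ κ, S.m (dict P.n κ) = 0) →
      Bdd W (save.eval tape S) ∧ Saved P (save.eval tape S) ∧
      (P.treeSize P.n 0 ≤ cap → P.SavedAll (save.eval tape S)) ∧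
      (∀ a, (∀ κ, a ≠ dict P.n κ) → (save.eval tape S).m a = S.m a) ∧
      save.cost tape S ≤ K * ((cap + 1) * (W + 1)) := by
  obtain ⟨c, hc⟩ : ∃ c : Cmd, c = .assign .x 0 := ⟨_, rfl⟩
  -- The queue may hold up to `1 + 3 * cap` nodes, since each of the `cap` rounds adds at most
  -- three; the factor 4 converts this into `cap + 1`.
  refine ⟨4 * (c.K + 1 + (saveBody.K + (3 * (Var.tail : Expr).K + 6))), ?_⟩
  intro P W cap S l tape hP hcap hn hl hB h0
  have hc1 : c.cost tape S ≤ c.K * (W + 1) := Cmd.cost_le tape c (by rw [hc]; rfl) hB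
  have hce : c.eval tape S = S.set .x 0 := by rw [hc]; rfl
  have hcb : Bdd W (c.eval tape S) := by rw [hce]; exact hB.set _ (by omega)
  have hl' : Enumerated P cap (c.eval tape S) l := by
    rw [hce]
    exact ⟨hl.rep, by simp [hl.tail], hl.length, hl.sound, hl.ways, hl.complete⟩
  obtain ⟨hI, hcost⟩ := Cmd.rep_rule (tape := tape) (e := Var.tail) (c := saveBody)
    (S := c.eval tape S) (SaveInv P W (c.eval tape S) l) (N := l.length)
    (A := saveBody.K * (W + 1)) (W := W) (by simpa using hl'.tail) hcb
    ⟨hcb, by simp [hce], fun _ _ => rfl, fun _ _ => rfl, fun j hj => by omega,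
      fun κ hκ => absurd (by rw [hce]; exact h0 κ) hκ⟩
    (fun t ht S' hS' => ⟨saveBody_spec hP hcap (by simp [hce, hn]) hl' ht hS',
      Cmd.cost_le tape _ rfl hS'.bdd⟩)
  have hev : save.eval tape S = (Cmd.rep Var.tail saveBody).eval tape (c.eval tape S) := by
    rw [hc]; rfl
  rw [← hev] at hI
  have hlen := hl.length
  refine ⟨hI.bdd, ⟨?_⟩, ?_, ?_, ?_⟩
  · intro κ hκ
    obtain ⟨x, hx, hxs, hxk, hxc⟩ := hI.sound κ hκ
    obtain ⟨f, i, hi, hf, rfl⟩ := hl.sound x hx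
    have : i = P.n := hxs
    subst this
    exact ⟨f, hf, hxk, fun hw => P.resOf_eq_of_ways (hl.ways hw _ hx), hxc⟩
  · intro hsize f hf hk
    obtain ⟨j, hj, hjx⟩ := List.getElem_of_mem (hl.complete hsize f hf hk)
    exact hI.found j hj _ (by rw [List.getElem?_eq_getElem hj, hjx]) rfl
  · intro a ha
    rw [hI.rest a ha, hce]
    rfl
  · have hco : save.cost tape S = c.cost tape S +
        ((Cmd.rep Var.tail saveBody).cost tape (c.eval tape S) + 1) := by rw [hc]; rfl
    rw [hco]
    have := loop_cost_le hc1 hcost (show l.length ≤ 4 * cap + 3 by omega)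
    calc _ ≤ _ := this
      _ = _ := by ring

/-! ### Looking up the second list and writing the output -/

/-- Decode one pair of digits and write the output for it. -/
def decodeBody : Cmd := block [
  .assign .i (Var.i - 1),
  .assign .w (Var.c1 % 3),
  .assign .b (Var.c2 % 3),
  .assign .c1 (Var.c1 / 3),
  .assign .c2 (Var.c2 / 3),
  .store Var.i (Var.w % 2 + Var.b % 2),
  .store (Var.n + Var.i) (Var.w / 2 + Var.b / 2),
  .assign .diff (Var.diff + ((.load Var.i - .load (Var.n + Var.i)) +
    (.load (Var.n + Var.i) - .load Var.i)))]

/-- The output for the first set. -/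
def out1 (f g : ℕ → ℕ) (i : ℕ) : ℕ := f i % 2 + g i % 2

/-- The output for the second set. -/
def out2 (f g : ℕ → ℕ) (i : ℕ) : ℕ := f i / 2 + g i / 2

/-- The memory holds the output for the digits `f` and `g`. -/
def Decoded (n : ℕ) (f g : ℕ → ℕ) (m : ℕ → ℕ) : Prop :=
  ∀ i < n, m i = out1 f g i ∧ m (n + i) = out2 f g i

/-- The two sets are different. -/
def Differ (n : ℕ) (f g : ℕ → ℕ) : Prop := ∃ i < n, out1 f g i ≠ out2 f g i

/-- The loop invariant for the decoding. -/
structure DecodeInv (n W : ℕ) (f g : ℕ → ℕ) (S₀ : St) (t : ℕ) (S : St) : Prop where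
  bdd : Bdd W S
  i : S.v .i = n - t
  c1 : S.v .c1 = Par.codeOf f (n - t)
  c2 : S.v .c2 = Par.codeOf g (n - t)
  frame : ∀ x ∉ decodeBody.mods, S.v x = S₀.v x
  out : ∀ i < n, n - t ≤ i → S.m i = out1 f g i ∧ S.m (n + i) = out2 f g i
  rest : ∀ a, 2 * n ≤ a → S.m a = S₀.m a
  diff : S.v .diff ≠ 0 ↔ ∃ i < n, n - t ≤ i ∧ out1 f g i ≠ out2 f g i
  diff_le : S.v .diff ≤ 4 * t

/-- The code has the last digit in its lowest ternary place, so the digits come out from `n - 1`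
downwards. The variable `diff` adds up the distances of the two outputs, which makes it nonzero
exactly when they differ somewhere. -/
theorem decodeBody_spec {n W : ℕ} (hW : 4 * n + 4 < 2 ^ W) {f g : ℕ → ℕ} (hf : ∀ j < n, f j < 3)
    (hg : ∀ j < n, g j < 3) {S₀ : St} (hn₀ : S₀.v .n = n) {tape : ℕ → Bool} {t : ℕ} (ht : t < n)
    {S : St} (h : DecodeInv n W f g S₀ t S) :
    DecodeInv n W f g S₀ (t + 1) (decodeBody.eval tape S) := by
  have hn : S.v .n = n := (h.frame _ (by decide)).trans hn₀
  have hfr : ∀ x ∉ decodeBody.mods, (decodeBody.eval tape S).v x = S₀.v x := fun x hx => by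
    rw [Cmd.eval_v_of_notMem tape _ hx, h.frame x hx]
  obtain ⟨i, hi⟩ : ∃ i, n - t = i + 1 := ⟨n - t - 1, by omega⟩
  have hi' : n - (t + 1) = i := by omega
  have hin : i < n := by omega
  have hfi := hf i hin
  have hgi := hg i hin
  have hi1 : S.v .i = i + 1 := h.i.trans hi
  have hc1 : S.v .c1 = 3 * Par.codeOf f i + f i := by rw [h.c1, hi]; rfl
  have hc2 : S.v .c2 = 3 * Par.codeOf g i + g i := by rw [h.c2, hi]; rfl
  have hc1W := h.bdd.v .c1
  have hc2W := h.bdd.v .c2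
  rw [hc1] at hc1W
  rw [hc2] at hc2W
  have hd := h.diff_le
  have o1 : out1 f g i ≤ 2 := by unfold out1; omega
  have o2 : out2 f g i ≤ 2 := by unfold out2; omega
  obtain ⟨D, hD⟩ : ∃ D, D = S.v .diff + ((out1 f g i - out2 f g i) +
    (out2 f g i - out1 f g i)) := ⟨_, rfl⟩
  have e : decodeBody.eval tape S = ((((((((S.set .i i).set .w (f i)).set .b (g i)).set .c1
      (Par.codeOf f i)).set .c2 (Par.codeOf g i)).write i (out1 f g i)).write (n + i)
      (out2 f g i)).set .diff D) := by
    have a1 : (3 * Par.codeOf f i + f i) % 3 = f i := by omega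
    have a2 : (3 * Par.codeOf f i + f i) / 3 = Par.codeOf f i := by omega
    have a3 : (3 * Par.codeOf g i + g i) % 3 = g i := by omega
    have a4 : (3 * Par.codeOf g i + g i) / 3 = Par.codeOf g i := by omega
    have hne : i ≠ n + i := by omega
    simp only [decodeBody, eval_block_cons, eval_block_nil, eval_assign, eval_store,
      Expr.eval_sub, Expr.eval_add, Expr.eval_div, Expr.eval_mod, Expr.eval_var, Expr.eval_ofNat,
      Expr.eval_load, St.set_v, St.write_v, St.set_m, St.write_m, if_true, reduceCtorEq, if_false,
      hi1, hc1, hc2, hn, Nat.add_sub_cancel, a1, a2, a3, a4, hne, hD, out1, out2]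
  rw [e] at hfr ⊢
  refine ⟨?_, by simp [hi'], by simp [hi'], by simp [hi'], hfr, ?_, ?_, ?_, ?_⟩
  · exact (((((((h.bdd.set _ (by omega)).set _ (by omega)).set _ (by omega)).set _
      (by omega)).set _ (by omega)).write _ (by omega)).write _ (by omega)).set _ (by omega)
  · intro j hj hij
    simp only [St.set_m, St.write_m]
    rcases Nat.eq_or_lt_of_le (hi'.symm.le.trans hij) with rfl | hlt
    · exact ⟨by rw [if_neg (by omega), if_pos rfl], by rw [if_pos rfl]⟩
    · obtain ⟨h1, h2⟩ := h.out j hj (by omega)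
      exact ⟨by rw [if_neg (by omega), if_neg (by omega), h1],
        by rw [if_neg (by omega), if_neg (by omega), h2]⟩
  · intro a ha
    simp only [St.set_m, St.write_m]
    rw [if_neg (by omega), if_neg (by omega), h.rest a ha]
  · have hdd := h.diff
    simp only [St.set_v, if_true]
    constructor
    · intro hne
      by_cases h0 : S.v .diff = 0
      · exact ⟨i, hin, by omega, by omega⟩
      · obtain ⟨j, h1, h2, h3⟩ := hdd.1 h0
        exact ⟨j, h1, by omega, h3⟩
    · rintro ⟨j, h1, h2, h3⟩
      by_cases hji : j = i
      · subst hji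
        omega
      · have := hdd.2 ⟨j, h1, by omega, h3⟩
        omega
  · simp only [St.set_v, if_true]
    omega

/-- Look one completion up in the dictionary. -/
def lookupHit : Cmd := block [
  .assign .c1 (Var.c1 - 1),
  .assign .c2 (.load (cell 4 Var.x)),
  .assign .i Var.n,
  .assign .diff 0,
  .rep Var.n decodeBody,
  .assign .done Var.diff]

/-- Look one completion up in the dictionary. -/
def lookupBody : Cmd := block [
  .ite Var.done .skip (.ite (Var.n - .load (cell 1 Var.x)) .skip (block [
    .assign .c1 (.load (cell 5 ((Var.s + (Var.q - .load (cell 3 Var.x))) % Var.q))),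
    .ite Var.c1 lookupHit .skip])),
  .assign .x (Var.x + 1)]

/-- Look all completions up in the dictionary. -/
def lookup : Cmd := block [.assign .x 0, .rep Var.tail lookupBody]

theorem lookupHit_spec : ∃ K : ℕ, ∀ {n W : ℕ} {f g : ℕ → ℕ} {S : St} {tape : ℕ → Bool},
    4 * n + 4 < 2 ^ W → (∀ j < n, f j < 3) → (∀ j < n, g j < 3) → S.v .n = n →
    S.v .c1 = Par.codeOf f n + 1 → S.m (2 * n + (6 * S.v .x + 4)) = Par.codeOf g n → Bdd W S →
      Bdd W (lookupHit.eval tape S) ∧ Decoded n f g (lookupHit.eval tape S).m ∧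
      (∀ a, 2 * n ≤ a → (lookupHit.eval tape S).m a = S.m a) ∧
      ((lookupHit.eval tape S).v .done ≠ 0 ↔ Differ n f g) ∧
      lookupHit.cost tape S ≤ K * ((n + 1) * (W + 1)) := by
  obtain ⟨c, hc⟩ : ∃ c : Cmd, c = block [.assign .c1 (Var.c1 - 1),
    .assign .c2 (.load (cell 4 Var.x)), .assign .i Var.n, .assign .diff 0] := ⟨_, rfl⟩
  refine ⟨(c.K + 1 + (decodeBody.K + (3 * (Var.n : Expr).K + 6))) +
    (Cmd.assign .done Var.diff).K, ?_⟩
  intro n W f g S tape hW hf hg hn hc1 hc2 hB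
  have hcc : c.cost tape S ≤ c.K * (W + 1) := Cmd.cost_le tape c (by rw [hc]; rfl) hB
  obtain ⟨T, hTdef⟩ : ∃ T, T = c.eval tape S := ⟨_, rfl⟩
  have hT : T = (((S.set .c1 (Par.codeOf f n)).set .c2 (Par.codeOf g n)).set .i n).set .diff 0 := by
    rw [hTdef, hc]
    simp [cell, hn, hc1, hc2]
  have hfW : Par.codeOf f n < 2 ^ W := by have := hB.v .c1; omega
  have hgW : Par.codeOf g n < 2 ^ W := by rw [← hc2]; exact hB.m _
  have hTb : Bdd W T := by
    rw [hT]
    exact (((hB.set _ hfW).set _ hgW).set _ (by omega)).set _ (by omega)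
  obtain ⟨hI, hcost⟩ := Cmd.rep_rule (tape := tape) (e := Var.n) (c := decodeBody) (S := T)
    (DecodeInv n W f g T) (N := n) (A := decodeBody.K * (W + 1)) (W := W) (by simp [hT, hn]) hTb
    ⟨hTb, by simp [hT], by simp [hT], by simp [hT], fun _ _ => rfl, fun i hi hi' => by omega,
      fun _ _ => rfl, ⟨fun h => absurd (by simp [hT]) h, by rintro ⟨i, h1, h2, -⟩; omega⟩,
      by simp [hT]⟩
    (fun t ht S' hS' => ⟨decodeBody_spec hW hf hg (by simp [hT, hn]) ht hS',
      Cmd.cost_le tape _ rfl hS'.bdd⟩)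
  obtain ⟨U, hU⟩ : ∃ U, U = (Cmd.rep Var.n decodeBody).eval tape T := ⟨_, rfl⟩
  rw [← hU] at hI
  have hev : lookupHit.eval tape S = U.set .done (U.v .diff) := by rw [hU, hTdef, hc]; rfl
  have hco : lookupHit.cost tape S ≤ (c.cost tape S + ((Cmd.rep Var.n decodeBody).cost tape T + 1))
      + (Cmd.assign .done Var.diff).cost tape U := by
    rw [hU, hTdef, hc]
    simp only [lookupHit, cost_block_cons, cost_block_nil, eval_block_cons, eval_block_nil]
    omega
  rw [hev]
  refine ⟨hI.bdd.set _ (hI.bdd.v _), fun i hi => hI.out i hi (by omega), fun a ha => ?_, ?_, ?_⟩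
  · rw [St.set_m, hI.rest a ha, hT]
    rfl
  · simp only [St.set_v, if_true, hI.diff, Differ, Nat.sub_self, zero_le, true_and]
  · have h1 := loop_cost_le hcc hcost le_rfl
    have h2 := Cmd.cost_le tape (Cmd.assign .done Var.diff) rfl hI.bdd
    have h3 : (Cmd.assign .done Var.diff).K * (W + 1) ≤
        (Cmd.assign .done Var.diff).K * ((n + 1) * (W + 1)) :=
      Nat.mul_le_mul_left _ (Nat.le_mul_of_pos_left _ (by omega))
    rw [add_mul]
    omega

theorem cost_skip (tape : ℕ → Bool) (S : St) : Cmd.skip.cost tape S = 1 := rfl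

theorem Cmd.cost_ite_le (tape : ℕ → Bool) {W : ℕ} {S : St} (h : Bdd W S) (e : Expr)
    (c₁ c₂ : Cmd) : (Cmd.ite e c₁ c₂).cost tape S ≤ (2 * e.K + 1) * (W + 1) +
      if e.eval S ≠ 0 then c₁.cost tape S else c₂.cost tape S := by
  have h1 := e.size_le h
  have h2 := e.cost_le h
  simp only [Cmd.cost]
  nlinarith

/-- The pair of completions `f`, `g` has the right keys. -/
structure Hit (P₁ P₂ : Par) (s : ℕ) (f g : ℕ → ℕ) : Prop where
  adm₁ : P₁.Adm f P₁.n
  adm₂ : P₂.Adm g P₂.n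
  key : P₁.keyOf f P₁.n = (s + (P₂.q - P₂.keyOf g P₂.n)) % P₂.q

/-- The loop invariant of `lookup`. -/
structure LookupInv (P₁ P₂ : Par) (W : ℕ) (S₀ : St) (l : List Node) (t : ℕ) (S : St) : Prop where
  bdd : Bdd W S
  x : S.v .x = t
  frame : ∀ x ∉ lookupBody.mods, S.v x = S₀.v x
  rest : ∀ a, 2 * P₂.n ≤ a → S.m a = S₀.m a
  done : S.v .done ≠ 0 → ∃ f g, Hit P₁ P₂ (S₀.v .s) f g ∧ Decoded P₂.n f g S.m ∧ Differ P₂.n f g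
  found : ∀ j < t, ∀ g, l[j]? = some (P₂.node g P₂.n) → P₂.Adm g P₂.n → ∀ f, P₁.Adm f P₁.n →
    S₀.m (dict P₂.n ((S₀.v .s + (P₂.q - P₂.keyOf g P₂.n)) % P₂.q)) = Par.codeOf f P₁.n + 1 →
    Differ P₂.n f g → S.v .done ≠ 0

theorem codeOf_inj {f g : ℕ → ℕ} {n : ℕ} (hf : ∀ j < n, f j < 3) (hg : ∀ j < n, g j < 3)
    (h : Par.codeOf f n = Par.codeOf g n) : ∀ j < n, f j = g j := by
  induction n with
  | zero => intro j hj; omega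
  | succ n ih =>
    have h1 := hf n (by omega)
    have h2 := hg n (by omega)
    simp only [Par.codeOf] at h
    intro j hj
    rcases Nat.lt_succ_iff_lt_or_eq.1 hj with hj | rfl
    · exact ih (fun j hj => hf j (by omega)) (fun j hj => hg j (by omega)) (by omega) j hj
    · omega

theorem Differ.congr {n : ℕ} {f f' g g' : ℕ → ℕ} (hf : ∀ j < n, f j = f' j)
    (hg : ∀ j < n, g j = g' j) (h : Differ n f g) : Differ n f' g' := by
  obtain ⟨i, hi, h⟩ := h
  refine ⟨i, hi, ?_⟩
  unfold out1 out2 at *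
  rwa [← hf i hi, ← hg i hi]

-- A hit whose two sets differ sets `done`, and all later rounds leave the output alone. A hit with
-- equal sets destroys only the first `2 * n` cells, and the items stored there are no longer
-- needed.
set_option maxHeartbeats 800000 in
theorem lookupBody_spec : ∃ K : ℕ, ∀ {P₁ P₂ : Par} {W cap : ℕ} {S₀ : St} {l : List Node}
    {tape : ℕ → Bool}, P₂.Fits W → 3 * cap + 8 < 2 ^ W → P₁.n = P₂.n → S₀.v .n = P₂.n →
    S₀.v .q = P₂.q → Saved P₁ S₀ → Enumerated P₂ cap S₀ l → ∀ t < l.length, ∀ S,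
    LookupInv P₁ P₂ W S₀ l t S →
      LookupInv P₁ P₂ W S₀ l (t + 1) (lookupBody.eval tape S) ∧
      lookupBody.cost tape S ≤ K * ((P₂.n + 1) * (W + 1)) := by
  obtain ⟨Kh, hKh⟩ := lookupHit_spec
  obtain ⟨ca, hca⟩ : ∃ c : Cmd, c = .assign .c1 (.load (cell 5 ((Var.s + (Var.q -
    .load (cell 3 Var.x))) % Var.q))) := ⟨_, rfl⟩
  obtain ⟨cx, hcx⟩ : ∃ c : Cmd, c = .assign .x (Var.x + 1) := ⟨_, rfl⟩
  obtain ⟨e₂, he₂⟩ : ∃ e : Expr, e = Var.n - .load (cell 1 Var.x) := ⟨_, rfl⟩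
  obtain ⟨k₁, hk₁⟩ : ∃ k, k = 2 * (Var.done : Expr).K + 1 := ⟨_, rfl⟩
  obtain ⟨k₂, hk₂⟩ : ∃ k, k = 2 * e₂.K + 1 := ⟨_, rfl⟩
  obtain ⟨k₄, hk₄⟩ : ∃ k, k = 2 * (Var.c1 : Expr).K + 1 := ⟨_, rfl⟩
  obtain ⟨k₃, hk₃⟩ : ∃ k, k = ca.K := ⟨_, rfl⟩
  obtain ⟨k₅, hk₅⟩ : ∃ k, k = cx.K := ⟨_, rfl⟩
  refine ⟨k₁ + k₂ + k₃ + k₄ + Kh + k₅ + 3, ?_⟩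
  intro P₁ P₂ W cap S₀ l tape hP hcap hnn hn₀ hq₀ hD hl t ht S h
  have hn : S.v .n = P₂.n := (h.frame _ (by decide)).trans hn₀
  have hq : S.v .q = P₂.q := (h.frame _ (by decide)).trans hq₀
  have hs : S.v .s = S₀.v .s := h.frame _ (by decide)
  have hfr : ∀ x ∉ lookupBody.mods, (lookupBody.eval tape S).v x = S₀.v x := fun x hx => by
    rw [Cmd.eval_v_of_notMem tape _ hx, h.frame x hx]
  obtain ⟨x, hx⟩ : ∃ x, l[t]? = some x := ⟨_, List.getElem?_eq_getElem ht⟩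
  have hsx := hl.sound x (List.mem_of_getElem? hx)
  obtain ⟨hx1, hx2, hx3, hx4⟩ := hsx.bounds hP
  have hlen := hl.length
  obtain ⟨m1, m2, m3, m4⟩ := hl.rep t x hx
  rw [← h.rest _ (by omega)] at m1 m3 m4
  have htW : t + 1 < 2 ^ W := by omega
  obtain ⟨T, hT⟩ : ∃ T, T = Cmd.eval tape (.ite Var.done .skip (.ite e₂ .skip (block [ca,
    .ite Var.c1 lookupHit .skip]))) S := ⟨_, rfl⟩
  have hev : lookupBody.eval tape S = cx.eval tape T := by rw [hT, hca, hcx, he₂]; rfl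
  have hco : lookupBody.cost tape S = Cmd.cost tape (.ite Var.done .skip (.ite e₂ .skip (block [ca,
      .ite Var.c1 lookupHit .skip]))) S + (cx.cost tape T + 1) := by
    rw [hT, hca, hcx, he₂]; rfl
  -- it suffices to consider the first part
  suffices hmain : Bdd W T ∧ T.v .x = t ∧ (∀ a, 2 * P₂.n ≤ a → T.m a = S.m a) ∧
      (T.v .done ≠ 0 → ∃ f g, Hit P₁ P₂ (S₀.v .s) f g ∧ Decoded P₂.n f g T.m ∧ Differ P₂.n f g) ∧
      (S.v .done ≠ 0 → T.v .done ≠ 0) ∧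
      (∀ g, x = P₂.node g P₂.n → P₂.Adm g P₂.n → ∀ f, P₁.Adm f P₁.n →
        S₀.m (dict P₂.n ((S₀.v .s + (P₂.q - P₂.keyOf g P₂.n)) % P₂.q)) = Par.codeOf f P₁.n + 1 →
        Differ P₂.n f g → T.v .done ≠ 0) ∧
      Cmd.cost tape (.ite Var.done .skip (.ite e₂ .skip (block [ca,
        .ite Var.c1 lookupHit .skip]))) S ≤
        (k₁ + k₂ + k₃ + k₄ + Kh + 2) * ((P₂.n + 1) * (W + 1)) by
    obtain ⟨t1, t2, t3, t4, t5, t6, t7⟩ := hmain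
    have hexe : cx.eval tape T = T.set .x (t + 1) := by
      rw [hcx, eval_assign, Expr.eval_add, Expr.eval_var, t2]; rfl
    constructor
    · rw [hev, hexe] at hfr ⊢
      refine ⟨t1.set _ htW, by simp, hfr, fun a ha => ?_, ?_, ?_⟩
      · rw [St.set_m, t3 a ha, h.rest a ha]
      · simpa using t4
      · intro j hj g hjg hg f hf hk hd
        simp only [St.set_v, reduceCtorEq, if_false]
        rcases Nat.lt_succ_iff_lt_or_eq.1 hj with hj | rfl
        · exact t5 (h.found j hj g hjg hg f hf hk hd)
        · rw [hx, Option.some.injEq] at hjg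
          exact t6 g hjg hg f hf hk hd
    · have h1 := Cmd.cost_le tape cx (by rw [hcx]; rfl) t1
      have h2 : (k₅ + 1) * (W + 1) ≤ (k₅ + 1) * ((P₂.n + 1) * (W + 1)) :=
        Nat.mul_le_mul_left _ (Nat.le_mul_of_pos_left _ (by omega))
      rw [← hk₅] at h1
      rw [hco]
      obtain ⟨M, hMdef⟩ : ∃ M, M = (P₂.n + 1) * (W + 1) := ⟨_, rfl⟩
      rw [← hMdef] at h2 t7 ⊢
      simp only [add_mul] at h1 h2 t7 ⊢
      linarith
  have hM : W + 1 ≤ (P₂.n + 1) * (W + 1) := Nat.le_mul_of_pos_left _ (by omega)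
  obtain ⟨M, hMdef⟩ : ∃ M, M = (P₂.n + 1) * (W + 1) := ⟨_, rfl⟩
  rw [← hMdef] at hM ⊢
  have hmul : ∀ a, a * (W + 1) ≤ a * M := fun a => Nat.mul_le_mul_left _ hM
  have hM1 : 1 ≤ M := by omega
  have hcost1 := Cmd.cost_ite_le tape h.bdd Var.done .skip (.ite e₂ .skip (block [ca,
    .ite Var.c1 lookupHit .skip]))
  rw [← hk₁] at hcost1
  have hu1 := hmul k₁
  by_cases hdone : (Var.done : Expr).eval S ≠ 0
  · have hTS : T = S := by rw [hT, eval_ite_pos _ _ _ _ hdone]; rfl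
    rw [if_pos hdone] at hcost1
    rw [hTS]
    refine ⟨h.bdd, h.x, fun _ _ => rfl, h.done, id, fun _ _ _ _ _ _ _ => hdone, ?_⟩
    rw [cost_skip] at hcost1
    have hr : 0 ≤ (k₂ + k₃ + k₄ + Kh + 1) * M := Nat.zero_le _
    simp only [add_mul] at hr ⊢
    linarith
  rw [if_neg hdone] at hcost1
  rw [eval_ite_neg _ _ _ _ (not_not.1 hdone)] at hT
  have hcost2 := Cmd.cost_ite_le tape h.bdd e₂ .skip (block [ca, .ite Var.c1 lookupHit .skip])
  rw [← hk₂] at hcost2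
  have hu2 := hmul k₂
  have he₂e : e₂.eval S = P₂.n - x.stage := by simp [he₂, cell, hn, h.x, m1]
  have hnd : S.v .done = 0 := not_not.1 hdone
  by_cases hst : e₂.eval S ≠ 0
  · have hTS : T = S := by rw [hT, eval_ite_pos _ _ _ _ hst]; rfl
    rw [if_pos hst] at hcost2
    rw [hTS]
    refine ⟨h.bdd, h.x, fun _ _ => rfl, h.done, id, ?_, ?_⟩
    · rintro g rfl
      simp [he₂e, Par.node] at hst
    · rw [cost_skip] at hcost2
      have hr : 0 ≤ (k₃ + k₄ + Kh + 1) * M := Nat.zero_le _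
      simp only [add_mul] at hr ⊢
      linarith
  rw [if_neg hst] at hcost2
  rw [eval_ite_neg _ _ _ _ (not_not.1 hst)] at hT
  rw [he₂e] at hst
  have hstage : x.stage = P₂.n := by omega
  obtain ⟨κ, hκ⟩ : ∃ κ, κ = (S₀.v .s + (P₂.q - x.key)) % P₂.q := ⟨_, rfl⟩
  obtain ⟨U, hU⟩ : ∃ U, U = ca.eval tape S := ⟨_, rfl⟩
  have hUe : U = S.set .c1 (S₀.m (dict P₂.n κ)) := by
    have := h.rest (dict P₂.n κ) (by unfold dict; omega)
    rw [hU, hca, ← this]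
    simp [cell, hn, h.x, m3, hq, hs, hκ, dict]
  have hUb : Bdd W U := by
    rw [hUe, ← h.rest (dict P₂.n κ) (by unfold dict; omega)]
    exact h.bdd.set _ (h.bdd.m _)
  have hcost3 := Cmd.cost_le tape ca (by rw [hca]; rfl) h.bdd
  rw [← hk₃] at hcost3
  have hu3 := hmul k₃
  have hcost4 := Cmd.cost_ite_le tape hUb Var.c1 lookupHit .skip
  rw [← hk₄] at hcost4
  have hu4 := hmul k₄
  have hcost23 : (block [ca, .ite Var.c1 lookupHit .skip]).cost tape S = ca.cost tape S +
      ((Cmd.ite Var.c1 lookupHit .skip).cost tape U + 1) := by rw [hU]; rfl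
  replace hT : T = Cmd.eval tape (.ite Var.c1 lookupHit .skip) U := by rw [hT, hU]; rfl
  have hc1e : (Var.c1 : Expr).eval U = S₀.m (dict P₂.n κ) := by simp [hUe]
  by_cases hhit : (Var.c1 : Expr).eval U ≠ 0
  · rw [eval_ite_pos _ _ _ _ hhit] at hT
    rw [if_pos hhit] at hcost4
    rw [hc1e, ← hnn] at hhit
    obtain ⟨f, hf, hfk, -, hfc⟩ := hD.sound κ hhit
    obtain ⟨g, i, hi, hg, rfl⟩ := hsx
    have hi : i = P₂.n := hstage
    subst hi
    have hf3 : ∀ j < P₂.n, f j < 3 := fun j hj => hf.digit_lt (by omega)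
    have hg3 : ∀ j < P₂.n, g j < 3 := fun j hj => hg.digit_lt hj
    have hκ' : κ = (S₀.v .s + (P₂.q - P₂.keyOf g P₂.n)) % P₂.q := hκ
    rw [hnn] at hfc
    obtain ⟨d1, d2, d3, d4, d5⟩ := hKh (tape := tape) (f := f) (g := g) (S := U) hP.n_lt
      hf3 hg3 (by simp [hUe, hn]) (by simp [hUe, hfc])
      (by rw [hUe]; simpa [h.x, Par.node] using m4) hUb
    rw [← hT] at d1 d2 d3 d4
    have hTx : T.v .x = t := by
      rw [hT, Cmd.eval_v_of_notMem tape _ (by decide), hUe]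
      simpa using h.x
    refine ⟨d1, hTx, fun a ha => ?_, fun hne => ?_, fun hne => absurd hnd hne, ?_, ?_⟩
    · rw [d3 a ha, hUe]
      rfl
    · exact ⟨f, g, ⟨hf, hg, by rw [hfk, hκ']⟩, d2, d4.1 hne⟩
    · intro g' hgg' hg' f' hf' hk hdiff
      have hcg : Par.codeOf g P₂.n = Par.codeOf g' P₂.n := congrArg Node.code hgg'
      have hkg : P₂.keyOf g P₂.n = P₂.keyOf g' P₂.n := congrArg Node.key hgg'
      rw [← hkg, ← hκ', hfc, hnn] at hk
      refine d4.2 (hdiff.congr (codeOf_inj (fun j hj => hf'.digit_lt (by omega)) hf3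
        (Nat.add_right_cancel hk).symm)
        (codeOf_inj (fun j hj => hg'.digit_lt hj) hg3 hcg.symm))
    · rw [← hMdef] at d5
      rw [hcost23] at hcost2
      simp only [add_mul]
      linarith
  · rw [eval_ite_neg _ _ _ _ (not_not.1 hhit)] at hT
    rw [if_neg hhit] at hcost4
    have hTU : T = U := hT
    have hTdone : T.v .done = 0 := by rw [hTU, hUe]; simpa using hnd
    refine ⟨by rw [hTU]; exact hUb, by rw [hTU, hUe]; simpa using h.x,
      fun a _ => by rw [hTU, hUe]; rfl, fun hne => absurd hTdone hne, fun hne => absurd hnd hne,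
      ?_, ?_⟩
    · intro g' hgg' hg' f' hf' hk hdiff
      have hkg : x.key = P₂.keyOf g' P₂.n := congrArg Node.key hgg'
      rw [← hkg, ← hκ, ← hc1e] at hk
      exact absurd (by omega) hhit
    · rw [hcost23] at hcost2
      rw [cost_skip] at hcost4
      have hr : 0 ≤ Kh * M := Nat.zero_le _
      simp only [add_mul]
      linarith

theorem lookup_spec : ∃ K : ℕ, ∀ {P₁ P₂ : Par} {W cap : ℕ} {S : St} {l : List Node}
    {tape : ℕ → Bool}, P₂.Fits W → 3 * cap + 8 < 2 ^ W → P₁.n = P₂.n → S.v .n = P₂.n →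
    S.v .q = P₂.q → S.v .done = 0 → Saved P₁ S → Enumerated P₂ cap S l → Bdd W S →
      ((lookup.eval tape S).v .done ≠ 0 → ∃ f g, Hit P₁ P₂ (S.v .s) f g ∧
        Decoded P₂.n f g (lookup.eval tape S).m ∧ Differ P₂.n f g) ∧
      (∀ g, P₂.node g P₂.n ∈ l → P₂.Adm g P₂.n → ∀ f, P₁.Adm f P₁.n →
        S.m (dict P₂.n ((S.v .s + (P₂.q - P₂.keyOf g P₂.n)) % P₂.q)) = Par.codeOf f P₁.n + 1 →
        Differ P₂.n f g → (lookup.eval tape S).v .done ≠ 0) ∧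
      lookup.cost tape S ≤ K * ((cap + 1) * (P₂.n + 1) * (W + 1)) := by
  obtain ⟨Kb, hKb⟩ := lookupBody_spec
  obtain ⟨c, hc⟩ : ∃ c : Cmd, c = .assign .x 0 := ⟨_, rfl⟩
  refine ⟨4 * (c.K + 1 + (Kb + (3 * (Var.tail : Expr).K + 6))), ?_⟩
  intro P₁ P₂ W cap S l tape hP hcap hnn hn hq hdone hD hl hB
  have hc1 : c.cost tape S ≤ c.K * (W + 1) := Cmd.cost_le tape c (by rw [hc]; rfl) hB
  have hce : c.eval tape S = S.set .x 0 := by rw [hc]; rfl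
  have hcb : Bdd W (c.eval tape S) := by rw [hce]; exact hB.set _ (by omega)
  have hl' : Enumerated P₂ cap (c.eval tape S) l := by
    rw [hce]
    exact ⟨hl.rep, by simp [hl.tail], hl.length, hl.sound, hl.ways, hl.complete⟩
  have hD' : Saved P₁ (c.eval tape S) := by rw [hce]; exact ⟨hD.sound⟩
  obtain ⟨hI, hcost⟩ := Cmd.rep_rule (tape := tape) (e := Var.tail) (c := lookupBody)
    (S := c.eval tape S) (LookupInv P₁ P₂ W (c.eval tape S) l) (N := l.length)
    (A := Kb * ((P₂.n + 1) * (W + 1))) (W := W) (by simpa using hl'.tail) hcb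
    ⟨hcb, by simp [hce], fun _ _ => rfl, fun _ _ => rfl,
      fun h => absurd (by simpa [hce] using hdone) h, fun j hj => by omega⟩
    (hKb hP hcap hnn (by simp [hce, hn]) (by simp [hce, hq]) hD' hl')
  have hev : lookup.eval tape S = (Cmd.rep Var.tail lookupBody).eval tape (c.eval tape S) := by
    rw [hc]; rfl
  have hs : (c.eval tape S).v .s = S.v .s := by simp [hce]
  have hm : (c.eval tape S).m = S.m := by rw [hce]; rfl
  rw [← hev] at hI
  have hlen := hl.length
  have hd := hI.done
  have hf := hI.found
  rw [hs] at hd hf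
  rw [hm] at hf
  refine ⟨hd, ?_, ?_⟩
  · intro g hg hga f hfa hk hdiff
    obtain ⟨j, hj, hjx⟩ := List.getElem_of_mem hg
    exact hf j hj g (by rw [List.getElem?_eq_getElem hj, hjx]) hga f hfa hk hdiff
  · have hco : lookup.cost tape S = c.cost tape S +
        ((Cmd.rep Var.tail lookupBody).cost tape (c.eval tape S) + 1) := by rw [hc]; rfl
    rw [hco]
    have hNW : W + 1 ≤ (P₂.n + 1) * (W + 1) := Nat.le_mul_of_pos_left _ (by omega)
    -- A round may contain a complete decoding and thus costs a multiple of `(n + 1) * (W + 1)`;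
    -- this product takes the role of the word length in `loop_cost_le`.
    obtain ⟨w, hw⟩ : ∃ w, (P₂.n + 1) * (W + 1) = w + 1 :=
      ⟨(P₂.n + 1) * (W + 1) - 1, by omega⟩
    have h2 : (Cmd.rep Var.tail lookupBody).cost tape (c.eval tape S) ≤ (l.length + 1) *
        (Kb * (w + 1) + (3 * (Var.tail : Expr).K + 6) * (w + 1)) := by
      refine hcost.trans (Nat.mul_le_mul_left _ ?_)
      rw [hw] at hNW ⊢
      exact Nat.add_le_add_left (Nat.mul_le_mul_left _ hNW) _
    have h3 : c.cost tape S ≤ c.K * (w + 1) :=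
      hc1.trans (Nat.mul_le_mul_left _ (by rw [← hw]; exact hNW))
    have := loop_cost_le h3 h2 (show l.length ≤ 4 * cap + 3 by omega)
    rw [mul_assoc (cap + 1), hw]
    calc _ ≤ _ := this
      _ = _ := by ring

/-! ### A complete search with given parameters -/

/-- The parameters for the first list. -/
def setup1 : Cmd := block [.assign .done 0, .assign .lo 0, .assign .hi Var.c, .assign .f1 1,
  .assign .f2 (1 - Var.md), .assign .k Var.k1]

/-- The parameters for the second list. -/
def setup2 : Cmd := block [.assign .lo (Var.c * (1 - Var.md)), .assign .hi Var.n,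
  .assign .f1 (1 - Var.md), .assign .f2 1, .assign .k Var.k2]

/-- Enumerate both lists and search for a pair with matching keys. -/
def core : Cmd := block [setup1, table, bfs, save, setup2, table, bfs, lookup]

/-- The numbers that determine a search. -/
structure Search : Type where
  (n p q s c md k1 k2 : ℕ)
  b : ℕ → ℕ

/-- The first list of a search. -/
def Search.P₁ (A : Search) : Par :=
  ⟨A.n, A.p, A.q, A.md, 1 - A.md, 0, A.c, 1, 1 - A.md, A.k1, A.b⟩

/-- The second list of a search. -/
def Search.P₂ (A : Search) : Par :=
  ⟨A.n, A.p, A.q, A.md, 1 - A.md, A.c * (1 - A.md), A.n, 1 - A.md, 1, A.k2, A.b⟩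

/-- The key that matches the key of `g`. -/
def Search.partner (A : Search) (g : ℕ → ℕ) : ℕ := (A.s + (A.q - A.P₂.keyOf g A.n)) % A.q

/-- `f` is a completion with the right residue. -/
def Par.Full (P : Par) (f : ℕ → ℕ) : Prop := P.Adm f P.n ∧ P.resOf f P.n = P.k

/-- Whatever completions the dictionary contains, there is a match. -/
def Search.Good (A : Search) : Prop := ∀ F : ℕ → ℕ → ℕ,
  (∀ f, A.P₁.Full f → A.P₁.Full (F (A.P₁.keyOf f A.n)) ∧
    A.P₁.keyOf (F (A.P₁.keyOf f A.n)) A.n = A.P₁.keyOf f A.n) →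
  ∃ g, A.P₂.Full g ∧ (∃ f, A.P₁.Full f ∧ A.P₁.keyOf f A.n = A.partner g) ∧
    Differ A.n (F (A.partner g)) g

/-- The state `S` holds the numbers of the search. -/
structure Search.Vars (A : Search) (S : St) : Prop where
  n : S.v .n = A.n
  p : S.v .p = A.p
  q : S.v .q = A.q
  s : S.v .s = A.s
  c : S.v .c = A.c
  md : S.v .md = A.md
  al : S.v .al = A.md
  be : S.v .be = 1 - A.md
  k1 : S.v .k1 = A.k1
  k2 : S.v .k2 = A.k2
  b : ∀ i < A.n, S.m i = A.b i
  dict : ∀ κ, S.m (dict A.n κ) = 0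

/-- Bounds for the numbers of a search. -/
structure Search.Fits (A : Search) (W : ℕ) : Prop where
  p_pos : 0 < A.p
  q_pos : 0 < A.q
  table : (A.n + 1) * A.p < 2 ^ W
  q_lt : A.q < 2 ^ W
  codes : 3 ^ A.n < 2 ^ W
  n_lt : 4 * A.n + 4 < 2 ^ W
  c_lt : A.c < 2 ^ W

theorem outside_dict (n κ : ℕ) : Outside n (dict n κ) := Or.inr ⟨κ, Or.inr rfl⟩

theorem dict_ne (n κ y : ℕ) : dict n κ ≠ 2 * n + 6 * y := by
  unfold dict
  omega

theorem core_spec : ∃ K : ℕ, ∀ {A : Search} {W cap : ℕ} {S : St} {tape : ℕ → Bool}, A.Fits W →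
    A.Vars S → S.v .cap = cap → 3 * cap + 8 < 2 ^ W → Bdd W S →
      core.cost tape S ≤ K * ((cap + (A.n + 1) * A.p + 1) * (A.n + 1) * (W + 1)) ∧
      (A.P₁.treeSize A.n 0 ≤ cap → A.P₂.treeSize A.n 0 ≤ cap → A.Good →
        ∃ f g, Hit A.P₁ A.P₂ A.s f g ∧ Decoded A.n f g (core.eval tape S).m ∧ Differ A.n f g) := by
  obtain ⟨Kt, hKt⟩ := table_spec
  obtain ⟨Kb, hKb⟩ := bfs_spec
  obtain ⟨Ks, hKs⟩ := save_spec
  obtain ⟨Kl, hKl⟩ := lookup_spec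
  obtain ⟨k₁, hk₁⟩ : ∃ k, k = setup1.K := ⟨_, rfl⟩
  obtain ⟨k₂, hk₂⟩ : ∃ k, k = setup2.K := ⟨_, rfl⟩
  refine ⟨k₁ + k₂ + 2 * Kt + 2 * Kb + Ks + Kl + 1, ?_⟩
  intro A W cap S tape hA hV hcap hcW hB
  have h1W : 1 < 2 ^ W := by omega
  have hF1 : A.P₁.Fits W := ⟨hA.p_pos, hA.q_pos, le_rfl, Nat.sub_le _ _, hA.table, hA.q_lt,
    hA.codes, hA.n_lt⟩
  have hF2 : A.P₂.Fits W := ⟨hA.p_pos, hA.q_pos, Nat.sub_le _ _, le_rfl, hA.table, hA.q_lt,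
    hA.codes, hA.n_lt⟩
  have hmdW : 1 - A.md < 2 ^ W := (Nat.sub_le _ _).trans_lt h1W
  -- the first list
  obtain ⟨S₁, hS₁⟩ : ∃ T, T = setup1.eval tape S := ⟨_, rfl⟩
  have e1 : S₁ = (((((S.set .done 0).set .lo 0).set .hi A.c).set .f1 1).set .f2
      (1 - A.md)).set .k A.k1 := by
    rw [hS₁]
    simp [setup1, hV.c, hV.md, hV.k1]
  have b1 : Bdd W S₁ := by
    rw [e1]
    exact (((((hB.set _ (by omega)).set _ (by omega)).set _ hA.c_lt).set _ h1W).set _ hmdW).set _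
      (by rw [← hV.k1]; exact hB.v _)
  have v1 : A.P₁.Vars S₁ := by
    rw [e1]
    exact ⟨by simp [hV.n, Search.P₁], by simp [hV.p, Search.P₁], by simp [hV.q, Search.P₁],
      by simp [hV.al, Search.P₁], by simp [hV.be, Search.P₁], by simp [Search.P₁],
      by simp [Search.P₁], by simp [Search.P₁], by simp [Search.P₁], by simp [Search.P₁], hV.b⟩
  obtain ⟨S₂, hS₂⟩ : ∃ T, T = table.eval tape S₁ := ⟨_, rfl⟩
  obtain ⟨b2, t2, m2, c2⟩ := hKt (tape := tape) hF1 v1 b1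
  rw [← hS₂] at b2 t2 m2
  have fr2 : ∀ x ∉ table.mods, S₂.v x = S₁.v x := fun x hx => by
    rw [hS₂, Cmd.eval_v_of_notMem tape _ hx]
  have v2 : A.P₁.Vars S₂ := v1.of_frame fr2 (fun i hi => m2 i (fun y => by
    have : A.P₁.n = A.n := rfl
    omega))
  have cap2 : S₂.v .cap = cap := by rw [fr2 _ (by decide), e1]; simpa using hcap
  obtain ⟨S₃, hS₃⟩ : ∃ T, T = bfs.eval tape S₂ := ⟨_, rfl⟩
  obtain ⟨b3, ⟨l, en3⟩, m3, c3⟩ := hKb (tape := tape) hF1 v2 t2 cap2 hcW b2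
  rw [← hS₃] at b3 en3 m3
  have fr3 : ∀ x ∉ bfs.mods, S₃.v x = S₂.v x := fun x hx => by
    rw [hS₃, Cmd.eval_v_of_notMem tape _ hx]
  have d3 : ∀ κ, S₃.m (dict A.P₁.n κ) = 0 := fun κ => by
    rw [m3 _ (outside_dict _ _), m2 _ (fun y => dict_ne _ _ _), e1]
    exact hV.dict κ
  obtain ⟨S₄, hS₄⟩ : ∃ T, T = save.eval tape S₃ := ⟨_, rfl⟩
  have n3 : S₃.v .n = A.n := by rw [fr3 _ (by decide), fr2 _ (by decide), e1]; simpa using hV.n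
  obtain ⟨b4, sv4, sa4, m4, c4⟩ := hKs (tape := tape) hF1 hcW n3 en3 b3 d3
  rw [← hS₄] at b4 sv4 sa4 m4
  have fr4 : ∀ x ∉ save.mods, S₄.v x = S₃.v x := fun x hx => by
    rw [hS₄, Cmd.eval_v_of_notMem tape _ hx]
  have fr4' : ∀ x, x ∉ table.mods → x ∉ bfs.mods → x ∉ save.mods → S₄.v x = S₁.v x :=
    fun x h1 h2 h3 => by rw [fr4 x h3, fr3 x h2, fr2 x h1]
  have bm4 : ∀ i < A.n, S₄.m i = A.b i := fun i hi => by
    rw [m4 _ (fun κ => by unfold dict; have : A.P₁.n = A.n := rfl; omega),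
      m3 _ (Or.inl (by have : A.P₁.n = A.n := rfl; omega)),
      m2 _ (fun y => by have : A.P₁.n = A.n := rfl; omega), e1]
    exact hV.b i hi
  have frs : ∀ x, x ∉ setup1.mods → x ∉ table.mods → x ∉ bfs.mods → x ∉ save.mods →
      S₄.v x = S.v x := fun x h0 h1 h2 h3 => by
    rw [fr4' x h1 h2 h3, hS₁, Cmd.eval_v_of_notMem tape _ h0]
  -- the second list
  obtain ⟨S₅, hS₅⟩ : ∃ T, T = setup2.eval tape S₄ := ⟨_, rfl⟩
  have c4' : S₄.v .c = A.c := (frs _ (by decide) (by decide) (by decide) (by decide)).trans hV.c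
  have md4 : S₄.v .md = A.md := (frs _ (by decide) (by decide) (by decide) (by decide)).trans hV.md
  have n4 : S₄.v .n = A.n := (frs _ (by decide) (by decide) (by decide) (by decide)).trans hV.n
  have k24 : S₄.v .k2 = A.k2 := (frs _ (by decide) (by decide) (by decide) (by decide)).trans hV.k2
  have e5 : S₅ = ((((S₄.set .lo (A.c * (1 - A.md))).set .hi A.n).set .f1 (1 - A.md)).set .f2
      1).set .k A.k2 := by
    rw [hS₅]
    simp [setup2, c4', md4, n4, k24]
  have b5 : Bdd W S₅ := by
    rw [e5]
    refine ((((b4.set _ ?_).set _ ?_).set _ hmdW).set _ h1W).set _ ?_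
    · exact ((Nat.mul_le_mul_left A.c (Nat.sub_le 1 A.md)).trans (Nat.mul_one _).le).trans_lt hA.c_lt
    · have := hA.n_lt; omega
    · rw [← k24]; exact b4.v _
  have v5 : A.P₂.Vars S₅ := by
    rw [e5]
    refine ⟨?_, ?_, ?_, ?_, ?_, by simp [Search.P₂], by simp [Search.P₂], by simp [Search.P₂],
      by simp [Search.P₂], by simp [Search.P₂], bm4⟩
    · simp [n4, Search.P₂]
    · simp [(frs .p (by decide) (by decide) (by decide) (by decide)).trans hV.p, Search.P₂]
    · simp [(frs .q (by decide) (by decide) (by decide) (by decide)).trans hV.q, Search.P₂]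
    · simp [(frs .al (by decide) (by decide) (by decide) (by decide)).trans hV.al, Search.P₂]
    · simp [(frs .be (by decide) (by decide) (by decide) (by decide)).trans hV.be, Search.P₂]
  have fr5 : ∀ x ∉ setup2.mods, S₅.v x = S₄.v x := fun x hx => by
    rw [hS₅, Cmd.eval_v_of_notMem tape _ hx]
  obtain ⟨S₆, hS₆⟩ : ∃ T, T = table.eval tape S₅ := ⟨_, rfl⟩
  obtain ⟨b6, t6, m6, c6⟩ := hKt (tape := tape) hF2 v5 b5
  rw [← hS₆] at b6 t6 m6
  have fr6 : ∀ x ∉ table.mods, S₆.v x = S₅.v x := fun x hx => by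
    rw [hS₆, Cmd.eval_v_of_notMem tape _ hx]
  have v6 : A.P₂.Vars S₆ := v5.of_frame fr6 (fun i hi => m6 i (fun y => by
    have : A.P₂.n = A.n := rfl
    omega))
  have cap6 : S₆.v .cap = cap := by
    rw [fr6 _ (by decide), fr5 _ (by decide), frs _ (by decide) (by decide) (by decide) (by decide)]
    exact hcap
  obtain ⟨S₇, hS₇⟩ : ∃ T, T = bfs.eval tape S₆ := ⟨_, rfl⟩
  obtain ⟨b7, ⟨l', en7⟩, m7, c7⟩ := hKb (tape := tape) hF2 v6 t6 cap6 hcW b6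
  rw [← hS₇] at b7 en7 m7
  have fr7 : ∀ x ∉ bfs.mods, S₇.v x = S₆.v x := fun x hx => by
    rw [hS₇, Cmd.eval_v_of_notMem tape _ hx]
  have fr7' : ∀ x, x ∉ setup2.mods → x ∉ table.mods → x ∉ bfs.mods → S₇.v x = S₄.v x :=
    fun x h0 h1 h2 => by rw [fr7 x h2, fr6 x h1, fr5 x h0]
  have dm7 : ∀ κ, S₇.m (dict A.n κ) = S₄.m (dict A.n κ) := fun κ => by
    refine (m7 _ (outside_dict A.n κ)).trans ((m6 _ (fun y => dict_ne A.n κ y)).trans ?_)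
    rw [e5]
    rfl
  have sv7 : Saved A.P₁ S₇ := ⟨fun κ hκ => by
    change S₇.m (dict A.n κ) ≠ 0 at hκ
    rw [dm7] at hκ
    obtain ⟨f, h1, h2, h3, h4⟩ := sv4.sound κ hκ
    exact ⟨f, h1, h2, h3, (dm7 κ).trans h4⟩⟩
  have q7 : S₇.v .q = A.q := by
    rw [fr7' _ (by decide) (by decide) (by decide), frs _ (by decide) (by decide) (by decide)
      (by decide), hV.q]
  have n7 : S₇.v .n = A.n := by
    rw [fr7' _ (by decide) (by decide) (by decide), n4]
  have s7 : S₇.v .s = A.s := by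
    rw [fr7' _ (by decide) (by decide) (by decide), frs _ (by decide) (by decide) (by decide)
      (by decide), hV.s]
  have done7 : S₇.v .done = 0 := by
    rw [fr7' _ (by decide) (by decide) (by decide), fr4' _ (by decide) (by decide) (by decide), e1]
    simp
  obtain ⟨l1, l2, c8⟩ := hKl (tape := tape) (P₁ := A.P₁) hF2 hcW rfl n7 q7 done7 sv7 en7 b7
  have hev : core.eval tape S = lookup.eval tape S₇ := by
    rw [hS₇, hS₆, hS₅, hS₄, hS₃, hS₂, hS₁]; rfl
  have hco : core.cost tape S = setup1.cost tape S + (table.cost tape S₁ + (bfs.cost tape S₂ +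
      (save.cost tape S₃ + (setup2.cost tape S₄ + (table.cost tape S₅ + (bfs.cost tape S₆ +
      (lookup.cost tape S₇ + 1))))))) := by
    rw [hS₇, hS₆, hS₅, hS₄, hS₃, hS₂, hS₁]; rfl
  constructor
  · have c1 := Cmd.cost_le tape setup1 rfl hB
    have c5 := Cmd.cost_le tape setup2 rfl b4
    rw [← hk₁] at c1
    rw [← hk₂] at c5
    have en1 : A.P₁.n = A.n := rfl
    have en2 : A.P₂.n = A.n := rfl
    have ep1 : A.P₁.p = A.p := rfl
    have ep2 : A.P₂.p = A.p := rfl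
    rw [en1, ep1] at c2
    rw [en2, ep2] at c6
    rw [en2] at c8
    obtain ⟨M, hM⟩ : ∃ M, M = (cap + (A.n + 1) * A.p + 1) * (A.n + 1) * (W + 1) := ⟨_, rfl⟩
    have h1 : (cap + 1) * (A.n + 1) * (W + 1) ≤ M := by
      rw [hM]
      exact Nat.mul_le_mul_right _ (Nat.mul_le_mul_right _ (by omega))
    have h2 : (cap + 1) * (W + 1) ≤ M := by
      refine le_trans ?_ h1
      exact Nat.mul_le_mul_right _ (Nat.le_mul_of_pos_right _ (by omega))
    have h3 : ((A.n + 1) * A.p + 1) * (W + 1) ≤ M := by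
      rw [hM]
      refine Nat.mul_le_mul_right _ (le_trans ?_ (Nat.le_mul_of_pos_right _ (by omega)))
      omega
    have h4 : W + 1 ≤ M := le_trans (Nat.le_mul_of_pos_left _ (by omega)) h2
    have h5 := Nat.mul_le_mul_left k₁ h4
    have h6 := Nat.mul_le_mul_left k₂ h4
    have h7 := Nat.mul_le_mul_left Kt h3
    have h8 := Nat.mul_le_mul_left Kb h2
    have h9 := Nat.mul_le_mul_left Ks h2
    have h10 := Nat.mul_le_mul_left Kl h1
    rw [hco, ← hM]
    simp only [add_mul, mul_assoc 2]
    linarith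
  · intro ht1 ht2 hgood
    rw [hev]
    -- the completions in the dictionary
    have hsa := sa4 ht1
    -- The function `F` demanded by `Search.Good` is read off from the dictionary. Where no
    -- completion has the key, its value is irrelevant and the zero digits serve as a default.
    have hex : ∀ κ, ∃ f', ∀ f, A.P₁.Full f → A.P₁.keyOf f A.n = κ → (A.P₁.Full f' ∧
        A.P₁.keyOf f' A.n = κ ∧ S₄.m (dict A.n κ) = Par.codeOf f' A.n + 1) := by
      intro κ
      by_cases h : ∃ f, A.P₁.Full f ∧ A.P₁.keyOf f A.n = κ
      · obtain ⟨f, hf, hfk⟩ := h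
        have hne := hsa f hf.1 hf.2
        change S₄.m (dict A.n (A.P₁.keyOf f A.n)) ≠ 0 at hne
        rw [hfk] at hne
        obtain ⟨f', h1, h2, h3, h4⟩ := sv4.sound κ hne
        have hw : A.P₁.count A.P₁.n 0 ≠ 0 := by
          have := A.P₁.count_ne_zero_of_adm hf.1 hf.2 A.P₁.n le_rfl
          simpa [Par.resOf] using this
        exact ⟨f', fun _ _ _ => ⟨⟨h1, h3 hw⟩, h2, h4⟩⟩
      · exact ⟨fun _ => 0, fun f hf hfk => absurd ⟨f, hf, hfk⟩ h⟩
    choose F hF using hex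
    obtain ⟨g, hg, ⟨f, hf, hfk⟩, hd⟩ := hgood F (fun f hf =>
      ⟨(hF _ f hf rfl).1, (hF _ f hf rfl).2.1⟩)
    obtain ⟨hF1', hF2', hF3⟩ := hF _ f hf hfk
    have hne := l2 g (en7.complete ht2 g hg.1 hg.2) hg.1 (F (A.partner g)) hF1'.1 (by
      rw [s7]
      exact (dm7 _).trans hF3) hd
    have := l1 hne
    rw [s7] at this
    exact this

/-! ### Preparation: size test, coins and reduction modulo `q` -/

theorem St.set_set (S : St) (x : Var) (a b : ℕ) : (S.set x a).set x b = S.set x b := by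
  ext y <;> simp only [St.set_v, St.set_m, St.set_coins]
  split_ifs <;> rfl

/-- A loop whose states are known. -/
theorem Cmd.rep_eq {tape : ℕ → Bool} {e : Expr} {c : Cmd} {S : St} {N W : ℕ} (F : ℕ → St)
    (hc : c.Straight) (hN : e.eval S = N) (h0 : F 0 = S) (hB : ∀ t ≤ N, Bdd W (F t))
    (hs : ∀ t < N, c.eval tape (F t) = F (t + 1)) :
    (Cmd.rep e c).eval tape S = F N ∧
      (Cmd.rep e c).cost tape S ≤ (c.K + 3 * e.K + 6) * ((N + 1) * (W + 1)) := by
  have h := Cmd.rep_rule (tape := tape) (e := e) (c := c) (S := S) (fun t T => T = F t)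
    (N := N) (A := c.K * (W + 1)) (W := W) hN (h0 ▸ hB 0 (Nat.zero_le _)) h0.symm
    (fun t ht T hT => by
      subst hT
      exact ⟨hs t ht, Cmd.cost_le tape c hc (hB t ht.le)⟩)
  refine ⟨h.1, h.2.trans (le_of_eq ?_)⟩
  ring

/-- Add up the items. -/
def sumLoop : Cmd :=
  .rep Var.n (block [.assign .sum (Var.sum + .load Var.i), .assign .i (Var.i + 1)])

/-- Square `x` until it exceeds the sum. -/
def squareLoop : Cmd :=
  .rep Var.n (.ite (Var.sum + 1 - Var.x) (.assign .x (Var.x * Var.x)) .skip)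

/-- Compute the range of the random numbers. -/
def rangeLoop : Cmd := .rep Var.n (.assign .modM (Var.modM * 65536))

/-- Draw a random number. -/
def flipLoop : Cmd :=
  .rep (128 * Var.n) (block [.flip .x, .assign .rnd (2 * Var.rnd + Var.x), .assign .x 0])

/-- Reduce the items modulo `q`. -/
def reduceLoop : Cmd :=
  .rep Var.n (block [.store Var.i (.load Var.i % Var.q), .assign .i (Var.i + 1)])

/-- The number with the given binary digits. -/
def bitsVal (tape : ℕ → Bool) : ℕ → ℕ
  | 0 => 0
  | t + 1 => 2 * bitsVal tape t + (tape t).toNat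

theorem bitsVal_lt (tape : ℕ → Bool) (t : ℕ) : bitsVal tape t < 2 ^ t := by
  induction t with
  | zero => simp [bitsVal]
  | succ t ih =>
    have : (tape t).toNat ≤ 1 := Bool.toNat_le _
    rw [bitsVal, pow_succ]
    omega

/-- Repeated squaring until `σ` is exceeded. -/
def squares (σ : ℕ) : ℕ → ℕ
  | 0 => 2
  | t + 1 => if squares σ t ≤ σ then squares σ t * squares σ t else squares σ t

theorem squares_spec (σ t : ℕ) :
    squares σ t = 2 ^ 2 ^ t ∨ σ < squares σ t ∧ squares σ t ≤ 2 ^ 2 ^ t := by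
  induction t with
  | zero => left; rfl
  | succ t ih =>
    have hm : 2 ^ 2 ^ t ≤ 2 ^ 2 ^ (t + 1) := Nat.pow_le_pow_right two_pos
      (Nat.pow_le_pow_right two_pos (Nat.le_succ t))
    rw [squares]
    split_ifs with h
    · left
      rcases ih with ih | ih
      · rw [ih, ← pow_add, pow_succ]
        congr 1
        ring
      · omega
    · right
      rcases ih with ih | ih
      · rw [ih] at h ⊢
        exact ⟨by omega, hm⟩
      · exact ⟨ih.1, ih.2.trans hm⟩

/-- This decides whether `σ` reaches `2 ^ 2 ^ n` without writing down that number, whose length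
would not be polynomial in the input. -/
theorem squares_le_iff (σ t : ℕ) : squares σ t ≤ σ ↔ 2 ^ 2 ^ t ≤ σ := by
  rcases squares_spec σ t with h | h
  · rw [h]
  · constructor
    · omega
    · intro; omega

/-- Only numbers up to `σ` are ever squared, so the length at most doubles beyond that of `σ`. -/
theorem squares_lt {σ L : ℕ} (h : σ < 2 ^ L) (t : ℕ) : squares σ t < 2 ^ (2 * L + 2) := by
  have h2 : (2 : ℕ) ^ (2 * L + 2) = 4 * (2 ^ L * 2 ^ L) := by rw [pow_add, two_mul, pow_add]; ring
  have h3 : 1 ≤ 2 ^ L := Nat.one_le_two_pow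
  induction t with
  | zero => rw [h2, squares]; nlinarith
  | succ t ih =>
    rw [squares]
    split_ifs with h4
    · rw [h2]
      have : squares σ t * squares σ t ≤ 2 ^ L * 2 ^ L := Nat.mul_le_mul (by omega) (by omega)
      nlinarith
    · exact ih

section loops
variable {tape : ℕ → Bool} {S : St} {N W : ℕ}

/-- Here and for the other simple loops, 1000000 is a generous value for the constant of
`Cmd.rep_eq`, confirmed by evaluating `Cmd.K` and `Expr.K`. -/
theorem sumLoop_spec (hB : Bdd W S) (hN : S.v .n = N) (h0 : S.v .sum = 0) (hi : S.v .i = 0)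
    (hs : ∑ t ∈ Finset.range N, S.m t < 2 ^ W) :
    sumLoop.eval tape S = (S.set .sum (∑ t ∈ Finset.range N, S.m t)).set .i N ∧
      sumLoop.cost tape S ≤ 1000000 * ((N + 1) * (W + 1)) := by
  have h := Cmd.rep_eq (tape := tape) (e := Var.n)
    (c := block [.assign .sum (Var.sum + .load Var.i), .assign .i (Var.i + 1)]) (S := S) (N := N)
    (W := W) (fun t => (S.set .sum (∑ t ∈ Finset.range t, S.m t)).set .i t) rfl hN
    (by ext y <;> simp only [St.set_v, St.set_m, St.set_coins]
        split_ifs with h1 h2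
        · rw [h1, hi]
        · rw [h2, h0]; rfl
        · rfl)
    (fun t ht => (hB.set _ ((Finset.sum_le_sum_of_subset
      (Finset.range_subset_range.2 ht)).trans_lt hs)).set _ (by
        have := hB.v .n; omega))
    (fun t ht => by
      simp only [eval_block_cons, eval_block_nil, eval_assign]
      ext y <;> simp [Finset.sum_range_succ, St.set_v]
      split_ifs <;> rfl)
  exact ⟨h.1, h.2.trans (Nat.mul_le_mul_right _ (by decide))⟩

theorem squareLoop_spec {L : ℕ} (hB : Bdd W S) (hN : S.v .n = N) (hx : S.v .x = 2)
    (hs : S.v .sum < 2 ^ L) (hL : 2 * L + 2 ≤ W) :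
    squareLoop.eval tape S = S.set .x (squares (S.v .sum) N) ∧
      squareLoop.cost tape S ≤ 1000000 * ((N + 1) * (W + 1)) := by
  have h := Cmd.rep_eq (tape := tape) (e := Var.n)
    (c := .ite (Var.sum + 1 - Var.x) (.assign .x (Var.x * Var.x)) .skip) (S := S) (N := N)
    (W := W) (fun t => S.set .x (squares (S.v .sum) t)) rfl hN
    (by ext y <;> simp only [St.set_v, St.set_m, St.set_coins]
        split_ifs with h1
        · rw [h1, hx]; rfl
        · rfl)
    (fun t ht => hB.set _ ((squares_lt hs t).trans_le (Nat.pow_le_pow_right two_pos hL)))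
    (fun t ht => by
      by_cases hc : squares (S.v .sum) t ≤ S.v .sum
      · rw [eval_ite_pos _ _ _ _ (by simp [St.set_v]; omega), squares, if_pos hc, eval_assign,
          St.set_set]
        simp
      · rw [eval_ite_neg _ _ _ _ (by simp [St.set_v]; omega), squares, if_neg hc, eval_skip])
  exact ⟨h.1, h.2.trans (Nat.mul_le_mul_right _ (by decide))⟩

theorem rangeLoop_spec (hB : Bdd W S) (hN : S.v .n = N) (hx : S.v .modM = 1)
    (hW : 16 * N < W) :
    rangeLoop.eval tape S = S.set .modM (2 ^ (16 * N)) ∧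
      rangeLoop.cost tape S ≤ 1000000 * ((N + 1) * (W + 1)) := by
  have h := Cmd.rep_eq (tape := tape) (e := Var.n)
    (c := .assign .modM (Var.modM * 65536)) (S := S) (N := N)
    (W := W) (fun t => S.set .modM (2 ^ (16 * t))) rfl hN
    (by ext y <;> simp only [St.set_v, St.set_m, St.set_coins]
        split_ifs with h1
        · rw [h1, hx]; rfl
        · rfl)
    (fun t ht => hB.set _ (Nat.pow_lt_pow_right one_lt_two (by omega)))
    (fun t ht => by
      rw [eval_assign, St.set_set, mul_add, pow_add]
      simp)
  exact ⟨h.1, h.2.trans (Nat.mul_le_mul_right _ (by decide))⟩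

theorem flipLoop_spec (hB : Bdd W S) (hN : S.v .n = N) (hx : S.v .x = 0) (hr : S.v .rnd = 0)
    (hc : S.coins = 0) (hW : 128 * N ≤ W) :
    flipLoop.eval tape S = ⟨(S.set .rnd (bitsVal tape (128 * N))).v, S.m, 128 * N⟩ ∧
      flipLoop.cost tape S ≤ 1000000 * ((128 * N + 1) * (W + 1)) := by
  have h := Cmd.rep_eq (tape := tape) (e := 128 * Var.n)
    (c := block [.flip .x, .assign .rnd (2 * Var.rnd + Var.x), .assign .x 0]) (S := S)
    (N := 128 * N) (W := W) (fun t => ⟨(S.set .rnd (bitsVal tape t)).v, S.m, t⟩) rfl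
    (by simp [hN])
    (by ext y <;> simp only [St.set_v, hc]
        split_ifs with h1
        · rw [h1, hr]; rfl
        · rfl)
    (fun t ht => ⟨(hB.set _ ((bitsVal_lt tape t).trans_le
      (Nat.pow_le_pow_right two_pos (ht.trans hW)))).v, hB.m⟩)
    (fun t ht => by
      simp only [eval_block_cons, eval_block_nil, Cmd.eval]
      ext y <;> simp [St.set_v, St.tick, bitsVal]
      split_ifs with h1 <;> simp_all)
  exact ⟨h.1, h.2.trans (Nat.mul_le_mul_right _ (by decide))⟩

theorem reduceLoop_spec {q : ℕ} (hB : Bdd W S) (hN : S.v .n = N) (hi : S.v .i = 0)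
    (hq : S.v .q = q) :
    reduceLoop.eval tape S =
        ⟨(S.set .i N).v, fun j => if j < N then S.m j % q else S.m j, S.coins⟩ ∧
      reduceLoop.cost tape S ≤ 1000000 * ((N + 1) * (W + 1)) := by
  have h := Cmd.rep_eq (tape := tape) (e := Var.n)
    (c := block [.store Var.i (.load Var.i % Var.q), .assign .i (Var.i + 1)]) (S := S)
    (N := N) (W := W)
    (fun t => ⟨(S.set .i t).v, fun j => if j < t then S.m j % q else S.m j, S.coins⟩) rfl hN
    (by ext y <;> simp only [St.set_v, Nat.not_lt_zero, if_false]
        split_ifs with h1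
        · rw [h1, hi]
        · rfl)
    (fun t ht => ⟨(hB.set _ (by have := hB.v .n; omega)).v, fun j => by
      dsimp only
      split_ifs
      · exact (Nat.mod_le _ _).trans_lt (hB.m j)
      · exact hB.m j⟩)
    (fun t ht => by
      simp only [eval_block_cons, eval_block_nil, eval_assign, eval_store]
      ext y
      · simp [St.set_v]
        split_ifs with h1 <;> simp_all
      · simp [St.set_v, St.write_m, hq]
        split_ifs with h1 <;> first | rfl | omega | simp_all
      · rfl)
  exact ⟨h.1, h.2.trans (Nat.mul_le_mul_right _ (by decide))⟩

end loops

/-- Prepare the random modulus and reduce the instance. -/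
def prepare : Cmd := block [sumLoop, .assign .x 2, squareLoop,
  block [.assign .big (1 - (Var.x - Var.sum)), .assign .x 0, .assign .modM 1], rangeLoop, flipLoop,
  block [.assign .q (Var.big * (2 * Var.sum + 1) + (1 - Var.big) * (1 + Var.rnd % Var.modM)),
    .assign .rnd (Var.rnd / Var.modM), .assign .i 0], reduceLoop,
  block [.assign .s (Var.s % Var.q), .assign .sum 0, .assign .i 0]]

/-- Whether `σ` is at least `2 ^ 2 ^ n`. -/
def bigFlag (n σ : ℕ) : ℕ := 1 - (squares σ n - σ)

theorem bigFlag_eq (n σ : ℕ) : bigFlag n σ = if 2 ^ 2 ^ n ≤ σ then 1 else 0 := by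
  have := squares_le_iff σ n
  unfold bigFlag
  split_ifs with h <;> omega

theorem bigFlag_le_one (n σ : ℕ) : bigFlag n σ ≤ 1 := Nat.sub_le _ _

/-- The modulus obtained from the random number `R`. -/
def modulus (n σ R : ℕ) : ℕ :=
  bigFlag n σ * (2 * σ + 1) + (1 - bigFlag n σ) * (1 + R % 2 ^ (16 * n))

theorem modulus_pos (n σ R : ℕ) : 0 < modulus n σ R := by
  have := bigFlag_le_one n σ
  unfold modulus
  interval_cases bigFlag n σ <;> omega

/-- The initial state. -/
def initSt (n s : ℕ) (m : ℕ → ℕ) : St :=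
  ⟨fun y => if y = .n then n else if y = .s then s else 0, m, 0⟩

/-- The state after the preparation. -/
def preparedSt (n s R : ℕ) (m : ℕ → ℕ) : St :=
  let σ := ∑ t ∈ Finset.range n, m t
  ⟨fun y => if y = .n then n else if y = .s then s % modulus n σ R else
    if y = .big then bigFlag n σ else if y = .modM then 2 ^ (16 * n) else
    if y = .q then modulus n σ R else if y = .rnd then R / 2 ^ (16 * n) else 0,
    fun j => if j < n then m j % modulus n σ R else m j, 128 * n⟩

theorem prepare_spec : ∃ K : ℕ, ∀ {n s L : ℕ} {m : ℕ → ℕ} {tape : ℕ → Bool},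
    n < L → (∀ j, m j < 2 ^ L) → s < 2 ^ L → ∑ t ∈ Finset.range n, m t < 2 ^ L →
      prepare.eval tape (initSt n s m) = preparedSt n s (bitsVal tape (128 * n)) m ∧
      prepare.cost tape (initSt n s m) ≤ K * (L * L) := by
  obtain ⟨B₁, hB₁⟩ : ∃ c : Cmd, c = .assign .x 2 := ⟨_, rfl⟩
  obtain ⟨B₂, hB₂⟩ : ∃ c : Cmd, c = block [.assign .big (1 - (Var.x - Var.sum)), .assign .x 0,
    .assign .modM 1] := ⟨_, rfl⟩
  obtain ⟨B₃, hB₃⟩ : ∃ c : Cmd, c = block [.assign .q (Var.big * (2 * Var.sum + 1) +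
    (1 - Var.big) * (1 + Var.rnd % Var.modM)), .assign .rnd (Var.rnd / Var.modM), .assign .i 0] :=
    ⟨_, rfl⟩
  obtain ⟨B₄, hB₄⟩ : ∃ c : Cmd, c = block [.assign .s (Var.s % Var.q), .assign .sum 0,
    .assign .i 0] := ⟨_, rfl⟩
  refine ⟨134 * (B₁.K + B₂.K + B₃.K + B₄.K + 133000000), ?_⟩
  intro n s L m tape hn hm hs hσ
  obtain ⟨σ, hσd⟩ : ∃ σ, σ = ∑ t ∈ Finset.range n, m t := ⟨_, rfl⟩
  obtain ⟨R, hR⟩ : ∃ R, R = bitsVal tape (128 * n) := ⟨_, rfl⟩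
  -- Room for the squares of numbers below `2 ^ L`, for the modulus `2 * σ + 1` and for the `128 *
  -- n` coins.
  obtain ⟨W, hW⟩ : ∃ W, W = 2 * L + 2 + 128 * n := ⟨_, rfl⟩
  have hLW : 2 ^ L < 2 ^ W := Nat.pow_lt_pow_right one_lt_two (by omega)
  have h2W : 2 < 2 ^ W := lt_of_lt_of_le (by norm_num)
    (Nat.pow_le_pow_right two_pos (show 2 ≤ W by omega))
  have hnL : n < 2 ^ L := hn.trans L.lt_two_pow_self
  have hRW : R < 2 ^ W := by
    rw [hR]
    exact (bitsVal_lt _ _).trans_le (Nat.pow_le_pow_right two_pos (by omega))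
  have hMW : 2 ^ (16 * n) < 2 ^ W := Nat.pow_lt_pow_right one_lt_two (by omega)
  have hbig := bigFlag_le_one n σ
  have hqW : modulus n σ R < 2 ^ W := by
    have h1 : R % 2 ^ (16 * n) < 2 ^ (16 * n) := Nat.mod_lt _ (by positivity)
    have h2 : 2 ^ L * 4 ≤ 2 ^ W := by
      rw [show 4 = 2 ^ 2 from rfl, ← pow_add]
      exact Nat.pow_le_pow_right two_pos (by omega)
    unfold modulus
    interval_cases bigFlag n σ <;> omega
  have b0 : Bdd W (initSt n s m) := ⟨fun y => by
    simp only [initSt]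
    split_ifs <;> omega, fun j => (hm j).trans hLW⟩
  -- the sum
  obtain ⟨e1, c1⟩ := sumLoop_spec (tape := tape) b0 (N := n) rfl rfl rfl
    (by simp only [initSt]; omega)
  obtain ⟨S₁, hS₁⟩ : ∃ T, T = sumLoop.eval tape (initSt n s m) := ⟨_, rfl⟩
  rw [← hS₁] at e1
  have b1 : Bdd W S₁ := by
    rw [e1]
    exact (b0.set _ (by simp only [initSt]; omega)).set _ (by omega)
  obtain ⟨S₂, hS₂⟩ : ∃ T, T = B₁.eval tape S₁ := ⟨_, rfl⟩
  have e2 : S₂ = S₁.set .x 2 := by rw [hS₂, hB₁]; rfl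
  have b2 : Bdd W S₂ := by rw [e2]; exact b1.set _ h2W
  obtain ⟨e3, c3⟩ := squareLoop_spec (tape := tape) (L := L) b2 (N := n) (by simp [e2, e1, initSt])
    (by simp [e2]) (by simpa [e2, e1, initSt] using hσ) (by omega)
  have hsum2 : S₂.v .sum = σ := by simp [e2, e1, initSt, hσd]
  rw [hsum2] at e3
  obtain ⟨S₃, hS₃⟩ : ∃ T, T = squareLoop.eval tape S₂ := ⟨_, rfl⟩
  rw [← hS₃] at e3
  have b3 : Bdd W S₃ := by
    rw [e3]
    refine b2.set _ ((squares_lt (hσd.trans_lt hσ) n).trans_le (Nat.pow_le_pow_right two_pos ?_))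
    omega
  obtain ⟨S₄, hS₄⟩ : ∃ T, T = B₂.eval tape S₃ := ⟨_, rfl⟩
  have e4 : S₄ = ((S₃.set .big (bigFlag n σ)).set .x 0).set .modM 1 := by
    rw [hS₄, hB₂]
    simp [e3, hsum2, bigFlag]
  have b4 : Bdd W S₄ := by
    rw [e4]
    exact ((b3.set _ (by omega)).set _ (by omega)).set _ (by omega)
  have n4 : S₄.v .n = n := by simp [e4, e3, e2, e1, initSt]
  obtain ⟨e5, c5⟩ := rangeLoop_spec (tape := tape) b4 n4 (by simp [e4]) (by omega)
  obtain ⟨S₅, hS₅⟩ : ∃ T, T = rangeLoop.eval tape S₄ := ⟨_, rfl⟩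
  rw [← hS₅] at e5
  have b5 : Bdd W S₅ := by rw [e5]; exact b4.set _ hMW
  obtain ⟨e6, c6⟩ := flipLoop_spec (tape := tape) (N := n) b5 (by simp [e5, n4])
    (by simp [e5, e4]) (by simp [e5, e4, e3, e2, e1, initSt])
    (by simp [e5, e4, e3, e2, e1, initSt]) (by omega)
  obtain ⟨S₆, hS₆⟩ : ∃ T, T = flipLoop.eval tape S₅ := ⟨_, rfl⟩
  rw [← hS₆, ← hR] at e6
  have b6 : Bdd W S₆ := by rw [e6]; exact ⟨(b5.set _ hRW).v, b5.m⟩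
  obtain ⟨S₇, hS₇⟩ : ∃ T, T = B₃.eval tape S₆ := ⟨_, rfl⟩
  have e7 : S₇ = ((S₆.set .q (modulus n σ R)).set .rnd (R / 2 ^ (16 * n))).set .i 0 := by
    rw [hS₇, hB₃]
    simp [e6, e5, e4, e3, hsum2, modulus]
  have b7 : Bdd W S₇ := by
    rw [e7]
    exact ((b6.set _ hqW).set _ ((Nat.div_le_self _ _).trans_lt hRW)).set _ (by omega)
  obtain ⟨e8, c8⟩ := reduceLoop_spec (tape := tape) (N := n) (q := modulus n σ R) b7
    (by simp [e7, e6, e5, n4]) (by simp [e7]) (by simp [e7])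
  obtain ⟨S₈, hS₈⟩ : ∃ T, T = reduceLoop.eval tape S₇ := ⟨_, rfl⟩
  rw [← hS₈] at e8
  have b8 : Bdd W S₈ := by
    rw [e8]
    refine ⟨(b7.set _ (by omega)).v, fun j => ?_⟩
    dsimp only
    split_ifs
    · exact (Nat.mod_le _ _).trans_lt (b7.m j)
    · exact b7.m j
  have hev : prepare.eval tape (initSt n s m) = B₄.eval tape S₈ := by
    rw [hS₈, hS₇, hS₆, hS₅, hS₄, hS₃, hS₂, hS₁, hB₁, hB₂, hB₃, hB₄]; rfl
  have hco : prepare.cost tape (initSt n s m) = sumLoop.cost tape (initSt n s m) +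
      (B₁.cost tape S₁ + (squareLoop.cost tape S₂ + (B₂.cost tape S₃ + (rangeLoop.cost tape S₄ +
      (flipLoop.cost tape S₅ + (B₃.cost tape S₆ + (reduceLoop.cost tape S₇ +
      (B₄.cost tape S₈ + 1)))))))) := by
    rw [hS₈, hS₇, hS₆, hS₅, hS₄, hS₃, hS₂, hS₁, hB₁, hB₂, hB₃, hB₄]; rfl
  constructor
  · rw [hev, ← hR, hB₄]
    simp only [eval_block_cons, eval_block_nil, eval_assign]
    ext y
    · rw [e8, e7, e6, e5, e4, e3, e2, e1]
      simp only [St.set_v, preparedSt, initSt, ← hσd, Expr.eval_mod, Expr.eval_var,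
        Expr.eval_ofNat]
      cases y <;> simp
    · simp only [e8, e7, e6, e5, e4, e3, e2, e1, St.set_m, preparedSt, initSt, ← hσd]
    · simp only [e8, e7, e6, e5, e4, e3, e2, e1, St.set_coins, preparedSt, initSt, ← hσd]
  · have d1 := Cmd.cost_le tape B₁ (by rw [hB₁]; rfl) b1
    have d2 := Cmd.cost_le tape B₂ (by rw [hB₂]; rfl) b3
    have d3 := Cmd.cost_le tape B₃ (by rw [hB₃]; rfl) b6
    have d4 := Cmd.cost_le tape B₄ (by rw [hB₄]; rfl) b8
    have h1 : W + 1 ≤ 134 * L := by omega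
    have h2 : W + 1 ≤ (n + 1) * (W + 1) := Nat.le_mul_of_pos_left _ (by omega)
    have h3 : (n + 1) * (W + 1) ≤ L * (134 * L) := Nat.mul_le_mul (by omega) h1
    have h4 : (128 * n + 1) * (W + 1) ≤ 128 * L * (134 * L) := Nat.mul_le_mul (by omega) h1
    obtain ⟨Z, hZ⟩ : ∃ Z, Z = L * (134 * L) := ⟨_, rfl⟩
    rw [mul_assoc, ← hZ] at h4
    rw [← hZ] at h3
    have hZ1 : 1 ≤ Z := by omega
    have f1 := Nat.mul_le_mul_left B₁.K (h2.trans h3)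
    have f2 := Nat.mul_le_mul_left B₂.K (h2.trans h3)
    have f3 := Nat.mul_le_mul_left B₃.K (h2.trans h3)
    have f4 := Nat.mul_le_mul_left B₄.K (h2.trans h3)
    have hfin : 134 * (B₁.K + B₂.K + B₃.K + B₄.K + 133000000) * (L * L) =
        B₁.K * Z + B₂.K * Z + B₃.K * Z + B₄.K * Z + 133000000 * Z := by rw [hZ]; ring
    rw [hfin, hco]
    omega

/-! ### Drawing the parameters of the search -/

/-- The draws other than the modulus. -/
def drawVars : Cmd := block [.assign .xp (Var.rnd % Var.modM), .assign .rnd (Var.rnd / Var.modM),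
  .assign .xk (Var.rnd % Var.modM), .assign .rnd (Var.rnd / Var.modM),
  .assign .md (Var.rnd % Var.modM % 2), .assign .rnd (Var.rnd / Var.modM),
  .assign .x (Var.big * Var.n + (1 - Var.big) * (143 * Var.n / 185 + 1)),
  .assign .g (Var.rnd % Var.modM % (Var.x + 1)), .assign .rnd (Var.rnd / Var.modM),
  .assign .e (Var.rnd % Var.modM % (Var.g + 1)), .assign .rnd (Var.rnd / Var.modM),
  .assign .j (Var.rnd % Var.modM), .assign .rnd (Var.rnd / Var.modM),
  .assign .c (Var.rnd % Var.modM % (Var.n + 1)), .assign .pe 1, .assign .pg 1]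

/-- The parameters of the search. -/
def setVars : Cmd := block [.assign .cap (2000 * Var.n * Var.n * Var.n * Var.pg),
  .assign .al Var.md, .assign .be (1 - Var.md),
  .assign .p (Var.md * (1 + Var.xp % Var.pe) + (1 - Var.md) * (Var.n + 1)),
  .assign .k2 (Var.xk % Var.p),
  .assign .k1 ((Var.md * (Var.k2 + Var.s + (Var.j % (2 * Var.n + 1) + Var.n * (Var.p - 1)) * Var.q)
    + (1 - Var.md) * Var.j) % Var.p),
  .assign .c (Var.md * Var.n + (1 - Var.md) * Var.c)]

/-- Choose the parameters of the search. -/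
def choose : Cmd := block [drawVars, .rep Var.e (.assign .pe (Var.pe * 2)),
  .rep Var.g (.assign .pg (Var.pg * 2)), setVars]

/-- The search with the given parameters. -/
def mkSearch (n q s : ℕ) (b : ℕ → ℕ) (md e xp xk j c : ℕ) : Search where
  n := n
  q := q
  s := s
  b := b
  md := md
  p := md * (1 + xp % 2 ^ e) + (1 - md) * (n + 1)
  k2 := xk % (md * (1 + xp % 2 ^ e) + (1 - md) * (n + 1))
  k1 := (md * (xk % (md * (1 + xp % 2 ^ e) + (1 - md) * (n + 1)) + s + (j % (2 * n + 1) +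
    n * (md * (1 + xp % 2 ^ e) + (1 - md) * (n + 1) - 1)) * q) + (1 - md) * j) %
      (md * (1 + xp % 2 ^ e) + (1 - md) * (n + 1))
  c := md * n + (1 - md) * c

/-- The largest possible value of the exponent `g`. -/
def gTop (n σ : ℕ) : ℕ := bigFlag n σ * n + (1 - bigFlag n σ) * (143 * n / 185 + 1)

theorem gTop_le (n σ : ℕ) : gTop n σ ≤ n + 1 := by
  have := bigFlag_le_one n σ
  unfold gTop
  interval_cases bigFlag n σ <;> omega

/-- The digits of the random number. -/
def draw (n R i : ℕ) : ℕ := R / (2 ^ (16 * n)) ^ i % 2 ^ (16 * n)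

/-- The exponent `g` that is drawn. -/
def drawG (n σ R : ℕ) : ℕ := draw n R 4 % (gTop n σ + 1)

/-- The search that is drawn. -/
def drawSearch (n σ s R : ℕ) (m : ℕ → ℕ) : Search :=
  mkSearch n (modulus n σ R) (s % modulus n σ R) (fun i => m i % modulus n σ R) (draw n R 3 % 2)
    (draw n R 5 % (drawG n σ R + 1)) (draw n R 1) (draw n R 2) (draw n R 6)
    (draw n R 7 % (n + 1))

theorem powLoop_spec {tape : ℕ → Bool} {S : St} {N W : ℕ} {x y : Var}
    (hB : Bdd W S) (hN : S.v x = N) (hy : S.v y = 1) (hW : N < W) :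
    (Cmd.rep x (.assign y (y * 2))).eval tape S = S.set y (2 ^ N) ∧
      (Cmd.rep x (.assign y (y * 2))).cost tape S ≤ 1000000 * ((N + 1) * (W + 1)) := by
  have h := Cmd.rep_eq (tape := tape) (e := x)
    (c := .assign y (y * 2)) (S := S) (N := N)
    (W := W) (fun t => S.set y (2 ^ t)) rfl hN
    (by ext z <;> simp only [St.set_v, St.set_m, St.set_coins]
        split_ifs with h1
        · rw [h1, hy]; rfl
        · rfl)
    (fun t ht => hB.set _ (Nat.pow_lt_pow_right one_lt_two (by omega)))
    (fun t ht => by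
      rw [eval_assign, St.set_set, pow_succ]
      simp)
  exact ⟨h.1, h.2.trans (Nat.mul_le_mul_right _ (by
    simp only [Cmd.K, Expr.K, HMul.hMul, Mul.mul]
    decide))⟩

/-- The memory beyond the items is still zero here; this is what makes the dictionary start empty.
-/
theorem choose_spec : ∃ K : ℕ, ∀ {n s R W : ℕ} {m : ℕ → ℕ} {tape : ℕ → Bool} {S : St},
    (∀ j, n ≤ j → m j = 0) → S = preparedSt n s R m → Bdd W S → n ≤ W →
      (drawSearch n (∑ t ∈ Finset.range n, m t) s R m).Vars (choose.eval tape S) ∧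
      (choose.eval tape S).v .cap =
        2000 * n * n * n * 2 ^ drawG n (∑ t ∈ Finset.range n, m t) R ∧
      Bdd (K * (W + 1)) (choose.eval tape S) ∧
      choose.cost tape S ≤ K * ((n + 1) * (W + 1)) := by
  obtain ⟨k₁, hk₁⟩ : ∃ k, k = drawVars.K := ⟨_, rfl⟩
  obtain ⟨k₂, hk₂⟩ : ∃ k, k = setVars.K := ⟨_, rfl⟩
  refine ⟨k₁ + 4000001 * (k₁ + 4) + k₂ * (k₁ + 4), ?_⟩
  intro n s R W m tape S hm hS hB hnW
  obtain ⟨σ, hσd⟩ : ∃ σ, σ = ∑ t ∈ Finset.range n, m t := ⟨_, rfl⟩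
  rw [← hσd]
  obtain ⟨b1, c1⟩ := Cmd.bdd_and_cost_le tape drawVars rfl hB
  rw [← hk₁] at b1 c1
  obtain ⟨S₁, hS₁⟩ : ∃ T, T = drawVars.eval tape S := ⟨_, rfl⟩
  rw [← hS₁] at b1
  obtain ⟨g, hg⟩ : ∃ g, g = drawG n σ R := ⟨_, rfl⟩
  obtain ⟨e, he⟩ : ∃ e, e = draw n R 5 % (g + 1) := ⟨_, rfl⟩
  have hgt := gTop_le n σ
  have hgn : g ≤ n + 1 := by
    have : g < gTop n σ + 1 := by rw [hg]; exact Nat.mod_lt _ (Nat.succ_pos _)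
    omega
  have heg : e ≤ g := by
    have : e < g + 1 := by rw [he]; exact Nat.mod_lt _ (Nat.succ_pos _)
    omega
  have hval : S₁.v .xp = draw n R 1 ∧ S₁.v .xk = draw n R 2 ∧ S₁.v .md = draw n R 3 % 2 ∧
      S₁.v .g = g ∧ S₁.v .e = e ∧ S₁.v .j = draw n R 6 ∧ S₁.v .c = draw n R 7 % (n + 1) ∧
      S₁.v .pe = 1 ∧ S₁.v .pg = 1 ∧ S₁.v .n = n ∧ S₁.v .s = s % modulus n σ R ∧
      S₁.v .q = modulus n σ R ∧ S₁.m = S.m := by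
    rw [hS₁, hS, he, hg, hσd]
    simp [drawVars, draw, drawG, gTop, preparedSt, Nat.div_div_eq_div_mul, pow_succ, mul_assoc]
  obtain ⟨xp1, xk1, md1, g1, e1, j1, c1', pe1, pg1, n1, s1, q1, m1⟩ := hval
  -- Beyond the words left by the draws there must be room for the powers `2 ^ e` and `2 ^ g`, where
  -- `e ≤ g ≤ n + 1`.
  obtain ⟨W', hW'⟩ : ∃ W', W' = (k₁ + 3) * (W + 1) := ⟨_, rfl⟩
  have hW'' : W' + 1 ≤ (k₁ + 4) * (W + 1) := by rw [hW']; linarith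
  have hW3 : k₁ * (W + 1) + n + 2 ≤ W' := by rw [hW']; linarith
  have b1' : Bdd W' S₁ := b1.mono (by omega)
  obtain ⟨e2, c2⟩ := powLoop_spec (tape := tape) (x := .e) (y := .pe) b1' e1 pe1
    (by omega)
  obtain ⟨S₂, hS₂⟩ : ∃ T, T = (Cmd.rep Var.e (.assign .pe (Var.pe * 2))).eval tape S₁ := ⟨_, rfl⟩
  rw [← hS₂] at e2
  have b2 : Bdd W' S₂ := by
    rw [e2]
    exact b1'.set _ (Nat.pow_lt_pow_right one_lt_two (by omega))
  obtain ⟨e3, c3⟩ := powLoop_spec (tape := tape) (x := .g) (y := .pg) (N := g) b2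
    (by simp [e2, g1]) (by simp [e2, pg1]) (by omega)
  obtain ⟨S₃, hS₃⟩ : ∃ T, T = (Cmd.rep Var.g (.assign .pg (Var.pg * 2))).eval tape S₂ := ⟨_, rfl⟩
  rw [← hS₃] at e3
  have b3 : Bdd W' S₃ := by
    rw [e3]
    exact b2.set _ (Nat.pow_lt_pow_right one_lt_two (by omega))
  obtain ⟨b4, c4⟩ := Cmd.bdd_and_cost_le tape setVars rfl b3
  rw [← hk₂] at b4 c4
  have hev : choose.eval tape S = setVars.eval tape S₃ := by rw [hS₃, hS₂, hS₁]; rfl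
  have hco : choose.cost tape S = drawVars.cost tape S +
      ((Cmd.rep Var.e (.assign .pe (Var.pe * 2))).cost tape S₁ +
      ((Cmd.rep Var.g (.assign .pg (Var.pg * 2))).cost tape S₂ +
      (setVars.cost tape S₃ + 1))) := by
    rw [hS₃, hS₂, hS₁]; rfl
  have h5 := Nat.mul_le_mul_left k₂ hW''
  rw [hev]
  refine ⟨?_, ?_, b4.mono ?_, ?_⟩
  · constructor <;> simp only [setVars, eval_block_cons, eval_block_nil, eval_assign, St.set_v,
      St.set_m, e3, e2, drawSearch, mkSearch, ← hg, ← he] <;>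
      (try simp [xp1, xk1, md1, j1, c1', n1, s1, q1])
    · intro i hi
      rw [m1, hS, hσd]
      simp [preparedSt, hi]
    · intro κ
      rw [m1, hS]
      have : ¬ dict n κ < n := by unfold dict; omega
      simp only [preparedSt, this, if_false]
      exact hm _ (by omega)
  · simp [setVars, e3, e2, n1, ← hg]
  · refine h5.trans ?_
    rw [← mul_assoc]
    exact Nat.mul_le_mul_right _ (Nat.le_add_left _ _)
  · have h1 : W + 1 ≤ (n + 1) * (W + 1) := Nat.le_mul_of_pos_left _ (by omega)
    obtain ⟨Z, hZ⟩ : ∃ Z, Z = (n + 1) * (W + 1) := ⟨_, rfl⟩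
    have h2 : ∀ t ≤ n + 1, (t + 1) * (W' + 1) ≤ 2 * ((k₁ + 4) * Z) := fun t ht => by
      calc (t + 1) * (W' + 1) ≤ (2 * (n + 1)) * ((k₁ + 4) * (W + 1)) :=
            Nat.mul_le_mul (by omega) hW''
        _ = _ := by rw [hZ]; ring
    have h3 := h2 e (by omega)
    have h4 := h2 g hgn
    rw [← hZ] at h1 ⊢
    have h6 := Nat.mul_le_mul_left k₁ h1
    have h7 : k₂ * ((k₁ + 4) * (W + 1)) ≤ k₂ * ((k₁ + 4) * Z) :=
      Nat.mul_le_mul_left _ (Nat.mul_le_mul_left _ h1)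
    have h8 : 1 ≤ (k₁ + 4) * Z := Nat.mul_pos (by omega) (by omega)
    have hfin : (k₁ + 4000001 * (k₁ + 4) + k₂ * (k₁ + 4)) * Z =
        k₁ * Z + 4000001 * ((k₁ + 4) * Z) + k₂ * ((k₁ + 4) * Z) := by ring
    rw [hfin, hco]
    omega

/-! ### The whole algorithm and its running time -/

/-- The whole algorithm. -/
def main : Cmd := block [prepare, choose, core]

/-- The purpose of the reduction: from here on the words have `128 * n` bits, and the input length
enters only if the sum is huge. -/
theorem preparedSt_bdd {n s R L : ℕ} {m : ℕ → ℕ} (hn : 0 < n) (hm : ∀ j, n ≤ j → m j = 0)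
    (hR : R < 2 ^ (128 * n)) (hσ : ∑ t ∈ Finset.range n, m t < 2 ^ L) :
    Bdd (128 * n + bigFlag n (∑ t ∈ Finset.range n, m t) * (L + 2)) (preparedSt n s R m) ∧
      modulus n (∑ t ∈ Finset.range n, m t) R <
        2 ^ (128 * n + bigFlag n (∑ t ∈ Finset.range n, m t) * (L + 2)) := by
  obtain ⟨σ, hσd⟩ : ∃ σ, σ = ∑ t ∈ Finset.range n, m t := ⟨_, rfl⟩
  rw [← hσd] at hσ ⊢
  obtain ⟨W, hW⟩ : ∃ W, W = 128 * n + bigFlag n σ * (L + 2) := ⟨_, rfl⟩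
  rw [← hW]
  have hnW : 128 * n ≤ W := by omega
  have hRW : R < 2 ^ W := hR.trans_le (Nat.pow_le_pow_right two_pos hnW)
  have hMW : 2 ^ (16 * n) < 2 ^ W := Nat.pow_lt_pow_right one_lt_two (by omega)
  have hbig := bigFlag_le_one n σ
  have hnn : n < 2 ^ W := lt_of_lt_of_le n.lt_two_pow_self
    (Nat.pow_le_pow_right two_pos (by omega))
  have h1W : 1 < 2 ^ W := Nat.one_lt_two_pow (by omega)
  have hq : modulus n σ R < 2 ^ W := by
    have h1 : R % 2 ^ (16 * n) < 2 ^ (16 * n) := Nat.mod_lt _ (by positivity)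
    have h2 : 2 * σ + 1 < 2 ^ (L + 2) := by rw [pow_add]; omega
    have h3 := bigFlag_eq n σ
    unfold modulus
    split_ifs at h3 with h4
    · have : 2 ^ (L + 2) ≤ 2 ^ W := Nat.pow_le_pow_right two_pos (by rw [hW, h3]; omega)
      rw [h3]
      omega
    · rw [h3]
      omega
  have hqp := modulus_pos n σ R
  refine ⟨⟨fun y => ?_, fun j => ?_⟩, hq⟩
  · simp only [preparedSt, ← hσd]
    have h1 : s % modulus n σ R < modulus n σ R := Nat.mod_lt _ hqp
    have h2 : R / 2 ^ (16 * n) ≤ R := Nat.div_le_self _ _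
    split_ifs <;> omega
  · simp only [preparedSt, ← hσd]
    split_ifs with h
    · exact (Nat.mod_lt _ hqp).trans hq
    · rw [hm _ (by omega)]
      omega

theorem mkSearch_p {n q s : ℕ} {b : ℕ → ℕ} {md e xp xk j c : ℕ} (hmd : md ≤ 1) :
    0 < (mkSearch n q s b md e xp xk j c).p ∧
      (mkSearch n q s b md e xp xk j c).p ≤ 2 ^ e + (n + 1) := by
  have h : xp % 2 ^ e < 2 ^ e := Nat.mod_lt _ (by positivity)
  simp only [mkSearch]
  interval_cases md <;> omega

/-- For `fl = 0` the core handles about `n ^ 3 * 2 ^ G` nodes, at most `n + 1` digits for each and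
words of length `O(n)`, which gives `n ^ 5 * 2 ^ G`. For `fl = 1` the inequalities `n < L` and `2 ^
G ≤ L` turn the same product into a multiple of `L ^ 6`. -/
theorem total_cost_le {n L fl G W W' K₁ K₂ K₃ p c₁ c₂ c₃ : ℕ} (hn : 0 < n) (hnL : n < L)
    (hfl : fl ≤ 1) (hbig : fl = 1 → 2 ^ n < L ∧ G ≤ n) (hW : W + 1 ≤ 129 * (n + fl * L))
    (hW' : W' ≤ 2 * (K₂ * (W + 1)) + W + 4 * n + 8) (hp : p ≤ 2 ^ G + (n + 1))
    (h₁ : c₁ ≤ K₁ * (L * L)) (h₂ : c₂ ≤ K₂ * ((n + 1) * (W + 1)))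
    (h₃ : c₃ ≤ K₃ * ((2000 * n * n * n * 2 ^ G + (n + 1) * p + 1) * (n + 1) * (W' + 1))) :
    c₁ + (c₂ + (c₃ + 1)) ≤ (K₁ + K₂ * 600 + K₃ * (2010 * 2 * (600 * K₂ + 150)) * 2 + 1) *
      (L ^ 6 + (1 - fl) * (n ^ 5 * 2 ^ G)) := by
  obtain ⟨X, hX⟩ : ∃ X, X = n ^ 4 * 2 ^ G * (n + fl * L) := ⟨_, rfl⟩
  obtain ⟨Y, hY⟩ : ∃ Y, Y = L ^ 6 + (1 - fl) * (n ^ 5 * 2 ^ G) := ⟨_, rfl⟩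
  have h2G : 1 ≤ 2 ^ G := Nat.one_le_two_pow
  have hXY : X ≤ 2 * Y := by
    rcases Nat.le_one_iff_eq_zero_or_eq_one.1 hfl with h | h
    · rw [hX, hY, h]
      have : n ^ 4 * 2 ^ G * (n + 0 * L) = n ^ 5 * 2 ^ G := by ring
      omega
    · obtain ⟨h1, h2⟩ := hbig h
      have h5 : 2 ^ G ≤ L := (Nat.pow_le_pow_right two_pos h2).trans h1.le
      rw [hX, hY, h]
      have h3 : n ^ 4 * 2 ^ G * (n + 1 * L) ≤ L ^ 4 * L * (2 * L) :=
        Nat.mul_le_mul (Nat.mul_le_mul (Nat.pow_le_pow_left hnL.le _) h5) (by omega)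
      have h4 : L ^ 4 * L * (2 * L) = 2 * L ^ 6 := by ring
      omega
  have hLY : L * L ≤ Y := by
    have : L ^ 2 ≤ L ^ 6 := Nat.pow_le_pow_right (by omega) (by norm_num)
    rw [pow_two] at this
    omega
  have hY1 : 1 ≤ Y := le_trans (Nat.mul_pos (by omega) (by omega)) hLY
  have hd : 2000 * n * n * n * 2 ^ G + (n + 1) * p + 1 ≤ 2010 * (n ^ 3 * 2 ^ G) := by
    have h0 : n + 1 ≤ 2 * n * 2 ^ G :=
      (show n + 1 ≤ 2 * n * 1 by omega).trans (Nat.mul_le_mul_left _ h2G)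
    have h1 : (n + 1) * p ≤ (2 * n) * (2 * n * 2 ^ G + 2 ^ G) :=
      Nat.mul_le_mul (by omega) (hp.trans (by omega))
    have h4 : 1 ≤ n * 2 ^ G := Nat.mul_pos hn (by positivity)
    have h5 : n * 2 ^ G ≤ n ^ 3 * 2 ^ G :=
      Nat.mul_le_mul_right _ (Nat.le_self_pow (by norm_num) _)
    have h6 : n ^ 2 * 2 ^ G ≤ n ^ 3 * 2 ^ G :=
      Nat.mul_le_mul_right _ (Nat.pow_le_pow_right hn (by norm_num))
    have h7 : (2 * n) * (2 * n * 2 ^ G + 2 ^ G) = 4 * (n ^ 2 * 2 ^ G) + 2 * (n * 2 ^ G) := by ring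
    have h8 : 2000 * n * n * n * 2 ^ G = 2000 * (n ^ 3 * 2 ^ G) := by ring
    omega
  have hW'le : W' + 1 ≤ (600 * K₂ + 150) * (n + fl * L) := by
    have h1 := Nat.mul_le_mul_left K₂ hW
    have h2 : K₂ * (129 * (n + fl * L)) = 129 * (K₂ * (n + fl * L)) := by ring
    have h3 : (600 * K₂ + 150) * (n + fl * L) = 600 * (K₂ * (n + fl * L)) +
        150 * (n + fl * L) := by ring
    omega
  have d3 : c₃ ≤ K₃ * (2010 * 2 * (600 * K₂ + 150)) * X := by
    have h1 := Nat.mul_le_mul (Nat.mul_le_mul hd (show n + 1 ≤ 2 * n by omega)) hW'le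
    refine (h₃.trans (Nat.mul_le_mul_left _ h1)).trans (le_of_eq ?_)
    rw [hX]
    ring
  have d2 : c₂ ≤ K₂ * 300 * X := by
    have h1 : n + 1 ≤ 2 * (n ^ 4 * 2 ^ G) := by
      have h2 : n ≤ n ^ 4 := Nat.le_self_pow (by norm_num) _
      have h3 : n ^ 4 * 1 ≤ n ^ 4 * 2 ^ G := Nat.mul_le_mul_left _ h2G
      omega
    have h2 : (n + 1) * (W + 1) ≤ 300 * X := by
      refine (Nat.mul_le_mul h1 hW).trans ?_
      have : 2 * (n ^ 4 * 2 ^ G) * (129 * (n + fl * L)) = 258 * X := by rw [hX]; ring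
      omega
    rw [mul_assoc]
    exact h₂.trans (Nat.mul_le_mul_left _ h2)
  have f1 := h₁.trans (Nat.mul_le_mul_left K₁ hLY)
  have f2 := d2.trans (Nat.mul_le_mul_left _ hXY)
  have f3 := d3.trans (Nat.mul_le_mul_left _ hXY)
  rw [← hY]
  refine (Nat.add_le_add f1 (Nat.add_le_add f2 (Nat.add_le_add f3 hY1))).trans (le_of_eq ?_)
  ring

theorem main_spec : ∃ K : ℕ, ∀ {n s L R σ : ℕ} {m : ℕ → ℕ} {tape : ℕ → Bool}, 0 < n →
    (∀ j, n ≤ j → m j = 0) → n < L → (∀ j, m j < 2 ^ L) → s < 2 ^ L → σ < 2 ^ L →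
    σ = ∑ t ∈ Finset.range n, m t → R = bitsVal tape (128 * n) →
    main.cost tape (initSt n s m) ≤
        K * (L ^ 6 + (1 - bigFlag n σ) * (n ^ 5 * 2 ^ drawG n σ R)) ∧
      ((drawSearch n σ s R m).P₁.treeSize n 0 ≤ 2000 * n * n * n * 2 ^ drawG n σ R →
        (drawSearch n σ s R m).P₂.treeSize n 0 ≤ 2000 * n * n * n * 2 ^ drawG n σ R →
        (drawSearch n σ s R m).Good →
        ∃ f g, Hit (drawSearch n σ s R m).P₁ (drawSearch n σ s R m).P₂ (s % modulus n σ R) f g ∧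
          Decoded n f g (main.eval tape (initSt n s m)).m ∧ Differ n f g) := by
  obtain ⟨K₁, hK₁⟩ := prepare_spec
  obtain ⟨K₂, hK₂⟩ := choose_spec
  obtain ⟨K₃, hK₃⟩ := core_spec
  refine ⟨K₁ + K₂ * 600 + K₃ * (2010 * 2 * (600 * K₂ + 150)) * 2 + 1, ?_⟩
  intro n s L R σ m tape hn hm hnL hmL hsL hσL hσd hRd
  have hσL' := hσL
  rw [hσd] at hσL'
  obtain ⟨e1, c1⟩ := hK₁ (tape := tape) hnL hmL hsL hσL'
  rw [← hRd] at e1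
  obtain ⟨b1, hq⟩ := preparedSt_bdd (s := s) hn hm (hRd ▸ bitsVal_lt tape (128 * n)) hσL'
  rw [← hσd] at b1 hq
  obtain ⟨fl, hfl⟩ : ∃ fl, fl = bigFlag n σ := ⟨_, rfl⟩
  have hfl1 := bigFlag_le_one n σ
  have hfleq := bigFlag_eq n σ
  obtain ⟨W, hW⟩ : ∃ W, W = 128 * n + fl * (L + 2) := ⟨_, rfl⟩
  rw [← hfl, ← hW] at b1 hq
  rw [← hfl] at hfleq hfl1 ⊢
  have hflL : fl * (L + 2) ≤ 3 * (fl * L) := by interval_cases fl <;> omega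
  have hWle : W + 1 ≤ 129 * (n + fl * L) := by omega
  obtain ⟨V, hcap, b2, c2⟩ := hK₂ (tape := tape) hm rfl b1 (by omega)
  rw [← hσd] at V hcap
  obtain ⟨S₁, hS₁⟩ : ∃ T, T = choose.eval tape (preparedSt n s R m) := ⟨_, rfl⟩
  rw [← hS₁] at V hcap b2
  -- The choice of parameters leaves words of `K₂ * (W + 1)` bits. The remaining bits pay for the
  -- factor `n + 1` of the table, for the codes below `3 ^ n` and for `3 * cap + 8`.
  obtain ⟨W', hW'⟩ : ∃ W', W' = 2 * (K₂ * (W + 1)) + W + 4 * n + 8 := ⟨_, rfl⟩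
  obtain ⟨A, hA⟩ : ∃ A, A = drawSearch n σ s R m := ⟨_, rfl⟩
  obtain ⟨G, hG⟩ : ∃ G, G = drawG n σ R := ⟨_, rfl⟩
  rw [← hA] at V
  rw [← hG] at hcap
  rw [← hA, ← hG]
  have hAn : A.n = n := by rw [hA]; rfl
  have hAq : A.q = modulus n σ R := by rw [hA]; rfl
  have hp : 0 < A.p ∧ A.p ≤ 2 ^ (draw n R 5 % (G + 1)) + (n + 1) := by
    rw [hA, hG]
    exact mkSearch_p (by omega)
  have heG : 2 ^ (draw n R 5 % (G + 1)) ≤ 2 ^ G := by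
    have : draw n R 5 % (G + 1) < G + 1 := Nat.mod_lt _ (by omega)
    exact Nat.pow_le_pow_right two_pos (by omega)
  have hpow : ∀ {x y : ℕ}, x ≤ y → 2 ^ x ≤ 2 ^ y := fun h => Nat.pow_le_pow_right two_pos h
  have hn2 : n < 2 ^ n := n.lt_two_pow_self
  have hfits : A.Fits W' := by
    refine ⟨hp.1, by rw [hAq]; exact modulus_pos _ _ _, ?_, ?_, ?_, ?_, ?_⟩
    · have h1 : A.p < 2 ^ (K₂ * (W + 1)) := by rw [← V.p]; exact b2.v _
      calc (A.n + 1) * A.p ≤ 2 ^ n * A.p := Nat.mul_le_mul_right _ (by omega)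
        _ < 2 ^ n * 2 ^ (K₂ * (W + 1)) := Nat.mul_lt_mul_of_pos_left h1 (by positivity)
        _ ≤ 2 ^ W' := by rw [← pow_add]; exact hpow (by omega)
    · rw [hAq]
      exact hq.trans_le (hpow (by omega))
    · rw [hAn]
      calc 3 ^ n < 4 ^ n := Nat.pow_lt_pow_left (by norm_num) (by omega)
        _ = 2 ^ (2 * n) := by rw [pow_mul]; rfl
        _ ≤ 2 ^ W' := hpow (by omega)
    · rw [hAn]
      calc 4 * n + 4 < 2 ^ n * 2 ^ 3 := by omega
        _ ≤ 2 ^ W' := by rw [← pow_add]; exact hpow (by omega)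
    · rw [← V.c]
      exact (b2.v _).trans_le (hpow (by omega))
  have hcW : 3 * (2000 * n * n * n * 2 ^ G) + 8 < 2 ^ W' := by
    rw [← hcap]
    have h1 := b2.v .cap
    have h2 : 2 ^ (K₂ * (W + 1)) * 2 ^ 5 ≤ 2 ^ W' := by rw [← pow_add]; exact hpow (by omega)
    have h3 : 1 ≤ 2 ^ (K₂ * (W + 1)) := Nat.one_le_two_pow
    omega
  obtain ⟨c3, good⟩ := hK₃ (tape := tape) hfits V hcap hcW (b2.mono (by omega))
  have hev : main.eval tape (initSt n s m) = core.eval tape S₁ := by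
    rw [hS₁, ← e1]; rfl
  have hco : main.cost tape (initSt n s m) = prepare.cost tape (initSt n s m) +
      (choose.cost tape (preparedSt n s R m) + (core.cost tape S₁ + 1)) := by
    rw [hS₁, ← e1]; rfl
  constructor
  · rw [hco]
    -- A set flag means `2 ^ 2 ^ n ≤ σ < 2 ^ L`.
    have hbig : fl = 1 → 2 ^ n < L ∧ G ≤ n := fun h => by
      rw [h] at hfleq
      split_ifs at hfleq with hb
      · have h1 : G < gTop n σ + 1 := by rw [hG]; exact Nat.mod_lt _ (Nat.succ_pos _)
        have h3 : gTop n σ = n := by unfold gTop; rw [← hfl, h]; omega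
        exact ⟨(Nat.pow_lt_pow_iff_right one_lt_two).1 (hb.trans_lt hσL), by omega⟩
    rw [hAn] at c3
    have := total_cost_le hn hnL hfl1 hbig hWle (W' := W') (K₂ := K₂) (by omega)
      (hp.2.trans (Nat.add_le_add_right heG _)) c1 c2 c3
    omega
  · have hs : A.s = s % modulus n σ R := by rw [hA]; rfl
    rw [← hs, hev]
    rw [hAn] at good
    exact good

/-! ### Fractions of uniformly drawn numbers, and coins -/

open Classical in
/-- At least the fraction `δ` of the numbers below `N` satisfies `Φ`. -/
def Frac (N : ℕ) (δ : ℝ) (Φ : ℕ → Prop) : Prop :=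
  δ * N ≤ ((Finset.range N).filter Φ).card

theorem Frac.mono {N : ℕ} {δ δ' : ℝ} {Φ Ψ : ℕ → Prop} (h : Frac N δ Φ) (hδ : δ' ≤ δ)
    (hΦ : ∀ x < N, Φ x → Ψ x) : Frac N δ' Ψ := by
  unfold Frac at *
  refine (mul_le_mul_of_nonneg_right hδ (Nat.cast_nonneg _)).trans (h.trans ?_)
  gcongr with x hx
  exact hΦ x (Finset.mem_range.1 hx)

theorem frac_iff {N : ℕ} {δ : ℝ} {Φ : ℕ → Prop} [DecidablePred Φ] :
    Frac N δ Φ ↔ δ * N ≤ ((Finset.range N).filter Φ).card := by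
  unfold Frac
  convert Iff.rfl

theorem Frac.of_card {N : ℕ} {δ : ℝ} {Φ : ℕ → Prop} (A : Finset ℕ)
    (hA : ∀ x ∈ A, x < N ∧ Φ x) (h : δ * N ≤ A.card) : Frac N δ Φ := by
  refine h.trans ?_
  gcongr
  intro x hx
  simpa using hA x hx

/-- The numbers below `M` contain `M / m` complete blocks of residues. Only the incomplete block at
the end is lost; since `m ≤ M`, it makes up less than half, whence `δ / 2`. -/
theorem Frac.of_mod {M m : ℕ} {δ : ℝ} {Φ : ℕ → Prop} (hm : 0 < m) (hM : m ≤ M) (hδ : 0 ≤ δ)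
    (h : Frac m δ Φ) : Frac M (δ / 2) fun x => Φ (x % m) := by
  classical
  refine Frac.of_card (((Finset.range (M / m)) ×ˢ ((Finset.range m).filter Φ)).image
    fun y => y.2 + m * y.1) ?_ ?_
  · intro x hx
    simp only [Finset.mem_image, Finset.mem_product, Finset.mem_range, Finset.mem_filter] at hx
    obtain ⟨⟨i, j⟩, ⟨hi, hj, hj'⟩, rfl⟩ := hx
    dsimp only at *
    have h1 : m * (i + 1) ≤ M := (Nat.mul_le_mul_left m hi).trans (Nat.mul_div_le M m)
    refine ⟨by rw [mul_add] at h1; omega, ?_⟩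
    rwa [Nat.add_mul_mod_self_left, Nat.mod_eq_of_lt hj]
  · rw [Finset.card_image_of_injOn, Finset.card_product, Finset.card_range]
    · have h1 : M ≤ 2 * (m * (M / m)) := by
        have h2 := Nat.div_add_mod M m
        have h3 := Nat.mod_lt M hm
        have h4 : 1 ≤ M / m := (Nat.one_le_div_iff hm).2 hM
        have h5 : m * 1 ≤ m * (M / m) := Nat.mul_le_mul_left _ h4
        omega
      have h1' : (M : ℝ) ≤ 2 * (m * (M / m : ℕ)) := by exact_mod_cast h1
      push_cast
      calc δ / 2 * M ≤ δ / 2 * (2 * (m * (M / m : ℕ))) := by gcongr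
        _ = (M / m : ℕ) * (δ * m) := by ring
        _ ≤ _ := by
          refine mul_le_mul_of_nonneg_left ?_ (Nat.cast_nonneg _)
          exact frac_iff.1 h
    · rintro ⟨i, j⟩ hx ⟨i', j'⟩ hy hxy
      simp only [Finset.coe_product, Set.mem_prod, Finset.coe_filter, Finset.mem_range,
        Set.mem_ofPred_eq] at hx hy hxy
      have h1 := congrArg (· % m) hxy
      simp only [Nat.add_mul_mod_self_left, Nat.mod_eq_of_lt hx.2.1, Nat.mod_eq_of_lt hy.2.1] at h1
      subst h1
      have h2 : i = i' := Nat.eq_of_mul_eq_mul_left hm (by omega)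
      rw [h2]

/-- The low digit `R % M` and the high part `R / M` of a uniform `R` are independent. The condition
on the second draw may depend on the first. -/
theorem Frac.mul {M N : ℕ} {α δ : ℝ} {Φ : ℕ → ℕ → Prop} (hδ : 0 ≤ δ)
    (h : Frac M α fun x => Frac N δ (Φ x)) : Frac (M * N) (α * δ) fun R => Φ (R % M) (R / M) := by
  classical
  refine Frac.of_card ((((Finset.range M).filter fun x => Frac N δ (Φ x)).sigma
    fun x => (Finset.range N).filter (Φ x)).image fun y => y.1 + M * y.2) ?_ ?_
  · intro R hR
    simp only [Finset.mem_image, Finset.mem_sigma, Finset.mem_range, Finset.mem_filter] at hR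
    obtain ⟨⟨x, y⟩, ⟨⟨hx, -⟩, hy, hxy⟩, rfl⟩ := hR
    dsimp only at *
    have h1 : M * (y + 1) ≤ M * N := Nat.mul_le_mul_left M hy
    refine ⟨by rw [mul_add] at h1; omega, ?_⟩
    rwa [Nat.add_mul_mod_self_left, Nat.mod_eq_of_lt hx,
      Nat.add_mul_div_left _ _ (by omega), Nat.div_eq_of_lt hx, zero_add]
  · rw [Finset.card_image_of_injOn, Finset.card_sigma]
    · push_cast
      calc α * δ * (M * N) = (α * M) * (δ * N) := by ring
        _ ≤ (((Finset.range M).filter fun x => Frac N δ (Φ x)).card : ℝ) * (δ * N) := by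
          refine mul_le_mul_of_nonneg_right ?_ (by positivity)
          exact frac_iff.1 h
        _ = ∑ x ∈ (Finset.range M).filter fun x => Frac N δ (Φ x), δ * N := by
          rw [Finset.sum_const, nsmul_eq_mul]
        _ ≤ _ := by
          refine Finset.sum_le_sum fun x hx => ?_
          exact frac_iff.1 (Finset.mem_filter.1 hx).2
    · rintro ⟨i, j⟩ hx ⟨i', j'⟩ hy hxy
      simp only [Finset.coe_sigma, Set.mem_sigma_iff, Finset.coe_filter, Finset.mem_range,
        Set.mem_ofPred_eq] at hx hy hxy
      have h1 := congrArg (· % M) hxy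
      simp only [Nat.add_mul_mod_self_left, Nat.mod_eq_of_lt hx.1.1, Nat.mod_eq_of_lt hy.1.1] at h1
      subst h1
      have h2 : j = j' := Nat.eq_of_mul_eq_mul_left (show 0 < M by omega) (by omega)
      rw [h2]

theorem Frac.single {N x : ℕ} (hx : x < N) {Φ : ℕ → Prop} (h : Φ x) : Frac N (1 / N) Φ := by
  refine Frac.of_card {x} (by simpa using ⟨hx, h⟩) ?_
  have : (N : ℝ) ≠ 0 := by
    have : N ≠ 0 := by omega
    exact_mod_cast this
  simp [this]

theorem Frac.of_forall {N : ℕ} {Φ : ℕ → Prop} (h : ∀ x < N, Φ x) : Frac N 1 Φ :=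
  Frac.of_card (Finset.range N) (fun x hx => ⟨by simpa using hx, h x (by simpa using hx)⟩) (by simp)

/-- Independent draws. -/
theorem Frac.draws {M : ℕ} {Φ : ℕ → ℕ → ℕ → ℕ → ℕ → ℕ → ℕ → ℕ → Prop}
    {α₀ α₁ α₂ α₃ α₄ α₅ α₆ α₇ : ℝ} (h₁ : 0 ≤ α₁) (h₂ : 0 ≤ α₂) (h₃ : 0 ≤ α₃) (h₄ : 0 ≤ α₄)
    (h₅ : 0 ≤ α₅) (h₆ : 0 ≤ α₆) (h₇ : 0 ≤ α₇)
    (h : Frac M α₀ fun x₀ => Frac M α₁ fun x₁ => Frac M α₂ fun x₂ => Frac M α₃ fun x₃ =>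
      Frac M α₄ fun x₄ => Frac M α₅ fun x₅ => Frac M α₆ fun x₆ => Frac M α₇ fun x₇ =>
      Φ x₀ x₁ x₂ x₃ x₄ x₅ x₆ x₇) :
    Frac (M ^ 8) (α₀ * (α₁ * (α₂ * (α₃ * (α₄ * (α₅ * (α₆ * α₇))))))) fun R =>
      Φ (R / M ^ 0 % M) (R / M ^ 1 % M) (R / M ^ 2 % M) (R / M ^ 3 % M) (R / M ^ 4 % M)
        (R / M ^ 5 % M) (R / M ^ 6 % M) (R / M ^ 7 % M) := by
  have step : ∀ {N : ℕ} {α δ δ' : ℝ} {Ψ Ψ' : ℕ → ℕ → Prop},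
      (∀ x, Frac M δ' (Ψ x) → Frac N δ (Ψ' x)) → 0 ≤ δ → Frac M α (fun x => Frac M δ' (Ψ x)) →
      Frac (M * N) (α * δ) fun R => Ψ' (R % M) (R / M) := by
    intro N α δ δ' Ψ Ψ' h hδ hM
    exact Frac.mul hδ (hM.mono le_rfl fun x _ => h x)
  have key := step (fun x₀ => step (fun x₁ => step (fun x₂ => step (fun x₃ => step (fun x₄ =>
    step (fun x₅ => step (fun x₆ h => h) h₇) (by positivity)) (by positivity)) (by positivity))
    (by positivity)) (by positivity)) (by positivity) h
  have hM : M * (M * (M * (M * (M * (M * (M * M)))))) = M ^ 8 := by ring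
  rw [hM] at key
  refine key.mono le_rfl fun R hR h => ?_
  simp only [Nat.div_div_eq_div_mul] at h
  -- The leading digit of a number below `M ^ 8` needs no reduction.
  have hlast : R / (M * M * M * M * M * M * M) % M = R / (M * M * M * M * M * M * M) := by
    refine Nat.mod_eq_of_lt (Nat.div_lt_of_lt_mul (hR.trans_eq ?_))
    ring
  simpa [pow_succ, hlast] using h

theorem bitsVal_congr {t t' : ℕ → Bool} {K : ℕ} (h : ∀ i < K, t i = t' i) :
    bitsVal t K = bitsVal t' K := by
  induction K with
  | zero => rfl
  | succ K ih => rw [bitsVal, bitsVal, ih fun i hi => h i (by omega), h K (by omega)]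

/-- The first coin becomes the leading bit; this inverts `bitsVal` and shows that every number below
`2 ^ K` arises from some string of `K` coins. -/
theorem bitsVal_testBit (R K t : ℕ) (ht : t ≤ K) :
    bitsVal (fun i => R.testBit (K - 1 - i)) t = R % 2 ^ K / 2 ^ (K - t) := by
  induction t with
  | zero => simp [bitsVal, Nat.div_eq_of_lt (Nat.mod_lt R (Nat.two_pow_pos K))]
  | succ t ih =>
    rw [bitsVal, ih (by omega), Nat.toNat_testBit]
    obtain ⟨u, hu⟩ : ∃ u, u = K - (t + 1) := ⟨_, rfl⟩
    have h1 : K - 1 - t = u := by omega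
    have h2 : K - t = u + 1 := by omega
    have h3 : R / 2 ^ u % 2 = R % 2 ^ K / 2 ^ u % 2 := by
      rw [show K = u + (K - u) by omega, pow_add, Nat.mod_mul_right_div_self,
        Nat.mod_mod_of_dvd _ (dvd_pow_self 2 (by omega))]
    rw [h1, h2, ← hu, h3, pow_succ, ← Nat.div_div_eq_div_mul]
    omega

/-- Only the number formed by the first `K` coins matters for `Φ`. Each such number can be combined
with all strings for the other `T - K` coins, and distinct combinations give distinct tapes. -/
theorem successProb_ge {P : Prog} {n s T K : ℕ} {a : Fin n → ℕ} {δ : ℝ} {Φ : ℕ → Prop}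
    (hT : K ≤ T) (hΦ : Frac (2 ^ K) δ Φ)
    (h : ∀ r : Fin T → Bool, Φ (bitsVal (padTape r) K) → SolvesWithin P a s (padTape r) T) :
    δ ≤ successProb P a s T := by
  classical
  obtain ⟨G, hG⟩ : ∃ G, G = (Finset.range (2 ^ K)).filter Φ := ⟨_, rfl⟩
  let F : ℕ × (Fin (T - K) → Bool) → (Fin T → Bool) := fun y i =>
    if h : i.1 < K then y.1.testBit (K - 1 - i) else y.2 ⟨i - K, by omega⟩
  have hF1 : ∀ y : ℕ × (Fin (T - K) → Bool), y.1 < 2 ^ K → bitsVal (padTape (F y)) K = y.1 := by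
    intro y hy
    rw [bitsVal_congr (t' := fun i => y.1.testBit (K - 1 - i)), bitsVal_testBit _ _ _ le_rfl]
    · simp [Nat.mod_eq_of_lt hy]
    · intro i hi
      simp [padTape, F, hi, show i < T by omega]
  have hinj : Set.InjOn F (G ×ˢ (Finset.univ : Finset (Fin (T - K) → Bool)) : Finset _) := by
    intro y hy z hz hyz
    simp only [hG, Finset.coe_product, Set.mem_prod, Finset.coe_filter, Finset.mem_range,
      Set.mem_ofPred_eq, Finset.coe_univ, Set.mem_univ, and_true] at hy hz
    have h1 := hF1 y hy.1
    rw [hyz, hF1 z hz.1] at h1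
    refine Prod.ext h1.symm (funext fun i => ?_)
    have h2 := congrFun hyz ⟨i + K, by omega⟩
    simpa [F] using h2
  have hsub : ((G ×ˢ (Finset.univ : Finset (Fin (T - K) → Bool))).image F : Set (Fin T → Bool)) ⊆
      {r | SolvesWithin P a s (padTape r) T} := by
    intro r hr
    simp only [Finset.coe_image, Set.mem_image, Finset.mem_coe, Finset.mem_product, hG,
      Finset.mem_filter, Finset.mem_range, Finset.mem_univ, and_true] at hr
    obtain ⟨y, hy, rfl⟩ := hr
    exact h _ (by rw [hF1 y hy.1]; exact hy.2)
  have hcard := Set.ncard_le_ncard hsub (Set.toFinite _)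
  rw [Set.ncard_coe_finset, Finset.card_image_of_injOn hinj, Finset.card_product,
    Finset.card_univ, Fintype.card_fun, Fintype.card_bool, Fintype.card_fin] at hcard
  unfold successProb
  rw [le_div_iff₀ (by positivity)]
  have h2 : (2 : ℝ) ^ T = 2 ^ K * 2 ^ (T - K) := by rw [← pow_add]; congr 1; omega
  have h3 : δ * 2 ^ K ≤ (G.card : ℝ) := by
    rw [hG]
    exact_mod_cast frac_iff.1 hΦ
  calc δ * 2 ^ T = δ * 2 ^ K * 2 ^ (T - K) := by rw [h2]; ring
    _ ≤ G.card * 2 ^ (T - K) := by gcongr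
    _ ≤ _ := by exact_mod_cast hcard

/-! ### From matching keys to a solution -/

/-- The items as a function on the natural numbers. -/
def extend {n : ℕ} (a : Fin n → ℕ) (i : ℕ) : ℕ := if h : i < n then a ⟨i, h⟩ else 0

/-- The modulus `q` introduces no new solutions. -/
def GoodMod {n : ℕ} (a : Fin n → ℕ) (s q : ℕ) : Prop :=
  ∀ t ≤ 1, ∀ S₁ S₂ : Finset (Fin n), ∑ i ∈ S₁, a i ≡ t * s + ∑ i ∈ S₂, a i [MOD q] →
    ∑ i ∈ S₁, a i = t * s + ∑ i ∈ S₂, a i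

/-- The sign of a digit. -/
def sgn (d : ℕ) : ℤ := if d = 0 then 0 else if d = 1 then 1 else -1

theorem sum_extend {n : ℕ} (a : Fin n → ℕ) :
    ∑ t ∈ Finset.range n, extend a t = ∑ i, a i := by
  rw [Finset.sum_range]
  simp [extend]

/-- The reduced items are at most `q`, so the truncated difference `q - b i` in the key is a genuine
negation modulo `q`. -/
theorem keyOf_cast (P : Par) (hq : 0 < P.q) (f m : ℕ → ℕ) (i : ℕ)
    (hb : ∀ j < i, P.b j = m j % P.q) :
    ((P.keyOf f i : ℕ) : ZMod P.q) = ∑ j ∈ Finset.range i, (sgn (f j) : ZMod P.q) * m j := by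
  induction i with
  | zero => simp [Par.keyOf]
  | succ i ih =>
    rw [Finset.sum_range_succ, ← ih fun j hj => hb j (by omega), Par.keyOf]
    have h1 : m i % P.q ≤ P.q := (Nat.mod_lt _ hq).le
    split_ifs with h2 h3
    · simp [sgn, h2]
    · simp [sgn, h3, hb i]
    · simp [sgn, h2, h3, hb i, Nat.cast_sub h1]

theorem keyOf_lt' (P : Par) (hq : 0 < P.q) (f : ℕ → ℕ) (i : ℕ) : P.keyOf f i < P.q := by
  induction i with
  | zero => exact hq
  | succ i ih =>
    rw [Par.keyOf]
    split_ifs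
    · exact ih
    · exact Nat.mod_lt _ hq
    · exact Nat.mod_lt _ hq

/-- The hypothesis `hfg` covers both searches: either at most one of the two digits is nonzero, or
they are 1 and 2 and put the item into both sets. In all cases the sum of the signs is the indicator
of the first set minus that of the second. Matching keys then give the equation modulo `q`, and
`GoodMod` with `t = 1` lifts it to the integers. -/
theorem isSolution_of_hit {n s q : ℕ} {a : Fin n → ℕ} {P₁ P₂ : Par} {f g m : ℕ → ℕ} (hq : 0 < q)
    (h₁ : P₁.n = n) (h₂ : P₂.n = n) (hq₁ : P₁.q = q) (hq₂ : P₂.q = q)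
    (hb₁ : ∀ i < n, P₁.b i = extend a i % q) (hb₂ : ∀ i < n, P₂.b i = extend a i % q)
    (hfg : ∀ i < n, f i = 0 ∧ g i < 3 ∨ g i = 0 ∧ f i < 3 ∨ f i = 1 ∧ g i = 2)
    (hit : Hit P₁ P₂ (s % q) f g) (hgood : GoodMod a s q) (hd : Decoded n f g m)
    (hdiff : Differ n f g) {τ : Config} (hτ : τ.mem = m) :
    IsSolution a s (τ.outSet n 0) (τ.outSet n n) := by
  have hm1 : ∀ i : Fin n, i ∈ τ.outSet n 0 ↔ out1 f g i ≠ 0 := fun i => by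
    simp [Config.outSet, hτ, (hd i i.2).1]
  have hm2 : ∀ i : Fin n, i ∈ τ.outSet n n ↔ out2 f g i ≠ 0 := fun i => by
    simp [Config.outSet, hτ, (hd i i.2).2]
  constructor
  · obtain ⟨i, hi, hne⟩ := hdiff
    intro heq
    have h := hm1 ⟨i, hi⟩
    rw [heq, hm2] at h
    unfold out1 out2 at h hne
    have := hfg i hi
    dsimp only at h
    rcases this with ⟨h1, h2⟩ | ⟨h1, h2⟩ | ⟨h1, h2⟩ <;> rw [h1] at h hne
    · interval_cases g i <;> simp_all
    · interval_cases f i <;> simp_all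
    · rw [h2] at h hne
      simp at hne
  · have key : ((∑ i ∈ τ.outSet n 0, a i : ℕ) : ZMod q) = ((1 * s + ∑ i ∈ τ.outSet n n, a i : ℕ) :
        ZMod q) := by
      have e1 := keyOf_cast P₁ (by omega) f (extend a) n (by rw [hq₁]; exact hb₁)
      have e2 := keyOf_cast P₂ (by omega) g (extend a) n (by rw [hq₂]; exact hb₂)
      have hk := hit.key
      have hlt := keyOf_lt' P₂ (by omega) g n
      rw [h₁, h₂] at hk
      subst hq₂
      rw [hq₁] at e1
      rw [hk, ZMod.natCast_mod, Nat.cast_add, Nat.cast_sub hlt.le, ZMod.natCast_mod,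
        ZMod.natCast_self, e2] at e1
      have e3 : (s : ZMod P₂.q) = ∑ j ∈ Finset.range n,
          ((sgn (f j) + sgn (g j) : ℤ) : ZMod P₂.q) * extend a j := by
        push_cast
        simp only [add_mul]
        rw [Finset.sum_add_distrib, ← e1]
        ring
      have e4 : ∀ i : Fin n, ((sgn (f i) + sgn (g i) : ℤ) : ZMod P₂.q) * extend a i =
          (if i ∈ τ.outSet n 0 then (a i : ZMod P₂.q) else 0) -
            (if i ∈ τ.outSet n n then (a i : ZMod P₂.q) else 0) := by
        intro i
        simp only [hm1, hm2, extend, i.2, dite_true]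
        unfold out1 out2
        rcases hfg i i.2 with ⟨h1, h2⟩ | ⟨h1, h2⟩ | ⟨h1, h2⟩ <;> rw [h1]
        · interval_cases g i <;> simp [sgn]
        · interval_cases f i <;> simp [sgn]
        · rw [h2]
          simp [sgn]
      rw [Finset.sum_range, Finset.sum_congr rfl fun i _ => e4 i, Finset.sum_sub_distrib,
        Finset.sum_ite_mem, Finset.sum_ite_mem, Finset.univ_inter, Finset.univ_inter] at e3
      push_cast
      rw [e3]
      ring
    have := hgood 1 le_rfl _ _ ((ZMod.natCast_eq_natCast_iff _ _ _).1 key)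
    omega

theorem rel_init {n : ℕ} (a : Fin n → ℕ) (s : ℕ) : Rel (initConfig a s) (initSt n s (extend a)) where
  reg x := by
    -- The order of the constructors of `Var` matters here: `n` and `s` must land in the input
    -- registers 0 and 1.
    have h0 : Var.n.idx = 0 := rfl
    have h1 : Var.s.idx = 1 := rfl
    have i0 : x.idx = 0 ↔ x = .n := by rw [← h0, Var.idx_injective.eq_iff]
    have i1 : x.idx = 1 ↔ x = .s := by rw [← h1, Var.idx_injective.eq_iff]
    simp [initConfig, initSt, i0, i1]
  mem := rfl
  coins := rfl

/-- In the split search the supports lie on opposite sides of `c`; in the residue search the first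
list uses the digits 0, 1 and the second the digits 0, 2. -/
theorem mkSearch_digits {n q s : ℕ} {b : ℕ → ℕ} {md e xp xk j c : ℕ} (hmd : md ≤ 1) {f g : ℕ → ℕ}
    (hf : (mkSearch n q s b md e xp xk j c).P₁.Adm f n)
    (hg : (mkSearch n q s b md e xp xk j c).P₂.Adm g n) (i : ℕ) (hi : i < n) :
    f i = 0 ∧ g i < 3 ∨ g i = 0 ∧ f i < 3 ∨ f i = 1 ∧ g i = 2 := by
  have h1 := hf i hi
  have h2 := hg i hi
  have a1 := (mkSearch n q s b md e xp xk j c).P₁.act_eq_one_iff i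
  have a2 := (mkSearch n q s b md e xp xk j c).P₂.act_eq_one_iff i
  have a3 := (mkSearch n q s b md e xp xk j c).P₁.act_le_one i
  have a4 := (mkSearch n q s b md e xp xk j c).P₂.act_le_one i
  simp only [Search.P₁, Search.P₂, mkSearch] at h1 h2 a1 a2 a3 a4
  interval_cases md <;> omega

theorem algorithm_spec : ∃ (P : Prog) (K : ℕ), ∀ {n s R : ℕ} {a : Fin n → ℕ} {tape : ℕ → Bool},
    s < ∑ i, a i → R = bitsVal tape (128 * n) →
      HaltsWithin P a s tape (K * (inputLength a s ^ 6 +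
        (1 - bigFlag n (∑ i, a i)) * (n ^ 5 * 2 ^ drawG n (∑ i, a i) R))) ∧
      ((drawSearch n (∑ i, a i) s R (extend a)).P₁.treeSize n 0 ≤
          2000 * n * n * n * 2 ^ drawG n (∑ i, a i) R →
        (drawSearch n (∑ i, a i) s R (extend a)).P₂.treeSize n 0 ≤
          2000 * n * n * n * 2 ^ drawG n (∑ i, a i) R →
        (drawSearch n (∑ i, a i) s R (extend a)).Good → GoodMod a s (modulus n (∑ i, a i) R) →
        SolvesWithin P a s tape (K * (inputLength a s ^ 6 +
          (1 - bigFlag n (∑ i, a i)) * (n ^ 5 * 2 ^ drawG n (∑ i, a i) R)))) := by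
  obtain ⟨K, hK⟩ := main_spec
  refine ⟨main.compile 41, K, ?_⟩
  intro n s R a tape hs hR
  have hn : 0 < n := by
    rcases Nat.eq_zero_or_pos n with rfl | h
    · simp at hs
    · exact h
  obtain ⟨L, hL⟩ : ∃ L, L = inputLength a s := ⟨_, rfl⟩
  have hsize : ∀ T : Finset (Fin n), ∑ i ∈ T, a i < 2 ^ ∑ i ∈ T, Nat.size (a i) := by
    intro T
    -- Passing to a product turns the bound on a sum into the sum of the bit lengths.
    have h1 : 1 + ∑ i ∈ T, a i ≤ ∏ i ∈ T, (1 + a i) := by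
      induction T using Finset.induction_on with
      | empty => simp
      | insert i T hi ih =>
        rw [Finset.sum_insert hi, Finset.prod_insert hi]
        nlinarith [Nat.zero_le (a i * ∑ i ∈ T, a i), Nat.mul_le_mul_left (1 + a i) ih]
    have h2 : ∏ i ∈ T, (1 + a i) ≤ ∏ i ∈ T, 2 ^ Nat.size (a i) :=
      Finset.prod_le_prod' fun i _ => by have := Nat.lt_size_self (a i); omega
    rw [Finset.prod_pow_eq_pow_sum] at h2
    omega
  have hσL : ∑ i, a i < 2 ^ L := (hsize Finset.univ).trans_le
    (Nat.pow_le_pow_right two_pos (by rw [hL]; unfold inputLength; omega))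
  have hσ0 : 0 < ∑ i, Nat.size (a i) := by
    by_contra h
    have := hsize Finset.univ
    rw [show ∑ i, Nat.size (a i) = 0 by omega] at this
    omega
  have hmL : ∀ j, extend a j < 2 ^ L := fun j => by
    unfold extend
    split_ifs with h
    · exact (Finset.single_le_sum (fun i _ => Nat.zero_le (a i)) (Finset.mem_univ _)).trans_lt hσL
    · positivity
  obtain ⟨hc, hg⟩ := hK (tape := tape) (R := R) (s := s) hn (m := extend a)
    (fun j hj => by simp [extend, not_lt.2 hj])
    (show n < L by rw [hL]; unfold inputLength; omega) hmL (hs.trans hσL) hσL (sum_extend a).symm hR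
  obtain ⟨τ, hx, hτ, -⟩ := main.compile_correct tape 41 _ _ le_rfl (rel_init a s)
  rw [← hL]
  refine ⟨⟨_, τ, hx, hc⟩, fun h1 h2 h3 h4 => ⟨_, τ, hx, hc, ?_⟩⟩
  obtain ⟨f, g, hit, hd, hdiff⟩ := hg h1 h2 h3
  exact isSolution_of_hit (P₁ := (drawSearch n (∑ i, a i) s R (extend a)).P₁)
    (P₂ := (drawSearch n (∑ i, a i) s R (extend a)).P₂) (q := modulus n (∑ i, a i) R) (modulus_pos _ _ _) rfl rfl rfl rfl
    (fun _ _ => rfl) (fun _ _ => rfl)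
    (mkSearch_digits (by omega) hit.adm₁ hit.adm₂) hit h4 hd hdiff hτ.mem

/-! ### Primes and the random modulus `q` -/

/-- There are many primes below a power of two. -/
theorem two_pow_le_primes {e : ℕ} (he : 0 < e) : 2 ^ e ≤ 4 * e * (Nat.primesLE (2 ^ e)).card := by
  rw [Nat.primesLE_card_eq_primeCounting]
  have h := Chebyshev.pi_ge (2 ^ e)
  have hlog : 0 < Real.log 2 := Real.log_pos (by norm_num)
  have he' : (0 : ℝ) < e := by exact_mod_cast he
  rcases Nat.lt_or_ge e 2 with h2 | h2
  · have : e = 1 := by omega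
    subst this
    decide
  · have h3 : 4 * (e + 1) ≤ 3 * 2 ^ e := by
      obtain ⟨k, rfl⟩ : ∃ k, e = k + 2 := ⟨e - 2, by omega⟩
      have : k + 1 ≤ 2 ^ k := k.lt_two_pow_self
      rw [pow_add]
      omega
    have h3' : (4 : ℝ) * (e + 1) ≤ 3 * 2 ^ e := by exact_mod_cast h3
    have h4 : Real.log ((2 : ℝ) ^ e + 1) ≤ (e + 1) * Real.log 2 := by
      have h5 : (2 : ℝ) ^ e + 1 ≤ 2 ^ (e + 1) := by
        rw [pow_succ]
        have : (1 : ℝ) ≤ 2 ^ e := one_le_pow₀ (by norm_num)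
        linarith
      calc _ ≤ Real.log (2 ^ (e + 1)) := Real.log_le_log (by positivity) h5
        _ = _ := by rw [Real.log_pow]; push_cast; ring
    push_cast at h
    rw [Real.log_pow, div_le_iff₀ (by positivity)] at h
    have h6 : (2 : ℝ) ^ e ≤ 4 * e * Nat.primeCounting (2 ^ e) := by
      have h7 : (2 : ℝ) ^ e * Real.log 2 ≤
          4 * e * Nat.primeCounting (2 ^ e) * Real.log 2 := by nlinarith
      exact le_of_mul_le_mul_right h7 hlog
    exact_mod_cast h6

theorem two_pow_card_primeFactors_le {d : ℕ} (hd : d ≠ 0) : 2 ^ d.primeFactors.card ≤ d :=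
  calc 2 ^ d.primeFactors.card ≤ ∏ p ∈ d.primeFactors, p :=
        Finset.pow_card_le_prod _ _ _ fun _ hp => (Nat.prime_of_mem_primeFactors hp).two_le
    _ ≤ d := Nat.le_of_dvd (Nat.pos_of_ne_zero hd) (Nat.prod_primeFactors_dvd d)

theorem card_primeFactors_le {d k : ℕ} (h : d < 2 ^ k) : d.primeFactors.card ≤ k := by
  rcases eq_or_ne d 0 with rfl | hd
  · simp
  · exact ((Nat.pow_lt_pow_iff_right one_lt_two).1 ((two_pow_card_primeFactors_le hd).trans_lt h)).le

/-- The distance of two numbers. -/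
theorem dist_dvd_of_modEq {q x y : ℕ} (h : x ≡ y [MOD q]) : q ∣ Nat.dist x y := by
  rcases le_total x y with hxy | hxy
  · rw [Nat.dist_eq_sub_of_le hxy]
    exact (Nat.modEq_iff_dvd' hxy).1 h
  · rw [Nat.dist_eq_sub_of_le_right hxy]
    exact (Nat.modEq_iff_dvd' hxy).1 h.symm

section
variable {n : ℕ} (a : Fin n → ℕ) (s : ℕ)

theorem goodMod_of_large {q : ℕ} (hs : s < ∑ i, a i) (hq : 2 * ∑ i, a i < q) : GoodMod a s q := by
  intro t ht S₁ S₂ h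
  have h1 : ∑ i ∈ S₁, a i ≤ ∑ i, a i := Finset.sum_le_sum_of_subset (Finset.subset_univ _)
  have h2 : ∑ i ∈ S₂, a i ≤ ∑ i, a i := Finset.sum_le_sum_of_subset (Finset.subset_univ _)
  have h3 : t * s ≤ 1 * s := Nat.mul_le_mul_right _ ht
  exact h.eq_of_lt_of_lt (by omega) (by omega)

/-- It suffices that `1 + x` is a prime dividing none of the nonzero differences of the two sides.
There are `2 * 4 ^ n` choices of `t`, `S₁`, `S₂`, and each difference is below `2 ^ (2 ^ n + 1)`,
hence has at most `2 ^ n + 1` prime factors. So at most `2 ^ (3 * n + 2)` primes are bad, at most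
half of the primes up to `2 ^ (16 * n)`. -/
theorem frac_goodMod (hn : 0 < n) (hs : s < ∑ i, a i) (hσ : ∑ i, a i < 2 ^ 2 ^ n) :
    Frac (2 ^ (16 * n)) (1 / (128 * n)) fun x => GoodMod a s (1 + x) := by
  classical
  obtain ⟨d, hd⟩ : ∃ d : ℕ × Finset (Fin n) × Finset (Fin n) → ℕ, d = fun y =>
    Nat.dist (∑ i ∈ y.2.1, a i) (y.1 * s + ∑ i ∈ y.2.2, a i) := ⟨_, rfl⟩
  obtain ⟨B, hB⟩ : ∃ B : Finset ℕ, B = (Finset.range 2 ×ˢ (Finset.univ ×ˢ Finset.univ)).biUnion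
    fun y => (d y).primeFactors := ⟨_, rfl⟩
  have hBcard : B.card ≤ 2 ^ (3 * n + 2) := by
    rw [hB]
    refine (Finset.card_biUnion_le_card_mul _ _ (2 ^ n + 1) fun y hy => ?_).trans ?_
    · refine card_primeFactors_le ?_
      have h1 : ∑ i ∈ y.2.1, a i ≤ ∑ i, a i := Finset.sum_le_sum_of_subset (Finset.subset_univ _)
      have h2 : ∑ i ∈ y.2.2, a i ≤ ∑ i, a i := Finset.sum_le_sum_of_subset (Finset.subset_univ _)
      have hy1 : y.1 ≤ 1 := by
        simp only [Finset.mem_product, Finset.mem_range] at hy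
        omega
      have h3 : y.1 * s ≤ 1 * s := Nat.mul_le_mul_right _ hy1
      rw [hd, pow_succ]
      change Nat.dist _ _ < _
      unfold Nat.dist
      omega
    · simp only [Finset.card_product, Finset.card_range, Finset.card_univ, Fintype.card_finset,
        Fintype.card_fin]
      have h1 : (2 : ℕ) ^ (3 * n + 2) = 2 * (2 ^ n * 2 ^ n) * (2 * 2 ^ n) := by
        rw [pow_add, pow_mul']
        ring
      rw [h1]
      exact Nat.mul_le_mul_left _ (by have : 1 ≤ 2 ^ n := Nat.one_le_two_pow; omega)
  refine Frac.of_card ((Nat.primesLE (2 ^ (16 * n)) \ B).image fun p => p - 1) ?_ ?_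
  · intro x hx
    simp only [Finset.mem_image, Finset.mem_sdiff, Nat.mem_primesLE] at hx
    obtain ⟨p, ⟨⟨hp1, hp2⟩, hp3⟩, rfl⟩ := hx
    have hp := hp2.pos
    refine ⟨by omega, ?_⟩
    rw [show 1 + (p - 1) = p by omega]
    intro t ht S₁ S₂ h
    by_contra hne
    refine hp3 ?_
    rw [hB, Finset.mem_biUnion]
    refine ⟨(t, S₁, S₂), by simp; omega, ?_⟩
    rw [Nat.mem_primeFactors]
    refine ⟨hp2, ?_, ?_⟩
    · rw [hd]
      exact dist_dvd_of_modEq h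
    · rw [hd]
      exact fun h0 => hne (Nat.eq_of_dist_eq_zero h0)
  · rw [Finset.card_image_of_injOn]
    · have h1 := two_pow_le_primes (e := 16 * n) (by omega)
      have h2 := Finset.le_card_sdiff B (Nat.primesLE (2 ^ (16 * n)))
      have h3 : 128 * n * 2 ^ (3 * n + 2) ≤ 2 ^ (16 * n) := by
        calc 128 * n * 2 ^ (3 * n + 2) ≤ 2 ^ 7 * 2 ^ n * 2 ^ (3 * n + 2) :=
              Nat.mul_le_mul_right _ (Nat.mul_le_mul_left _ n.lt_two_pow_self.le)
          _ = 2 ^ (7 + n + (3 * n + 2)) := by rw [← pow_add, ← pow_add]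
          _ ≤ _ := Nat.pow_le_pow_right two_pos (by omega)
      have h4 : 2 ^ (16 * n) ≤ 128 * n * (Nat.primesLE (2 ^ (16 * n)) \ B).card := by
        have h5 : 128 * n * (Nat.primesLE (2 ^ (16 * n))).card ≤
            128 * n * ((Nat.primesLE (2 ^ (16 * n)) \ B).card + 2 ^ (3 * n + 2)) :=
          Nat.mul_le_mul_left _ (by omega)
        rw [mul_add] at h5
        have h6 : 4 * (16 * n) * (Nat.primesLE (2 ^ (16 * n))).card * 2 =
          128 * n * (Nat.primesLE (2 ^ (16 * n))).card := by ring
        omega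
      have h4' : (2 : ℝ) ^ (16 * n) ≤ 128 * n * (Nat.primesLE (2 ^ (16 * n)) \ B).card := by
        exact_mod_cast h4
      have hn' : (0 : ℝ) < n := by exact_mod_cast hn
      push_cast
      rw [div_mul_eq_mul_div, one_mul, div_le_iff₀ (by positivity)]
      linarith
    · intro x hx y hy hxy
      simp only [Finset.coe_sdiff, Set.mem_sdiff, Finset.mem_coe, Nat.mem_primesLE] at hx hy
      have := hx.1.2.pos
      have := hy.1.2.pos
      dsimp only at hxy
      omega

end

/-! ### List lengths and the spread of residues -/

/-- The enumeration with another target. -/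
def Par.withK (P : Par) (k : ℕ) : Par := { P with k := k }

/-- Every digit string has exactly one residue. Summing over all targets therefore counts each
string once, and with at most one nonzero digit allowed there are at most `2 ^ u` of them. -/
theorem Par.sum_count_le (P : Par) (hf : P.f1 + P.f2 ≤ 1) (u r : ℕ) :
    ∑ k ∈ Finset.range P.p, (P.withK k).count u r ≤ 2 ^ u := by
  induction u generalizing r with
  | zero =>
    have h : ∀ k ∈ Finset.range P.p, (P.withK k).count 0 r = if k = r then 1 else 0 := by
      intro k _
      simp only [Par.count, Par.withK]
      split_ifs <;> omega
    rw [Finset.sum_congr rfl h, Finset.sum_ite_eq']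
    split_ifs <;> simp
  | succ u ih =>
    have h : ∀ k ∈ Finset.range P.p, (P.withK k).count (u + 1) r ≤
        (P.withK k).count u r + (P.withK k).count u (P.step (P.n - (u + 1)) r) := by
      intro k _
      simp only [Par.count]
      refine Nat.add_le_add_left ?_ _
      refine (Nat.mul_le_mul_right _ (Nat.mul_le_mul ((P.withK k).act_le_one _) hf)).trans ?_
      rw [one_mul, one_mul]
      rfl
    refine (Finset.sum_le_sum h).trans ?_
    rw [Finset.sum_add_distrib, pow_succ]
    have h1 := ih r
    have h2 := ih (P.step (P.n - (u + 1)) r)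
    omega

/-- Few targets have many completions. -/
theorem Par.card_large_count (P : Par) (hf : P.f1 + P.f2 ≤ 1) (T : ℕ) :
    ((Finset.range P.p).filter fun k => T < (P.withK k).count P.n 0).card * T ≤ 2 ^ P.n := by
  -- Markov's inequality for the numbers of completions.
  refine le_trans ?_ (P.sum_count_le hf P.n 0)
  rw [← smul_eq_mul]
  refine (Finset.card_nsmul_le_sum _ _ T fun k hk => (Finset.mem_filter.1 hk).2.le).trans ?_
  exact Finset.sum_le_sum_of_subset (Finset.filter_subset _ _)

theorem Par.resOf_eq (P : Par) (f : ℕ → ℕ) (i : ℕ) :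
    P.resOf f i = (∑ j ∈ Finset.range i, if f j = 0 then 0 else P.b j * P.al + P.be) % P.p := by
  induction i with
  | zero => simp [Par.resOf]
  | succ i ih =>
    rw [Par.resOf, Finset.sum_range_succ, ih]
    split_ifs
    · rfl
    · rw [Par.step, Nat.mod_add_mod]

section
variable {ι : Type*}

/-- The number of collisions bounds the number of values from below. -/
theorem card_sq_le_card_image_mul (X : Finset ι) (w : ι → ℕ) :
    X.card ^ 2 ≤ (X.image w).card * ((X ×ˢ X).filter fun y => w y.1 = w y.2).card := by
  have h1 : X.card = ∑ r ∈ X.image w, (X.filter fun x => w x = r).card :=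
    Finset.card_eq_sum_card_fiberwise fun x hx => Finset.mem_coe.2 (Finset.mem_image_of_mem w hx)
  -- The collisions, diagonal included, are counted by the squares of the fibre sizes; Cauchy's
  -- inequality then compares them with the number of fibres.
  have h2 : ((X ×ˢ X).filter fun y => w y.1 = w y.2).card =
      ∑ r ∈ X.image w, (X.filter fun x => w x = r).card ^ 2 := by
    rw [Finset.card_eq_sum_card_fiberwise (f := fun y => w y.1) (t := X.image w)]
    · refine Finset.sum_congr rfl fun r _ => ?_
      rw [pow_two, ← Finset.card_product]
      congr 1
      ext y
      simp only [Finset.mem_filter, Finset.mem_product]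
      constructor
      · rintro ⟨⟨⟨h1, h2⟩, h3⟩, h4⟩
        exact ⟨⟨h1, h4⟩, h2, h3 ▸ h4⟩
      · rintro ⟨⟨h1, h2⟩, h3, h4⟩
        exact ⟨⟨⟨h1, h3⟩, h2.trans h4.symm⟩, h2⟩
    · intro y hy
      have := Finset.mem_product.1 (Finset.mem_filter.1 hy).1
      exact Finset.mem_coe.2 (Finset.mem_image_of_mem w this.1)
  rw [h2]
  conv_lhs => rw [h1]
  exact sq_sum_le_card_mul_sum_sq

/-- The pairs on the diagonal collide modulo every prime. Any other pair has a nonzero difference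
below `2 ^ D` and collides modulo at most `D` primes. -/
theorem sum_collisions_le [DecidableEq ι] {X : Finset ι} {v : ι → ℕ} {D N : ℕ} (hv : Set.InjOn v X)
    (hD : ∀ x ∈ X, v x < 2 ^ D) :
    ∑ p ∈ Nat.primesLE N, ((X ×ˢ X).filter fun y => v y.1 % p = v y.2 % p).card ≤
      (Nat.primesLE N).card * X.card + X.card ^ 2 * D := by
  have h1 : ∀ p, ((X ×ˢ X).filter fun y => v y.1 % p = v y.2 % p).card =
      ∑ y ∈ X ×ˢ X, if v y.1 % p = v y.2 % p then 1 else 0 := fun p => by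
    rw [Finset.card_filter]
  simp only [h1]
  rw [Finset.sum_comm]
  have h2 : ∀ y ∈ X ×ˢ X, (∑ p ∈ Nat.primesLE N, if v y.1 % p = v y.2 % p then 1 else 0) ≤
      (if y.1 = y.2 then (Nat.primesLE N).card else 0) + D := by
    intro y hy
    rw [← Finset.card_filter]
    have hy' := Finset.mem_product.1 hy
    split_ifs with h
    · exact (Finset.card_filter_le _ _).trans (Nat.le_add_right _ _)
    · rw [zero_add]
      have h3 : Nat.dist (v y.1) (v y.2) < 2 ^ D := by
        have := hD _ hy'.1
        have := hD _ hy'.2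
        unfold Nat.dist
        omega
      refine le_trans (Finset.card_le_card ?_) (card_primeFactors_le h3)
      intro p hp
      simp only [Finset.mem_filter, Nat.mem_primesLE] at hp
      rw [Nat.mem_primeFactors]
      exact ⟨hp.1.2, dist_dvd_of_modEq hp.2,
        fun h0 => h (hv hy'.1 hy'.2 (Nat.eq_of_dist_eq_zero h0))⟩
  refine (Finset.sum_le_sum h2).trans ?_
  rw [Finset.sum_add_distrib, Finset.sum_const, Finset.card_product, smul_eq_mul, pow_two]
  refine Nat.add_le_add_right ?_ _
  rw [Finset.sum_product]
  have h3 : ∀ x ∈ X, (∑ y ∈ X, if (x, y).1 = (x, y).2 then (Nat.primesLE N).card else 0) =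
      (Nat.primesLE N).card := by
    intro x hx
    simp [hx]
  rw [Finset.sum_congr rfl h3, Finset.sum_const, smul_eq_mul, mul_comm]

/-- Many primes keep many of the values apart. -/
theorem frac_prime [DecidableEq ι] {X : Finset ι} {v : ι → ℕ} {n e : ℕ} (hn : 0 < n) (he : e ≤ n)
    (hX : X.card = 2 ^ e) (hv : Set.InjOn v X) (hD : ∀ x ∈ X, v x < 2 ^ (17 * n)) :
    Frac (2 ^ e) (1 / (8 * n)) fun y =>
      2 ^ e ≤ 138 * n ^ 2 * (X.image fun x => v x % (1 + y)).card := by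
  have hn' : (0 : ℝ) < n := by exact_mod_cast hn
  have hn2 : 1 ≤ n ^ 2 := Nat.one_le_pow _ _ hn
  -- For `e = 0` there is no prime up to `2 ^ e`, but also just one value to keep apart.
  rcases Nat.eq_zero_or_pos e with rfl | he0
  · refine (Frac.of_forall fun y hy => ?_).mono ?_ fun _ _ h => h
    · have h1 : 0 < (X.image fun x => v x % (1 + y)).card := by
        rw [Finset.card_pos, Finset.image_nonempty, ← Finset.card_pos, hX]
        positivity
      nlinarith
    · rw [div_le_one (by positivity)]
      have : (1 : ℝ) ≤ n := by exact_mod_cast hn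
      linarith
  obtain ⟨Q, hQ⟩ : ∃ Q, Q = Nat.primesLE (2 ^ e) := ⟨_, rfl⟩
  obtain ⟨coll, hcoll⟩ : ∃ coll : ℕ → ℕ, coll = fun p =>
    ((X ×ˢ X).filter fun y => v y.1 % p = v y.2 % p).card := ⟨_, rfl⟩
  have hsum : ∑ p ∈ Q, coll p ≤ Q.card * X.card + X.card ^ 2 * (17 * n) := by
    rw [hQ, hcoll]
    exact sum_collisions_le hv hD
  have hpr : 2 ^ e ≤ 4 * e * Q.card := by rw [hQ]; exact two_pow_le_primes he0
  have hpr' : 2 ^ e ≤ 4 * n * Q.card :=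
    hpr.trans (Nat.mul_le_mul_right _ (by omega))
  have hN : 0 < 2 ^ e := by positivity
  -- Twice the bound `69 * n ^ 2 * 2 ^ e` for the average number of collisions. In it, 68 is the
  -- product of the 17 in the size of the values and the 4 in the density of the primes, and 1 is
  -- for the diagonal. At least half of the primes stay below `T`.
  obtain ⟨T, hT⟩ : ∃ T, T = 138 * n ^ 2 * 2 ^ e := ⟨_, rfl⟩
  have hbad : 2 * (Q.filter fun p => T < coll p).card ≤ Q.card := by
    have h1 : (Q.filter fun p => T < coll p).card * T ≤ ∑ p ∈ Q, coll p := by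
      rw [← smul_eq_mul]
      refine (Finset.card_nsmul_le_sum _ _ T fun k hk => (Finset.mem_filter.1 hk).2.le).trans ?_
      exact Finset.sum_le_sum_of_subset (Finset.filter_subset _ _)
    have h2 : X.card ^ 2 * (17 * n) ≤ 68 * n ^ 2 * 2 ^ e * Q.card := by
      rw [hX]
      have := Nat.mul_le_mul_left (2 ^ e * (17 * n)) hpr'
      calc (2 ^ e) ^ 2 * (17 * n) = 2 ^ e * (17 * n) * 2 ^ e := by ring
        _ ≤ 2 ^ e * (17 * n) * (4 * n * Q.card) := this
        _ = _ := by ring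
    have h3 : Q.card * X.card ≤ n ^ 2 * 2 ^ e * Q.card := by
      rw [hX]
      calc Q.card * 2 ^ e = 1 * (2 ^ e * Q.card) := by ring
        _ ≤ n ^ 2 * (2 ^ e * Q.card) := Nat.mul_le_mul_right _ hn2
        _ = _ := by ring
    have h4 : 2 * (Q.filter fun p => T < coll p).card * (69 * n ^ 2 * 2 ^ e) ≤
        Q.card * (69 * n ^ 2 * 2 ^ e) := by
      calc 2 * (Q.filter fun p => T < coll p).card * (69 * n ^ 2 * 2 ^ e) =
          (Q.filter fun p => T < coll p).card * T := by rw [hT]; ring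
        _ ≤ n ^ 2 * 2 ^ e * Q.card + 68 * n ^ 2 * 2 ^ e * Q.card :=
          h1.trans (hsum.trans (Nat.add_le_add h3 h2))
        _ = _ := by ring
    exact Nat.le_of_mul_le_mul_right h4 (by positivity)
  refine Frac.of_card ((Q.filter fun p => ¬ T < coll p).image fun p => p - 1) ?_ ?_
  · intro x hx
    simp only [Finset.mem_image, Finset.mem_filter, hQ, Nat.mem_primesLE, not_lt] at hx
    obtain ⟨p, ⟨⟨hp1, hp2⟩, hp3⟩, rfl⟩ := hx
    have hp := hp2.pos
    refine ⟨by omega, ?_⟩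
    rw [show 1 + (p - 1) = p by omega]
    have h1 := card_sq_le_card_image_mul X fun x => v x % p
    rw [hX] at h1
    rw [hcoll] at hp3
    have h2 : 2 ^ e * 2 ^ e ≤ 138 * n ^ 2 * (X.image fun x => v x % p).card * 2 ^ e := by
      calc 2 ^ e * 2 ^ e = (2 ^ e) ^ 2 := by ring
        _ ≤ _ := h1
        _ ≤ (X.image fun x => v x % p).card * T := Nat.mul_le_mul_left _ hp3
        _ = _ := by rw [hT]; ring
    exact Nat.le_of_mul_le_mul_right h2 hN
  · rw [Finset.card_image_of_injOn]
    · have h1 := Finset.card_filter_add_card_filter_not (s := Q) (fun p => T < coll p)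
      have h2 : 2 ^ e ≤ 8 * n * (Q.filter fun p => ¬ T < coll p).card := by
        have h3 : 4 * n * Q.card ≤ 4 * n * (2 * (Q.filter fun p => ¬ T < coll p).card) :=
          Nat.mul_le_mul_left _ (by omega)
        calc 2 ^ e ≤ _ := hpr'.trans h3
          _ = _ := by ring
      have h2' : (2 : ℝ) ^ e ≤ 8 * n * (Q.filter fun p => ¬ T < coll p).card := by
        exact_mod_cast h2
      push_cast
      rw [div_mul_eq_mul_div, one_mul, div_le_iff₀ (by positivity)]
      linarith
    · intro x hx y hy hxy
      simp only [Finset.coe_filter, Set.mem_ofPred_eq, hQ, Nat.mem_primesLE] at hx hy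
      have := hx.1.2.pos
      have := hy.1.2.pos
      dsimp only at hxy
      omega

end

/-! ### Largest solutions and their extensions -/

/-- The digits that mark the elements of a set. -/
def mark {n : ℕ} (d : ℕ) (S : Finset (Fin n)) (i : ℕ) : ℕ :=
  if h : i < n then if (⟨i, h⟩ : Fin n) ∈ S then d else 0 else 0

theorem mark_coe {n : ℕ} (d : ℕ) (S : Finset (Fin n)) (i : Fin n) :
    mark d S i = if i ∈ S then d else 0 := by
  simp [mark]

theorem mkSearch_one (n q s : ℕ) (b : ℕ → ℕ) (e xp xk j c : ℕ) :
    mkSearch n q s b 1 e xp xk j c = ⟨n, 1 + xp % 2 ^ e, q, s, n, 1,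
      (xk % (1 + xp % 2 ^ e) + s + (j % (2 * n + 1) + n * (xp % 2 ^ e)) * q) % (1 + xp % 2 ^ e),
      xk % (1 + xp % 2 ^ e), b⟩ := by
  simp [mkSearch]

section
variable {n : ℕ}

theorem resOf_mark (P : Par) (hal : P.al = 1) (hbe : P.be = 0) {d : ℕ} (hd : d ≠ 0)
    (S : Finset (Fin n)) : P.resOf (mark d S) n = (∑ i ∈ S, P.b i) % P.p := by
  rw [P.resOf_eq, Finset.sum_range]
  congr 1
  have h : ∀ i : Fin n, (if mark d S i = 0 then 0 else P.b i * P.al + P.be) =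
      if i ∈ S then P.b i else 0 := by
    intro i
    rw [mark_coe, hal, hbe]
    split_ifs <;> simp_all
  rw [Finset.sum_congr rfl fun i _ => h i, Finset.sum_ite_mem, Finset.univ_inter]

theorem keyOf_mark (P : Par) {q : ℕ} (hq : 0 < q) (hPq : P.q = q) (d : ℕ) (S : Finset (Fin n))
    {a : Fin n → ℕ} (hb : ∀ i < n, P.b i = extend a i % q) :
    ((P.keyOf (mark d S) n : ℕ) : ZMod q) = (sgn d : ZMod q) * (∑ i ∈ S, a i : ℕ) := by
  subst hPq
  rw [keyOf_cast P hq _ (extend a) n hb, Finset.sum_range]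
  have h : ∀ i : Fin n, (sgn (mark d S i) : ZMod P.q) * extend a i =
      if i ∈ S then (sgn d : ZMod P.q) * a i else 0 := by
    intro i
    rw [mark_coe]
    split_ifs <;> simp [sgn, extend]
  rw [Finset.sum_congr rfl fun i _ => h i, Finset.sum_ite_mem, Finset.univ_inter, Nat.cast_sum,
    Finset.mul_sum]

theorem keyOf_congr (P : Par) {f g : ℕ → ℕ} {i : ℕ} (h : ∀ j < i, f j = g j) :
    P.keyOf f i = P.keyOf g i := congrArg Node.key (P.node_congr h)

theorem resOf_congr (P : Par) {f g : ℕ → ℕ} {i : ℕ} (h : ∀ j < i, f j = g j) :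
    P.resOf f i = P.resOf g i := congrArg Node.res (P.node_congr h)

end

/-- A pair of disjoint sets that is a solution, with the largest possible total size. -/
structure IsMaxPair {n : ℕ} (a : Fin n → ℕ) (s : ℕ) (M₁ M₂ : Finset (Fin n)) : Prop where
  sol : IsSolution a s M₁ M₂
  disj : Disjoint M₁ M₂
  max : ∀ S₁ S₂, IsSolution a s S₁ S₂ → Disjoint S₁ S₂ → S₁.card + S₂.card ≤ M₁.card + M₂.card

section
variable {n : ℕ} {a : Fin n → ℕ} {s : ℕ} {M₁ M₂ Y : Finset (Fin n)}

/-- Outside a largest solution, all subset sums are distinct. -/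
theorem IsMaxPair.sum_injOn (h : IsMaxPair a s M₁ M₂) (hY₁ : Disjoint M₁ Y)
    (hY₂ : Disjoint M₂ Y) : Set.InjOn (fun X => ∑ i ∈ X, a i) (Y.powerset : Set _) := by
  intro X hX X' hX' heq
  simp only [Finset.coe_powerset, Set.mem_preimage, Set.mem_powerset_iff, Finset.coe_subset]
    at hX hX'
  dsimp only at heq
  have e1 := Finset.sum_inter_add_sum_sdiff X X' a
  have e2 := Finset.sum_inter_add_sum_sdiff X' X a
  rw [Finset.inter_comm] at e2
  have d1 : Disjoint M₁ (X \ X') := hY₁.mono_right (Finset.sdiff_subset.trans hX)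
  have d2 : Disjoint M₂ (X' \ X) := hY₂.mono_right (Finset.sdiff_subset.trans hX')
  have d3 : Disjoint M₁ (X' \ X) := hY₁.mono_right (Finset.sdiff_subset.trans hX')
  have d4 : Disjoint M₂ (X \ X') := hY₂.mono_right (Finset.sdiff_subset.trans hX)
  have d5 : Disjoint (X \ X') (X' \ X) := disjoint_sdiff_sdiff
  have dd : Disjoint (M₁ ∪ X \ X') (M₂ ∪ X' \ X) := by
    rw [Finset.disjoint_union_left, Finset.disjoint_union_right, Finset.disjoint_union_right]
    exact ⟨⟨h.disj, d3⟩, d4.symm, d5⟩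
  -- Equal sums of `X` and `X'` give equal sums of the two differences, so adjoining these to the
  -- two sides keeps a disjoint solution. By maximality nothing was added, and both differences are
  -- empty.
  have hsol : IsSolution a s (M₁ ∪ X \ X') (M₂ ∪ X' \ X) := by
    constructor
    · intro he
      rw [he, disjoint_self, Finset.bot_eq_empty, Finset.union_eq_empty] at dd
      have : M₁ ∪ X \ X' = ∅ := by rw [he, dd.1, dd.2, Finset.union_empty]
      rw [Finset.union_eq_empty] at this
      exact h.sol.1 (this.1.trans dd.1.symm)
    · rw [Finset.sum_union d1, Finset.sum_union d2, h.sol.2]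
      omega
  have hm := h.max _ _ hsol dd
  rw [Finset.card_union_of_disjoint d1, Finset.card_union_of_disjoint d2] at hm
  have h1 : X \ X' = ∅ := Finset.card_eq_zero.1 (by omega)
  have h2 : X' \ X = ∅ := Finset.card_eq_zero.1 (by omega)
  exact Finset.Subset.antisymm (Finset.sdiff_eq_empty_iff_subset.1 h1)
    (Finset.sdiff_eq_empty_iff_subset.1 h2)

theorem sum_mod_modEq (q : ℕ) (S : Finset (Fin n)) :
    ∑ i ∈ S, extend a i % q ≡ ∑ i ∈ S, a i [MOD q] := by
  have h : ∀ i : Fin n, extend a i = a i := fun i => by simp [extend]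
  simp only [h]
  exact (Finset.sum_nat_mod S q a).symm

theorem sum_mod_le {q : ℕ} (hq : 0 < q) (S : Finset (Fin n)) :
    ∑ i ∈ S, extend a i % q ≤ n * (q - 1) := by
  refine (Finset.sum_le_card_nsmul S _ (q - 1) fun i _ => ?_).trans ?_
  · have := Nat.mod_lt (extend a i) hq
    omega
  · rw [smul_eq_mul]
    exact Nat.mul_le_mul_right _ ((Finset.card_le_univ S).trans (by simp))

/-- The multiple of the modulus between the two sides of a solution. -/
theorem exists_shift {q : ℕ} (hq : 0 < q) (hsol : IsSolution a s M₁ M₂) : ∃ j < 2 * n + 1,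
    ∑ i ∈ M₁, extend a i % q + n * q = s % q + ∑ i ∈ M₂, extend a i % q + j * q := by
  have h1 := sum_mod_modEq (a := a) q M₁
  have h2 := sum_mod_modEq (a := a) q M₂
  have b1 := sum_mod_le (a := a) hq M₁
  have b2 := sum_mod_le (a := a) hq M₂
  have hs : s % q ≡ s [MOD q] := Nat.mod_modEq _ _
  -- The reduced sides agree modulo `q`. Both reduced sums lie between 0 and `n * (q - 1)`, so
  -- adding `n * q` on the left makes the quotient nonnegative and at most `2 * n`.
  have h3 : s % q + ∑ i ∈ M₂, extend a i % q ≡ ∑ i ∈ M₁, extend a i % q + n * q [MOD q] := by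
    have h4 := (hs.add h2).trans (hsol.2 ▸ h1).symm
    refine h4.trans ?_
    simp [Nat.ModEq]
  obtain ⟨V₁, hV₁⟩ : ∃ V, V = ∑ i ∈ M₁, extend a i % q := ⟨_, rfl⟩
  obtain ⟨V₂, hV₂⟩ : ∃ V, V = s % q + ∑ i ∈ M₂, extend a i % q := ⟨_, rfl⟩
  rw [← hV₁, ← hV₂] at h3 ⊢
  rw [← hV₁] at b1
  have hlt : s % q < q := Nat.mod_lt _ hq
  have e1 : n * q = n * (q - 1) + n := by
    rw [← Nat.mul_succ, Nat.succ_eq_add_one, Nat.sub_add_cancel hq]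
  have hle : V₂ ≤ V₁ + n * q := by
    by_contra hcon
    obtain ⟨c, hc⟩ := (Nat.modEq_iff_dvd' (by omega)).1 h3.symm
    have : c ≠ 0 := by rintro rfl; omega
    have : q * 1 ≤ q * c := Nat.mul_le_mul_left _ (by omega)
    omega
  obtain ⟨j, hj⟩ := (Nat.modEq_iff_dvd' hle).1 h3
  refine ⟨j, ?_, by rw [mul_comm j]; omega⟩
  by_contra hcon
  have h5 : q * (2 * n + 1) ≤ q * j := Nat.mul_le_mul_left _ (by omega)
  have h6 : q * (2 * n + 1) = 2 * (n * q) + q := by ring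
  omega

end

/-! ### The residue search -/

section
variable {n : ℕ} {a : Fin n → ℕ} {s : ℕ} {M₁ M₂ X : Finset (Fin n)}

/-- The sum of the reduced items of a set. -/
def redSum (a : Fin n → ℕ) (q : ℕ) (S : Finset (Fin n)) : ℕ := ∑ i ∈ S, extend a i % q

/-- The intended match is `M₁ ∪ X` in the first list with `M₂ ∪ X` in the second. The danger is that
the dictionary holds `M₂ ∪ X` itself under the required key, which would produce two equal sets.
This forces `s = 0`, and then exchanging the roles of the two sides helps. -/
theorem good_of_residue {q e xp xk j c p j₀ : ℕ} (hq : 0 < q) (hgood : GoodMod a s q)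
    (hsol : IsSolution a s M₁ M₂) (hX₁ : Disjoint M₁ X) (hX₂ : Disjoint M₂ X)
    (hp : p = 1 + xp % 2 ^ e) (hk : xk % p = redSum a q (M₂ ∪ X) % p)
    (hj : redSum a q M₁ + n * q = s % q + redSum a q M₂ + j₀ * q) (hj₀ : j % (2 * n + 1) = j₀) :
    (mkSearch n q (s % q) (fun i => extend a i % q) 1 e xp xk j c).Good := by
  obtain ⟨k₁, hk₁⟩ : ∃ k₁, k₁ = (xk % p + s % q + (j₀ + n * (p - 1)) * q) % p := ⟨_, rfl⟩
  obtain ⟨A, hA⟩ : ∃ A : Search, A = ⟨n, p, q, s % q, n, 1, k₁, xk % p,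
    fun i => extend a i % q⟩ := ⟨_, rfl⟩
  have hmk : mkSearch n q (s % q) (fun i => extend a i % q) 1 e xp xk j c = A := by
    rw [mkSearch_one, hA, hk₁, hj₀, hp, Nat.add_sub_cancel_left]
  rw [hmk]
  have hAn : A.n = n := by rw [hA]
  have hk₁' : k₁ = redSum a q (M₁ ∪ X) % p := by
    have u1 : redSum a q (M₁ ∪ X) = redSum a q M₁ + redSum a q X := Finset.sum_union hX₁
    have u2 : redSum a q (M₂ ∪ X) = redSum a q M₂ + redSum a q X := Finset.sum_union hX₂
    -- The equation `hj` contains `-n * q`, which modulo `p` is replaced by `n * (p - 1) * q`.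
    have h1 : redSum a q (M₂ ∪ X) + s % q + (j₀ + n * (p - 1)) * q =
        redSum a q (M₁ ∪ X) + p * (n * q) := by
      obtain ⟨p', rfl⟩ : ∃ p', p = p' + 1 := ⟨p - 1, by omega⟩
      rw [u1, u2, Nat.add_sub_cancel]
      linarith
    rw [hk₁, hk, add_assoc, Nat.mod_add_mod, ← add_assoc, h1, Nat.add_mul_mod_self_left]
  have adm₁ : ∀ S : Finset (Fin n), A.P₁.Adm (mark 1 S) n := by
    intro S i hi
    have h1 := mark_coe 1 S ⟨i, hi⟩
    have h2 := (A.P₁.act_eq_one_iff i).2 ⟨Nat.zero_le _, by rw [hA]; exact hi⟩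
    dsimp only at h1
    rw [h1, h2]
    split_ifs
    · exact Or.inr ⟨one_ne_zero, Or.inl ⟨rfl, one_ne_zero⟩⟩
    · exact Or.inl rfl
  have adm₂ : ∀ S : Finset (Fin n), A.P₂.Adm (mark 2 S) n := by
    intro S i hi
    have h1 := mark_coe 2 S ⟨i, hi⟩
    have h2 := (A.P₂.act_eq_one_iff i).2 ⟨by rw [hA]; simp [Search.P₂], by rw [hA]; exact hi⟩
    dsimp only at h1
    rw [h1, h2]
    split_ifs
    · exact Or.inr ⟨one_ne_zero, Or.inr ⟨rfl, one_ne_zero⟩⟩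
    · exact Or.inl rfl
  have res₁ : ∀ S : Finset (Fin n), A.P₁.resOf (mark 1 S) n = redSum a q S % p := fun S => by
    rw [resOf_mark _ (by rw [hA]; rfl) (by rw [hA]; rfl) one_ne_zero, hA]
    rfl
  have res₂ : ∀ S : Finset (Fin n), A.P₂.resOf (mark 2 S) n = redSum a q S % p := fun S => by
    rw [resOf_mark _ (by rw [hA]; rfl) (by rw [hA]; rfl) two_ne_zero, hA]
    rfl
  have hq₁ : A.P₁.q = q := by rw [hA]; rfl
  have hq₂ : A.P₂.q = q := by rw [hA]; rfl
  have hb₁ : ∀ i < n, A.P₁.b i = extend a i % q := fun i _ => by rw [hA]; rfl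
  have hb₂ : ∀ i < n, A.P₂.b i = extend a i % q := fun i _ => by rw [hA]; rfl
  have key₁ : ∀ S : Finset (Fin n), ((A.P₁.keyOf (mark 1 S) n : ℕ) : ZMod q) =
      (∑ i ∈ S, a i : ℕ) := fun S => by
    rw [keyOf_mark A.P₁ hq hq₁ 1 S hb₁]
    simp [sgn]
  have part : ∀ S : Finset (Fin n), ((A.partner (mark 2 S) : ℕ) : ZMod q) =
      ((s + ∑ i ∈ S, a i : ℕ) : ZMod q) := fun S => by
    have h1 := keyOf_mark A.P₂ hq hq₂ 2 S hb₂
    have h2 := keyOf_lt' A.P₂ (by omega) (mark 2 S) n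
    have hAq : A.q = q := by rw [hA]
    have hAs : A.s = s % q := by rw [hA]
    rw [Search.partner, hAq, hAn, ZMod.natCast_mod, hAs, Nat.cast_add, ZMod.natCast_mod,
      Nat.cast_sub (by omega), h1]
    simp [sgn]
  have key_eq : ∀ S S' : Finset (Fin n), ∑ i ∈ S, a i ≡ s + ∑ i ∈ S', a i [MOD q] →
      A.P₁.keyOf (mark 1 S) n = A.partner (mark 2 S') := fun S S' h => by
    have h1 := (ZMod.natCast_eq_natCast_iff _ _ _).2 h
    rw [← key₁, ← part] at h1
    refine ((ZMod.natCast_eq_natCast_iff _ _ _).1 h1).eq_of_lt_of_lt ?_ ?_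
    · have := keyOf_lt' A.P₁ (by omega) (mark 1 S) n
      omega
    · have hAq : A.q = q := by rw [hA]
      rw [Search.partner, hAq]
      exact Nat.mod_lt _ hq
  have hfull₁ : ∀ S : Finset (Fin n), redSum a q S % p = k₁ → A.P₁.Full (mark 1 S) :=
    fun S h => by
      refine ⟨?_, ?_⟩
      · rw [hA] at adm₁ ⊢; exact adm₁ S
      · have := (res₁ S).trans h
        rw [hA] at this ⊢
        exact this
  have hfull₂ : ∀ S : Finset (Fin n), redSum a q S % p = xk % p → A.P₂.Full (mark 2 S) :=
    fun S h => by
      refine ⟨?_, ?_⟩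
      · rw [hA] at adm₂ ⊢; exact adm₂ S
      · have := (res₂ S).trans h
        rw [hA] at this ⊢
        exact this
  have hsum : ∑ i ∈ M₁ ∪ X, a i = s + ∑ i ∈ M₂ ∪ X, a i := by
    rw [Finset.sum_union hX₁, Finset.sum_union hX₂, hsol.2, add_assoc]
  intro F hF
  rw [hAn] at hF
  have hkey := key_eq (M₁ ∪ X) (M₂ ∪ X) (by rw [hsum])
  by_cases hd : Differ n (F (A.partner (mark 2 (M₂ ∪ X)))) (mark 2 (M₂ ∪ X))
  · exact ⟨mark 2 (M₂ ∪ X), hfull₂ _ hk.symm, ⟨mark 1 (M₁ ∪ X), hfull₁ _ hk₁'.symm, by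
      rw [hAn]; exact hkey⟩, by rw [hAn]; exact hd⟩
  · obtain ⟨f, hf⟩ : ∃ f, f = F (A.partner (mark 2 (M₂ ∪ X))) := ⟨_, rfl⟩
    have hFf := hF _ (hfull₁ _ hk₁'.symm)
    rw [hkey, ← hf] at hFf
    rw [← hf] at hd
    -- In this case the stored digits `f` mark exactly the set `M₂ ∪ X`.
    have hfm : ∀ i < n, f i = mark 1 (M₂ ∪ X) i := by
      intro i hi
      by_contra hne
      refine hd ⟨i, hi, fun he => hne ?_⟩
      have h1 := hFf.1.1 i (by rw [hA]; exact hi)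
      have h2 : A.P₁.f2 = 0 := by rw [hA]; rfl
      have h3 := mark_coe 1 (M₂ ∪ X) ⟨i, hi⟩
      have h4 := mark_coe 2 (M₂ ∪ X) ⟨i, hi⟩
      dsimp only at h3 h4
      unfold out1 out2 at he
      rw [h4] at he
      rw [h3]
      rw [h2] at h1
      split_ifs at he ⊢ <;> omega
    -- The set `M₂ ∪ X` then matches itself modulo `q`, and `GoodMod` makes this an equality of
    -- integers.
    have hs0 : s = 0 := by
      have h1 : ((∑ i ∈ M₂ ∪ X, a i : ℕ) : ZMod q) = ((1 * s + ∑ i ∈ M₂ ∪ X, a i : ℕ) : ZMod q) := by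
        rw [← key₁, one_mul, ← part, ← hFf.2, keyOf_congr _ hfm]
      have := hgood 1 le_rfl _ _ ((ZMod.natCast_eq_natCast_iff _ _ _).1 h1)
      omega
    have hres : redSum a q (M₂ ∪ X) % p = k₁ := by
      have h1 := hFf.1.2
      have h2 : A.P₁.n = n := by rw [hA]; rfl
      have h3 : A.P₁.k = k₁ := by rw [hA]; rfl
      rw [h2, h3, resOf_congr _ hfm, res₁] at h1
      exact h1
    -- With `s = 0` the sets `M₁ ∪ X` and `M₂ ∪ X` have equal sums. So `M₁ ∪ X`, taken from the
    -- second list, asks for the same key and meets the different set `M₂ ∪ X`; by `hres` both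
    -- targets are the same residue, hence it is in the second list.
    have hpart : A.partner (mark 2 (M₁ ∪ X)) = A.partner (mark 2 (M₂ ∪ X)) := by
      rw [← hkey]
      exact (key_eq _ _ (by rw [hs0, zero_add])).symm
    refine ⟨mark 2 (M₁ ∪ X), hfull₂ _ (by rw [← hk₁', ← hres, hk]), ⟨mark 1 (M₁ ∪ X),
      hfull₁ _ hk₁'.symm, ?_⟩, ?_⟩
    · rw [hAn, hpart]
      exact hkey
    · rw [hAn, hpart, ← hf]
      have hne : M₂ ∪ X ≠ M₁ ∪ X := by
        intro he
        apply hsol.1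
        ext i
        have h1 : i ∈ M₂ ∪ X ↔ i ∈ M₁ ∪ X := by rw [he]
        rw [Finset.mem_union, Finset.mem_union] at h1
        have h2 : i ∈ M₁ → i ∉ X := fun h => Finset.disjoint_left.1 hX₁ h
        have h3 : i ∈ M₂ → i ∉ X := fun h => Finset.disjoint_left.1 hX₂ h
        tauto
      by_contra hcon
      apply hne
      ext i
      by_contra hi
      refine hcon ⟨i, i.2, ?_⟩
      unfold out1 out2
      rw [hfm i i.2, mark_coe, mark_coe]
      split_ifs <;> simp_all

end

theorem treeSize_le_of_count {P : Par} {n g : ℕ} (hn : 0 < n)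
    (h : P.count n 0 ≤ 584 * n ^ 2 * 2 ^ g) : P.treeSize n 0 ≤ 2000 * n * n * n * 2 ^ g := by
  refine (P.treeSize_le n 0).trans ?_
  calc (n + 1) * P.count n 0 ≤ (2 * n) * (584 * n ^ 2 * 2 ^ g) := Nat.mul_le_mul (by omega) h
    _ = 1168 * (n ^ 3 * 2 ^ g) := by ring
    _ ≤ 2000 * (n ^ 3 * 2 ^ g) := Nat.mul_le_mul_right _ (by norm_num)
    _ = _ := by ring

/-- Many targets are residues and have few completions. -/
theorem frac_target {n e g p T c : ℕ} {I : Finset ℕ} {C₁ C₂ : ℕ → ℕ} (hn : 0 < n)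
    (hp : 0 < p) (hpe : p ≤ 2 ^ e) (heg : e + g = n) (hT : T = 584 * n ^ 2 * 2 ^ g)
    (hIp : ∀ x ∈ I, x < p) (hI : 2 ^ e ≤ 138 * n ^ 2 * I.card)
    (h₁ : ((Finset.range p).filter fun k => T < C₁ k).card * T ≤ 2 ^ n)
    (h₂ : ((Finset.range p).filter fun k => T < C₂ k).card * T ≤ 2 ^ n) :
    Frac p (1 / (292 * n ^ 2)) fun k => k ∈ I ∧ C₁ ((k + c) % p) ≤ T ∧ C₂ k ≤ T := by
  obtain ⟨B₁, hB₁⟩ : ∃ B, B = (Finset.range p).filter fun k => T < C₁ k := ⟨_, rfl⟩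
  obtain ⟨B₂, hB₂⟩ : ∃ B, B = (Finset.range p).filter fun k => T < C₂ k := ⟨_, rfl⟩
  obtain ⟨B₃, hB₃⟩ : ∃ B, B = (Finset.range p).filter fun k => T < C₁ ((k + c) % p) := ⟨_, rfl⟩
  rw [← hB₁] at h₁
  rw [← hB₂] at h₂
  have h31 : B₃.card ≤ B₁.card := by
    refine Finset.card_le_card_of_injOn (fun k => (k + c) % p) ?_ ?_
    · intro k hk
      simp only [hB₃, hB₁, Finset.coe_filter, Finset.mem_range, Set.mem_ofPred_eq] at hk ⊢
      exact ⟨Nat.mod_lt _ hp, hk.2⟩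
    · intro x hx y hy hxy
      simp only [hB₃, Finset.coe_filter, Finset.mem_range, Set.mem_ofPred_eq] at hx hy
      have : x ≡ y [MOD p] := Nat.ModEq.add_right_cancel' c hxy
      exact this.eq_of_lt_of_lt hx.1 hy.1
  -- At most `2 ^ e / (584 * n ^ 2)` targets are bad for either list. Removing both kinds from the
  -- at least `2 ^ e / (138 * n ^ 2)` residues in `I` leaves `2 ^ e / (292 * n ^ 2)`, because 1/138
  -- exceeds 2/292.
  have hsmall : ∀ B : ℕ, B * T ≤ 2 ^ n → 584 * n ^ 2 * B ≤ 2 ^ e := by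
    intro B hB
    rw [← heg, pow_add, hT] at hB
    have : 584 * n ^ 2 * B * 2 ^ g ≤ 2 ^ e * 2 ^ g := le_trans (le_of_eq (by ring)) hB
    exact Nat.le_of_mul_le_mul_right this (by positivity)
  have s1 := hsmall _ h₁
  have s2 := hsmall _ h₂
  refine Frac.of_card ((I \ B₃) \ B₂) ?_ ?_
  · intro x hx
    rw [Finset.mem_sdiff, Finset.mem_sdiff] at hx
    have hxp := hIp x hx.1.1
    refine ⟨hxp, hx.1.1, ?_, ?_⟩
    · by_contra hc
      exact hx.1.2 (by rw [hB₃]; simp [hxp, not_le.1 hc])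
    · by_contra hc
      exact hx.2 (by rw [hB₂]; simp [hxp, not_le.1 hc])
  · have c1 := Finset.le_card_sdiff B₃ I
    have c2 := Finset.le_card_sdiff B₂ (I \ B₃)
    have c3 : I.card ≤ ((I \ B₃) \ B₂).card + B₁.card + B₂.card := by omega
    have c4 := Nat.mul_le_mul_left (292 * n ^ 2) c3
    have c5 : 292 * n ^ 2 * (((I \ B₃) \ B₂).card + B₁.card + B₂.card) =
        292 * n ^ 2 * ((I \ B₃) \ B₂).card + 292 * n ^ 2 * B₁.card + 292 * n ^ 2 * B₂.card := by
      ring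
    have c6 : 584 * n ^ 2 * B₁.card = 2 * (292 * n ^ 2 * B₁.card) := by ring
    have c7 : 584 * n ^ 2 * B₂.card = 2 * (292 * n ^ 2 * B₂.card) := by ring
    have c8 : 292 * n ^ 2 * I.card = 2 * (138 * n ^ 2 * I.card) + 16 * n ^ 2 * I.card := by ring
    have c9 : p ≤ 292 * n ^ 2 * ((I \ B₃) \ B₂).card := by omega
    have c9' : (p : ℝ) ≤ 292 * n ^ 2 * ((I \ B₃) \ B₂).card := by exact_mod_cast c9
    have hn' : (0 : ℝ) < n := by exact_mod_cast hn
    rw [div_mul_eq_mul_div, one_mul, div_le_iff₀ (by positivity)]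
    linarith

/-- The residue search succeeds for many choices. -/
theorem frac_residue {n e g q s : ℕ} {a : Fin n → ℕ} {M₁ M₂ : Finset (Fin n)} (hn : 0 < n)
    (hmax : IsMaxPair a s M₁ M₂) (hq : 0 < q) (hqle : q ≤ 2 ^ (16 * n)) (hgood : GoodMod a s q)
    (heg : e + g = n) (he : e + (M₁.card + M₂.card) ≤ n) :
    ∃ j₀ < 2 * n + 1, Frac (2 ^ (16 * n)) (1 / (16 * n)) fun x₁ =>
      Frac (2 ^ (16 * n)) (1 / (584 * n ^ 2)) fun x₂ => ∀ j c, j % (2 * n + 1) = j₀ →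
        (mkSearch n q (s % q) (fun i => extend a i % q) 1 e x₁ x₂ j c).P₁.treeSize n 0 ≤
          2000 * n * n * n * 2 ^ g ∧
        (mkSearch n q (s % q) (fun i => extend a i % q) 1 e x₁ x₂ j c).P₂.treeSize n 0 ≤
          2000 * n * n * n * 2 ^ g ∧
        (mkSearch n q (s % q) (fun i => extend a i % q) 1 e x₁ x₂ j c).Good := by
  obtain ⟨j₀, hj₀, hj⟩ := exists_shift hq hmax.sol
  refine ⟨j₀, hj₀, ?_⟩
  have hn' : (0 : ℝ) < n := by exact_mod_cast hn
  obtain ⟨Y, hY, hYc⟩ : ∃ Y ⊆ (M₁ ∪ M₂)ᶜ, Y.card = e := by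
    refine Finset.exists_subset_card_eq ?_
    rw [Finset.card_compl, Finset.card_union_of_disjoint hmax.disj, Fintype.card_fin]
    omega
  have hY₁ : Disjoint M₁ Y := by
    rw [Finset.disjoint_right]
    intro i hi h
    simpa [h] using hY hi
  have hY₂ : Disjoint M₂ Y := by
    rw [Finset.disjoint_right]
    intro i hi h
    simpa [h] using hY hi
  have hsub : ∀ X ∈ Y.powerset, Disjoint M₁ X ∧ Disjoint M₂ X := fun X hX =>
    ⟨hY₁.mono_right (Finset.mem_powerset.1 hX), hY₂.mono_right (Finset.mem_powerset.1 hX)⟩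
  -- Reduction modulo `q` keeps the sums distinct; this is the reason for the case `t = 0` in
  -- `GoodMod`.
  have hinj : Set.InjOn (fun X => redSum a q (M₂ ∪ X)) (Y.powerset : Set _) := by
    intro X hX X' hX' heq
    refine hmax.sum_injOn hY₁ hY₂ hX hX' ?_
    have h1 := sum_mod_modEq (a := a) q (M₂ ∪ X)
    have h2 := sum_mod_modEq (a := a) q (M₂ ∪ X')
    dsimp only [redSum] at heq ⊢
    rw [heq] at h1
    have h3 := hgood 0 (by omega) _ _ (by simpa using h1.symm.trans h2)
    rw [Finset.sum_union (hsub X hX).2, Finset.sum_union (hsub X' hX').2] at h3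
    omega
  have hD : ∀ X ∈ Y.powerset, redSum a q (M₂ ∪ X) < 2 ^ (17 * n) := by
    intro X _
    refine (sum_mod_le hq _).trans_lt ?_
    calc n * (q - 1) ≤ n * 2 ^ (16 * n) := Nat.mul_le_mul_left _ (by omega)
      _ < 2 ^ n * 2 ^ (16 * n) := Nat.mul_lt_mul_of_pos_right n.lt_two_pow_self (by positivity)
      _ = _ := by rw [← pow_add]; congr 1; ring
  have key := (frac_prime (e := e) hn (by omega) (by rw [Finset.card_powerset, hYc]) hinj hD).of_mod
    (M := 2 ^ (16 * n)) (by positivity) (Nat.pow_le_pow_right two_pos (by omega)) (by positivity)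
  refine key.mono (le_of_eq (by rw [div_div]; ring)) fun x₁ _ hx₁ => ?_
  obtain ⟨p, hp⟩ : ∃ p, p = 1 + x₁ % 2 ^ e := ⟨_, rfl⟩
  have hpe : p ≤ 2 ^ e := by
    have : x₁ % 2 ^ e < 2 ^ e := Nat.mod_lt _ (by positivity)
    omega
  rw [← hp] at hx₁
  have hp0 : 0 < p := by omega
  obtain ⟨P₁, hP₁⟩ : ∃ P₁ : Par, P₁ = ⟨n, p, q, 1, 0, 0, n, 1, 0, 0, fun i => extend a i % q⟩ :=
    ⟨_, rfl⟩
  obtain ⟨P₂, hP₂⟩ : ∃ P₂ : Par, P₂ = ⟨n, p, q, 1, 0, 0, n, 0, 1, 0, fun i => extend a i % q⟩ :=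
    ⟨_, rfl⟩
  obtain ⟨T, hT⟩ : ∃ T, T = 584 * n ^ 2 * 2 ^ g := ⟨_, rfl⟩
  have c1 := P₁.card_large_count (by rw [hP₁]; exact le_rfl) T
  have c2 := P₂.card_large_count (by rw [hP₂]; exact le_rfl) T
  have n1 : P₁.n = n := by rw [hP₁]
  have n2 : P₂.n = n := by rw [hP₂]
  have p1 : P₁.p = p := by rw [hP₁]
  have p2 : P₂.p = p := by rw [hP₂]
  rw [n1, p1] at c1
  rw [n2, p2] at c2
  -- The target of the first list is that of the second, shifted by a constant modulo `p`. One
  -- random residue therefore controls both lists.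
  have fr := (frac_target (c := s % q + (j₀ + n * (p - 1)) * q) hn hp0 hpe heg hT (fun x hx => by
    obtain ⟨X, -, rfl⟩ := Finset.mem_image.1 hx
    exact Nat.mod_lt _ hp0) hx₁ c1 c2).of_mod (M := 2 ^ (16 * n)) hp0
      (hpe.trans (Nat.pow_le_pow_right two_pos (by omega))) (by positivity)
  refine fr.mono (le_of_eq (by rw [div_div]; ring)) fun x₂ _ ⟨h1, h2, h3⟩ j c hjc => ?_
  have e1 : (mkSearch n q (s % q) (fun i => extend a i % q) 1 e x₁ x₂ j c).P₁ =
      P₁.withK ((x₂ % p + (s % q + (j₀ + n * (p - 1)) * q)) % p) := by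
    rw [mkSearch_one, hP₁, ← hp, hjc, ← add_assoc, hp, Nat.add_sub_cancel_left]
    rfl
  have e2 : (mkSearch n q (s % q) (fun i => extend a i % q) 1 e x₁ x₂ j c).P₂ =
      P₂.withK (x₂ % p) := by
    rw [mkSearch_one, hP₂, ← hp]
    simp [Search.P₂, Par.withK]
  obtain ⟨X, hX, hXk⟩ := Finset.mem_image.1 h1
  refine ⟨treeSize_le_of_count hn ?_, treeSize_le_of_count hn ?_, ?_⟩
  · rw [e1, ← hT]
    exact h2
  · rw [e2, ← hT]
    exact h3
  · exact good_of_residue hq hgood hmax.sol (hsub X hX).1 (hsub X hX).2 hp hXk.symm hj hjc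

/-! ### The split search -/

theorem mkSearch_zero (n q s : ℕ) (b : ℕ → ℕ) (e xp xk j c : ℕ) :
    mkSearch n q s b 0 e xp xk j c =
      ⟨n, n + 1, q, s, c, 0, j % (n + 1), xk % (n + 1), b⟩ := by
  simp [mkSearch]

/-- The number of active items among the last `u` ones. -/
def Par.actives (P : Par) : ℕ → ℕ
  | 0 => 0
  | u + 1 => P.actives u + P.act (P.n - (u + 1))

/-- With `al = 0` and `be = 1` the residue counts the nonzero digits, and modulo `n + 1` it never
wraps around as long as `r + u ≤ n`. The recursion of `count` is then Pascal's rule, with a factor 2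
for each nonzero digit. -/
theorem Par.count_le_choose (P : Par) (hp : P.p = P.n + 1) (hal : P.al = 0) (hbe : P.be = 1)
    (hf : P.f1 + P.f2 = 2) (u r : ℕ) (hr : r + u ≤ P.n) :
    P.count u r ≤ if r ≤ P.k then (P.actives u).choose (P.k - r) * 2 ^ (P.k - r) else 0 := by
  induction u generalizing r with
  | zero =>
    simp only [Par.count, Par.actives]
    split_ifs with h
    · rcases Nat.eq_zero_or_pos (P.k - r) with h0 | h0
      · simp [h0]
      · simp only [Nat.choose_eq_zero_of_lt h0]
        omega
    · omega
  | succ u ih =>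
    have h1 := ih r (by omega)
    have h2 := ih (r + 1) (by omega)
    have hstep : P.step (P.n - (u + 1)) r = r + 1 := by
      rw [Par.step, hal, hbe, mul_zero, zero_add, hp, Nat.mod_eq_of_lt (by omega)]
    have hact := P.act_le_one (P.n - (u + 1))
    simp only [Par.count, Par.actives, hstep, hf]
    rcases Nat.le_one_iff_eq_zero_or_eq_one.1 hact with h0 | h0
    · rw [h0]
      simpa using h1
    · rw [h0, one_mul]
      split_ifs at h1 h2 ⊢ with h3 h4
      · obtain ⟨t, ht⟩ : ∃ t, P.k - r = t + 1 := ⟨P.k - r - 1, by omega⟩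
        rw [show P.k - (r + 1) = t by omega] at h2
        rw [ht] at h1 ⊢
        rw [Nat.choose_succ_succ, pow_succ] at *
        nlinarith
      · have : P.k - r = 0 := by omega
        rw [this] at h1 ⊢
        simp only [Nat.choose_zero_right] at h1 ⊢
        omega
      · omega
      · omega

theorem Par.actives_eq (P : Par) (hlo : P.lo ≤ P.hi) (hhi : P.hi ≤ P.n) (u : ℕ) (hu : u ≤ P.n) :
    P.actives u = min u (P.n - P.lo) - min u (P.n - P.hi) := by
  induction u with
  | zero => simp [Par.actives]
  | succ u ih =>
    rw [Par.actives, ih (by omega)]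
    have h1 := P.act_eq_one_iff (P.n - (u + 1))
    have h2 := P.act_le_one (P.n - (u + 1))
    omega

/-- A split of a set such that both parts can be enumerated quickly. -/
theorem exists_split {n m V : ℕ} (hn : 0 < n) (κ : ℕ → ℕ) (h0 : κ 0 = 0)
    (hs : ∀ c < n, κ (c + 1) = κ c ∨ κ (c + 1) = κ c + 1) (hm : κ n = m)
    (hV : n.choose m * 2 ^ m ≤ V * V) :
    ∃ c ≤ n, c.choose (κ c) * 2 ^ κ c ≤ 2 * n * V ∧
      (n - c).choose (m - κ c) * 2 ^ (m - κ c) ≤ 2 * n * V := by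
  have hmono : ∀ c d, c + d ≤ n → κ c ≤ κ (c + d) := by
    intro c d
    induction d with
    | zero => intro _; exact le_rfl
    | succ d ih =>
      intro h
      have h1 := ih (by omega)
      have h2 := hs (c + d) (by omega)
      rw [← add_assoc]
      omega
  have hle : ∀ c ≤ n, κ c ≤ c := by
    intro c hc
    induction c with
    | zero => omega
    | succ c ih =>
      have := ih (by omega)
      have := hs c (by omega)
      omega
  have hmn : m ≤ n := hm ▸ hle n le_rfl
  have hV0 : 0 < V := by
    have : 0 < n.choose m * 2 ^ m := Nat.mul_pos (Nat.choose_pos hmn) (by positivity)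
    rcases Nat.eq_zero_or_pos V with rfl | h
    · omega
    · exact h
  have hVV : V ≤ 2 * n * V := Nat.le_mul_of_pos_left _ (by omega)
  by_cases hex : ∃ c, c ≤ n ∧ V < c.choose (κ c) * 2 ^ κ c
  · classical
    -- The cut is the first position where the number of signed sets on the left exceeds `V`. One
    -- position earlier it is at most `V`, and a single item multiplies it by at most `2 * n`.
    obtain ⟨hc, hcV⟩ := Nat.find_spec hex
    obtain ⟨c, hcd⟩ : ∃ c, c = Nat.find hex := ⟨_, rfl⟩
    have hmin : ∀ d < c, ¬ (d ≤ n ∧ V < d.choose (κ d) * 2 ^ κ d) := fun d hd =>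
      Nat.find_min hex (hcd ▸ hd)
    rw [← hcd] at hc hcV
    refine ⟨c, hc, ?_, ?_⟩
    · rcases Nat.eq_zero_or_pos c with rfl | hc0
      · rw [h0] at hcV ⊢
        simp only [Nat.choose_zero_right, pow_zero] at hcV ⊢
        omega
      · obtain ⟨d, rfl⟩ : ∃ d, c = d + 1 := ⟨c - 1, by omega⟩
        have h1 := hmin d (by omega)
        have h2 : d.choose (κ d) * 2 ^ κ d ≤ V := by
          by_contra h
          exact h1 ⟨by omega, not_le.1 h⟩
        have hκd := hle d (by omega)
        have h3 : (d + 1).choose (κ (d + 1)) * 2 ^ κ (d + 1) ≤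
            2 * n * (d.choose (κ d) * 2 ^ κ d) := by
          rcases hs d (by omega) with h4 | h4
          · rw [h4]
            have h5 : (d + 1).choose (κ d) ≤ (d + 1) * d.choose (κ d) := by
              have h6 := Nat.choose_mul_succ_eq d (κ d)
              have h7 : (d + 1).choose (κ d) * 1 ≤ (d + 1).choose (κ d) * (d + 1 - κ d) :=
                Nat.mul_le_mul_left _ (by omega)
              rw [mul_comm (d + 1)]
              omega
            calc (d + 1).choose (κ d) * 2 ^ κ d ≤ (d + 1) * d.choose (κ d) * 2 ^ κ d :=
                  Nat.mul_le_mul_right _ h5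
              _ = (d + 1) * (d.choose (κ d) * 2 ^ κ d) := by ring
              _ ≤ _ := Nat.mul_le_mul_right _ (by omega)
          · rw [h4]
            have h5 : (d + 1).choose (κ d + 1) ≤ (d + 1) * d.choose (κ d) := by
              have h6 := Nat.add_one_mul_choose_eq d (κ d)
              have h7 : (d + 1).choose (κ d + 1) * 1 ≤ (d + 1).choose (κ d + 1) * (κ d + 1) :=
                Nat.mul_le_mul_left _ (by omega)
              omega
            calc (d + 1).choose (κ d + 1) * 2 ^ (κ d + 1) ≤
                  (d + 1) * d.choose (κ d) * 2 ^ (κ d + 1) := Nat.mul_le_mul_right _ h5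
              _ = 2 * (d + 1) * (d.choose (κ d) * 2 ^ κ d) := by ring
              _ ≤ _ := Nat.mul_le_mul_right _ (by omega)
        exact h3.trans (Nat.mul_le_mul_left _ h2)
    · refine le_trans ?_ hVV
      have hκ : κ c ≤ m := by
        have := hmono c (n - c) (by omega)
        rw [Nat.add_sub_cancel' hc, hm] at this
        exact this
      -- A single term of Vandermonde's identity. The product of the numbers on the two sides is
      -- thus at most `V * V`, so the right side is at most `V` when the left side exceeds it.
      have h1 : c.choose (κ c) * (n - c).choose (m - κ c) ≤ n.choose m := by
        have h2 := Nat.add_choose_eq c (n - c) m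
        rw [Nat.add_sub_cancel' hc] at h2
        rw [h2]
        exact Finset.single_le_sum (f := fun ij : ℕ × ℕ => c.choose ij.1 * (n - c).choose ij.2)
          (fun _ _ => Nat.zero_le _) (a := (κ c, m - κ c))
          (by simp [Nat.add_sub_cancel' hκ])
      have h2 : (c.choose (κ c) * 2 ^ κ c) * ((n - c).choose (m - κ c) * 2 ^ (m - κ c)) ≤ V * V := by
        have h3 : (2 : ℕ) ^ m = 2 ^ κ c * 2 ^ (m - κ c) := by
          rw [← pow_add, Nat.add_sub_cancel' hκ]
        refine le_trans ?_ hV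
        rw [h3]
        calc _ = c.choose (κ c) * (n - c).choose (m - κ c) * (2 ^ κ c * 2 ^ (m - κ c)) := by ring
          _ ≤ _ := Nat.mul_le_mul_right _ h1
      by_contra hcon
      have := Nat.mul_lt_mul_of_lt_of_le hcV (not_le.1 hcon).le (by omega)
      omega
  · refine ⟨n, le_rfl, ?_, ?_⟩
    · refine le_trans ?_ hVV
      by_contra h
      exact hex ⟨n, le_rfl, not_le.1 h⟩
    · rw [hm]
      simp
      omega

/-- The digits of a pair of disjoint sets. -/
def digits {n : ℕ} (S₁ S₂ : Finset (Fin n)) (i : ℕ) : ℕ :=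
  if h : i < n then if (⟨i, h⟩ : Fin n) ∈ S₁ then 1 else if (⟨i, h⟩ : Fin n) ∈ S₂ then 2 else 0
  else 0

theorem digits_coe {n : ℕ} (S₁ S₂ : Finset (Fin n)) (i : Fin n) :
    digits S₁ S₂ i = if i ∈ S₁ then 1 else if i ∈ S₂ then 2 else 0 := by
  simp [digits]

section
variable {n : ℕ}

theorem resOf_digits (P : Par) (hal : P.al = 0) (hbe : P.be = 1) (S₁ S₂ : Finset (Fin n)) :
    P.resOf (digits S₁ S₂) n = (S₁ ∪ S₂).card % P.p := by
  rw [P.resOf_eq, Finset.sum_range, Finset.card_eq_sum_ones]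
  congr 1
  have h : ∀ i : Fin n, (if digits S₁ S₂ i = 0 then 0 else P.b i * P.al + P.be) =
      if i ∈ S₁ ∪ S₂ then 1 else 0 := by
    intro i
    rw [digits_coe, hal, hbe]
    split_ifs <;> simp_all
  rw [Finset.sum_congr rfl fun i _ => h i, Finset.sum_ite_mem, Finset.univ_inter]

theorem keyOf_digits (P : Par) {q : ℕ} (hq : 0 < q) (hPq : P.q = q) {S₁ S₂ : Finset (Fin n)}
    (hS : Disjoint S₁ S₂) {a : Fin n → ℕ} (hb : ∀ i < n, P.b i = extend a i % q) :
    ((P.keyOf (digits S₁ S₂) n : ℕ) : ZMod q) = (∑ i ∈ S₁, a i : ℕ) - (∑ i ∈ S₂, a i : ℕ) := by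
  subst hPq
  rw [keyOf_cast P hq _ (extend a) n hb, Finset.sum_range]
  have h : ∀ i : Fin n, (sgn (digits S₁ S₂ i) : ZMod P.q) * extend a i =
      (if i ∈ S₁ then (a i : ZMod P.q) else 0) - if i ∈ S₂ then (a i : ZMod P.q) else 0 := by
    intro i
    have := fun h : i ∈ S₁ => Finset.disjoint_left.1 hS h
    rw [digits_coe]
    split_ifs <;> simp_all [sgn, extend]
  rw [Finset.sum_congr rfl fun i _ => h i, Finset.sum_sub_distrib, Finset.sum_ite_mem,
    Finset.sum_ite_mem, Finset.univ_inter, Finset.univ_inter]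
  push_cast
  rfl

end

/-- The part of a set below `c`. -/
def below {n : ℕ} (c : ℕ) (S : Finset (Fin n)) : Finset (Fin n) := S.filter fun i => i.1 < c

/-- The part of a set from `c` on. -/
def above {n : ℕ} (c : ℕ) (S : Finset (Fin n)) : Finset (Fin n) := S.filter fun i => ¬ i.1 < c

theorem sum_below_add_above {n c : ℕ} (S : Finset (Fin n)) (a : Fin n → ℕ) :
    ∑ i ∈ below c S, a i + ∑ i ∈ above c S, a i = ∑ i ∈ S, a i :=
  Finset.sum_filter_add_sum_filter_not _ _ _

/-- The part of the solution above the cut meets the part below. Whatever first-list entry `f'` is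
stored under that key, its support lies below the cut and that of `g` above, so the two outputs
differ wherever either has a nonzero digit. Only the case that all digits vanish has to be excluded.
-/
theorem good_of_split {n q s e xp xk j c : ℕ} {a : Fin n → ℕ} {M₁ M₂ : Finset (Fin n)}
    (hq : 0 < q) (hsol : IsSolution a s M₁ M₂) (hd : Disjoint M₁ M₂)
    (hk : xk % (n + 1) = (above c (M₁ ∪ M₂)).card) (hj : j % (n + 1) = (below c (M₁ ∪ M₂)).card) :
    (mkSearch n q (s % q) (fun i => extend a i % q) 0 e xp xk j c).Good := by
  obtain ⟨A, hA⟩ : ∃ A : Search, A = ⟨n, n + 1, q, s % q, c, 0, j % (n + 1), xk % (n + 1),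
    fun i => extend a i % q⟩ := ⟨_, rfl⟩
  rw [mkSearch_zero, ← hA]
  have hAn : A.n = n := by rw [hA]
  have hq₁ : A.P₁.q = q := by rw [hA]; rfl
  have hq₂ : A.P₂.q = q := by rw [hA]; rfl
  have hAq : A.q = q := by rw [hA]
  have hb₁ : ∀ i < n, A.P₁.b i = extend a i % q := fun i _ => by rw [hA]; rfl
  have hb₂ : ∀ i < n, A.P₂.b i = extend a i % q := fun i _ => by rw [hA]; rfl
  have db : Disjoint (below c M₁) (below c M₂) :=
    hd.mono (Finset.filter_subset _ _) (Finset.filter_subset _ _)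
  have da : Disjoint (above c M₁) (above c M₂) :=
    hd.mono (Finset.filter_subset _ _) (Finset.filter_subset _ _)
  have ub : below c M₁ ∪ below c M₂ = below c (M₁ ∪ M₂) := (Finset.filter_union _ _ _).symm
  have ua : above c M₁ ∪ above c M₂ = above c (M₁ ∪ M₂) := (Finset.filter_union _ _ _).symm
  have act₁ : ∀ i, A.P₁.act i = 1 ↔ i < c := fun i => by
    rw [A.P₁.act_eq_one_iff, hA]
    simp [Search.P₁]
  have act₂ : ∀ i, A.P₂.act i = 1 ↔ c ≤ i ∧ i < n := fun i => by
    rw [A.P₂.act_eq_one_iff, hA]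
    simp [Search.P₂]
  have f11 : A.P₁.f1 ≠ 0 := by rw [hA]; exact one_ne_zero
  have f12 : A.P₁.f2 ≠ 0 := by rw [hA]; exact one_ne_zero
  have f21 : A.P₂.f1 ≠ 0 := by rw [hA]; exact one_ne_zero
  have f22 : A.P₂.f2 ≠ 0 := by rw [hA]; exact one_ne_zero
  have hcard : ∀ S : Finset (Fin n), S.card % (n + 1) = S.card := fun S =>
    Nat.mod_eq_of_lt (Nat.lt_succ_of_le ((Finset.card_le_univ S).trans (by simp)))
  obtain ⟨f, hf⟩ : ∃ f, f = digits (below c M₁) (below c M₂) := ⟨_, rfl⟩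
  obtain ⟨g, hg⟩ : ∃ g, g = digits (above c M₁) (above c M₂) := ⟨_, rfl⟩
  have fullf : A.P₁.Full f := by
    constructor
    · intro i hi
      have hi' : i < n := by rw [hA] at hi; exact hi
      have h1 := digits_coe (below c M₁) (below c M₂) ⟨i, hi'⟩
      dsimp only at h1
      rw [hf, h1]
      by_cases hic : i < c
      · rw [(act₁ i).2 hic]
        split_ifs
        · exact Or.inr ⟨one_ne_zero, Or.inl ⟨rfl, f11⟩⟩
        · exact Or.inr ⟨one_ne_zero, Or.inr ⟨rfl, f12⟩⟩
        · exact Or.inl rfl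
      · simp [below, hic]
    · have h1 := resOf_digits A.P₁ (by rw [hA]; rfl) (by rw [hA]; rfl) (below c M₁) (below c M₂)
      have h2 : A.P₁.n = n := hAn
      have h3 : A.P₁.k = j % (n + 1) := by rw [hA]; rfl
      have h4 : A.P₁.p = n + 1 := by rw [hA]; rfl
      rw [h2, h3, hf, h1, ub, hj, h4, hcard]
  have fullg : A.P₂.Full g := by
    constructor
    · intro i hi
      have hi' : i < n := by rw [hA] at hi; exact hi
      have h1 := digits_coe (above c M₁) (above c M₂) ⟨i, hi'⟩
      dsimp only at h1
      rw [hg, h1]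
      by_cases hic : i < c
      · simp [above, not_le.2 hic]
      · rw [(act₂ i).2 ⟨not_lt.1 hic, hi'⟩]
        split_ifs
        · exact Or.inr ⟨one_ne_zero, Or.inl ⟨rfl, f21⟩⟩
        · exact Or.inr ⟨one_ne_zero, Or.inr ⟨rfl, f22⟩⟩
        · exact Or.inl rfl
    · have h1 := resOf_digits A.P₂ (by rw [hA]; rfl) (by rw [hA]; rfl) (above c M₁) (above c M₂)
      have h2 : A.P₂.n = n := hAn
      have h3 : A.P₂.k = xk % (n + 1) := by rw [hA]; rfl
      have h4 : A.P₂.p = n + 1 := by rw [hA]; rfl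
      rw [h2, h3, hg, h1, ua, hk, h4, hcard]
  have hkey : A.P₁.keyOf f n = A.partner g := by
    have h1 := keyOf_digits A.P₁ hq hq₁ db hb₁
    have h2 := keyOf_digits A.P₂ hq hq₂ da hb₂
    have h3 := keyOf_lt' A.P₂ (by omega) g n
    have hAs : A.s = s % q := by rw [hA]
    have h4 : ((A.partner g : ℕ) : ZMod q) = (A.P₁.keyOf f n : ℕ) := by
      rw [Search.partner, hAq, hAn, ZMod.natCast_mod, hAs, Nat.cast_add, ZMod.natCast_mod,
        Nat.cast_sub (by omega), hf, hg, h1, h2, ZMod.natCast_self]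
      have h5 : ((∑ i ∈ M₁, a i : ℕ) : ZMod q) = ((s + ∑ i ∈ M₂, a i : ℕ) : ZMod q) := by
        rw [hsol.2]
      rw [← sum_below_add_above (c := c) M₁, ← sum_below_add_above (c := c) M₂] at h5
      simp only [Nat.cast_add] at h5
      linear_combination -h5
    refine ((ZMod.natCast_eq_natCast_iff _ _ _).1 h4.symm).eq_of_lt_of_lt ?_ ?_
    · have := keyOf_lt' A.P₁ (by omega) f n
      omega
    · rw [Search.partner, hAq]
      exact Nat.mod_lt _ hq
  intro F hF
  refine ⟨g, fullg, ⟨f, fullf, by rw [hAn]; exact hkey⟩, ?_⟩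
  have hF' := (hF f fullf).1
  rw [hAn, hkey] at hF'
  rw [hAn]
  obtain ⟨f', hf'⟩ : ∃ f', f' = F (A.partner g) := ⟨_, rfl⟩
  rw [← hf'] at hF' ⊢
  have hf'0 : ∀ i < n, ¬ i < c → f' i = 0 := by
    intro i hi hic
    rcases hF'.1 i (by rw [hA]; exact hi) with h | ⟨h, -⟩
    · exact h
    · exact absurd ((act₁ i).1 (by have := A.P₁.act_le_one i; omega)) hic
  by_cases hne : (above c (M₁ ∪ M₂)).Nonempty
  · obtain ⟨i, hi⟩ := hne
    have hic : ¬ i.1 < c := (Finset.mem_filter.1 hi).2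
    have hiM := Finset.mem_union.1 (Finset.mem_filter.1 hi).1
    refine ⟨i, i.2, ?_⟩
    unfold out1 out2
    rw [hf'0 i i.2 hic, hg, digits_coe]
    by_cases h1 : i ∈ M₁
    · simp [above, h1, not_lt.1 hic]
    · simp [above, h1, not_lt.1 hic, hiM.resolve_left h1]
  · have hpos : 0 < (below c (M₁ ∪ M₂)).card := by
      rw [Finset.card_pos]
      by_contra hb
      have h1 : (M₁ ∪ M₂) = ∅ := by
        rw [Finset.eq_empty_iff_forall_notMem]
        intro i hi
        by_cases hic : i.1 < c
        · exact hb ⟨i, Finset.mem_filter.2 ⟨hi, hic⟩⟩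
        · exact hne ⟨i, Finset.mem_filter.2 ⟨hi, hic⟩⟩
      rw [Finset.union_eq_empty] at h1
      exact hsol.1 (h1.1.trans h1.2.symm)
    have hres : A.P₁.resOf f' n ≠ 0 := by
      have h2 : A.P₁.n = n := hAn
      have h3 : A.P₁.k = j % (n + 1) := by rw [hA]; rfl
      have h4 := hF'.2
      rw [h2, h3, hj] at h4
      omega
    obtain ⟨i, hi, hfi⟩ : ∃ i < n, f' i ≠ 0 := by
      by_contra hcon
      push Not at hcon
      refine hres ?_
      rw [A.P₁.resOf_eq, Finset.sum_eq_zero, Nat.zero_mod]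
      intro i hi
      rw [if_pos (hcon i (Finset.mem_range.1 hi))]
    have hic : i < c := by
      by_contra hic
      exact hfi (hf'0 i hi hic)
    have hgi : g i = 0 := by
      have h1 := digits_coe (above c M₁) (above c M₂) ⟨i, hi⟩
      dsimp only at h1
      rw [hg, h1]
      simp [above, not_le.2 hic]
    refine ⟨i, hi, ?_⟩
    have := hF'.1 i (by rw [hA]; exact hi)
    unfold out1 out2
    omega

/-- The split search succeeds for a suitable split. -/
theorem exists_split_search {n g s : ℕ} {a : Fin n → ℕ} {M₁ M₂ : Finset (Fin n)} (hn : 0 < n)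
    (hsol : IsSolution a s M₁ M₂) (hd : Disjoint M₁ M₂)
    (hW : n.choose (M₁.card + M₂.card) * 2 ^ (M₁.card + M₂.card) ≤ 2 ^ g * 2 ^ g) :
    ∃ c < n + 1, ∃ k₁ < n + 1, ∃ k₂ < n + 1, ∀ q e xp xk j, 0 < q → xk % (n + 1) = k₂ →
      j % (n + 1) = k₁ →
        (mkSearch n q (s % q) (fun i => extend a i % q) 0 e xp xk j c).P₁.treeSize n 0 ≤
          2000 * n * n * n * 2 ^ g ∧
        (mkSearch n q (s % q) (fun i => extend a i % q) 0 e xp xk j c).P₂.treeSize n 0 ≤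
          2000 * n * n * n * 2 ^ g ∧
        (mkSearch n q (s % q) (fun i => extend a i % q) 0 e xp xk j c).Good := by
  have hm : (M₁ ∪ M₂).card = M₁.card + M₂.card := Finset.card_union_of_disjoint hd
  rw [← hm] at hW
  have hcard : ∀ S : Finset (Fin n), S.card < n + 1 := fun S =>
    Nat.lt_succ_of_le ((Finset.card_le_univ S).trans (by simp))
  have hsplit : ∀ c, (below c (M₁ ∪ M₂)).card + (above c (M₁ ∪ M₂)).card = (M₁ ∪ M₂).card :=
    fun c => Finset.card_filter_add_card_filter_not _
  obtain ⟨c, hc, h1, h2⟩ := exists_split hn (fun c => (below c (M₁ ∪ M₂)).card)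
    (by simp [below]) (fun c hc => by
      by_cases hmem : (⟨c, hc⟩ : Fin n) ∈ M₁ ∪ M₂
      · right
        have : below (c + 1) (M₁ ∪ M₂) = insert ⟨c, hc⟩ (below c (M₁ ∪ M₂)) := by
          ext i
          simp only [below, Finset.mem_filter, Finset.mem_insert, Fin.ext_iff]
          constructor
          · rintro ⟨h1, h2⟩
            by_cases h : i.1 = c
            · exact Or.inl h
            · exact Or.inr ⟨h1, by omega⟩
          · rintro (h | ⟨h1, h2⟩)
            · have : i = ⟨c, hc⟩ := Fin.ext h
              exact ⟨this ▸ hmem, by omega⟩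
            · exact ⟨h1, by omega⟩
        rw [this, Finset.card_insert_of_notMem]
        simp [below]
      · left
        congr 1
        refine Finset.filter_congr fun i hi => ?_
        have : i.1 ≠ c := fun h => hmem ((Fin.ext h : i = ⟨c, hc⟩) ▸ hi)
        omega)
    (by congr 1; exact Finset.filter_true_of_mem fun i _ => i.2) hW
  have hab : (M₁ ∪ M₂).card - (below c (M₁ ∪ M₂)).card = (above c (M₁ ∪ M₂)).card := by
    have := hsplit c
    omega
  rw [hab] at h2
  have hbound : ∀ P : Par, P.count n 0 ≤ 2 * n * 2 ^ g →
      P.treeSize n 0 ≤ 2000 * n * n * n * 2 ^ g := fun P hP => by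
    refine treeSize_le_of_count hn (hP.trans (Nat.mul_le_mul_right _ ?_))
    have : n ≤ n ^ 2 := Nat.le_self_pow (by norm_num) _
    omega
  refine ⟨c, by omega, _, hcard (below c (M₁ ∪ M₂)), _, hcard (above c (M₁ ∪ M₂)), ?_⟩
  intro q e xp xk j hq hk hj
  refine ⟨hbound _ ?_, hbound _ ?_, good_of_split hq hsol hd hk hj⟩
  · rw [mkSearch_zero]
    refine (Par.count_le_choose _ rfl rfl rfl rfl n 0 ?_).trans ?_
    · exact (zero_add n).le
    · rw [Par.actives_eq _ (Nat.zero_le _) hc n le_rfl, if_pos (Nat.zero_le _)]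
      change (min n (n - 0) - min n (n - c)).choose (j % (n + 1) - 0) * 2 ^ (j % (n + 1) - 0) ≤ _
      rw [hj, Nat.sub_zero, Nat.sub_zero, show min n n - min n (n - c) = c by omega]
      exact h1
  · rw [mkSearch_zero]
    refine (Par.count_le_choose _ rfl rfl rfl rfl n 0 ?_).trans ?_
    · exact (zero_add n).le
    · rw [Par.actives_eq _ (by simpa [Search.P₂] using hc) le_rfl n le_rfl, if_pos (Nat.zero_le _)]
      change (min n (n - c * (1 - 0)) - min n (n - n)).choose (xk % (n + 1) - 0) *
        2 ^ (xk % (n + 1) - 0) ≤ _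
      rw [hk, Nat.sub_zero, Nat.sub_zero, mul_one,
        show min n (n - c) - min n (n - n) = n - c by omega]
      exact h2

/-! ### The probability of lucky draws -/

theorem frac_mod_eq {M m r : ℕ} {δ : ℝ} (hr : r < m) (hm : m ≤ M) (hδ : δ ≤ 1 / m / 2) :
    Frac M δ fun x => x % m = r :=
  ((Frac.single hr (Φ := fun x => x = r) rfl).of_mod (by omega) hm (by positivity)).mono hδ
    fun _ _ h => h

/-- A lower bound for the probability of good draws. -/
noncomputable def drawProb (n : ℕ) : ℝ :=
  1 / (128 * n) * (1 / (16 * n) * (1 / (584 * n ^ 2) * (1 / 4 * (1 / (6 * n) * (1 / (6 * n) *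
    (1 / (6 * n) * (1 / (6 * n))))))))

/-- The eight digits of `R` are, in order, the randomness for `q`, `p`, the second target, the kind
of search, `g`, `e`, `j` and `c`. The draws `x₃`, `x₄`, `x₅`, `x₇` must hit one value each; every
such range has at most `n + 2` elements, which the bounds `1 / 4` and `1 / (6 * n)` allow for. -/
theorem frac_params {n σ s g md e c : ℕ} {m : ℕ → ℕ} {Q : ℕ → Search → Prop} (hn : 0 < n)
    (hg : g ≤ gTop n σ) (hmd : md < 2) (he : e ≤ g) (hc : c < n + 1)
    (h : Frac (2 ^ (16 * n)) (1 / (128 * n)) fun x₀ => Frac (2 ^ (16 * n)) (1 / (16 * n)) fun x₁ =>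
      Frac (2 ^ (16 * n)) (1 / (584 * n ^ 2)) fun x₂ => Frac (2 ^ (16 * n)) (1 / (6 * n)) fun x₆ =>
        Q (modulus n σ x₀) (mkSearch n (modulus n σ x₀) (s % modulus n σ x₀)
          (fun i => m i % modulus n σ x₀) md e x₁ x₂ x₆ c)) :
    Frac (2 ^ (128 * n)) (drawProb n) fun R =>
      drawG n σ R = g ∧ Q (modulus n σ R) (drawSearch n σ s R m) := by
  have hn1 : (1 : ℝ) ≤ n := by exact_mod_cast hn
  have hgt := gTop_le n σ
  have hnM : n + 3 ≤ 2 ^ (16 * n) := by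
    have h1 : n < 2 ^ n := n.lt_two_pow_self
    have h2 : 2 ^ n * 2 ^ 2 ≤ 2 ^ (16 * n) := by
      rw [← pow_add]
      exact Nat.pow_le_pow_right two_pos (by omega)
    omega
  have small : ∀ {k : ℕ}, k ≤ n + 2 → 0 < k → 1 / (6 * (n : ℝ)) ≤ 1 / k / 2 := by
    intro k hk hk0
    have hk' : (k : ℝ) ≤ n + 2 := by exact_mod_cast hk
    have hk0' : (0 : ℝ) < k := by exact_mod_cast hk0
    rw [div_div, div_le_div_iff₀ (by positivity) (by positivity)]
    linarith
  have key := Frac.draws (M := 2 ^ (16 * n)) (Φ := fun x₀ x₁ x₂ x₃ x₄ x₅ x₆ x₇ =>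
    x₃ % 2 = md ∧ x₄ % (gTop n σ + 1) = g ∧ x₅ % (g + 1) = e ∧ x₇ % (n + 1) = c ∧
      Q (modulus n σ x₀) (mkSearch n (modulus n σ x₀) (s % modulus n σ x₀)
        (fun i => m i % modulus n σ x₀) md e x₁ x₂ x₆ c)) (α₀ := 1 / (128 * n))
    (α₁ := 1 / (16 * n)) (α₂ := 1 / (584 * n ^ 2)) (α₃ := 1 / 4) (α₄ := 1 / (6 * n))
    (α₅ := 1 / (6 * n)) (α₆ := 1 / (6 * n)) (α₇ := 1 / (6 * n)) (by positivity) (by positivity)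
    (by positivity) (by positivity) (by positivity) (by positivity) (by positivity)
    (h.mono le_rfl fun x₀ _ h => h.mono le_rfl fun x₁ _ h => h.mono le_rfl fun x₂ _ h =>
      (frac_mod_eq hmd (by omega) (by norm_num)).mono le_rfl fun x₃ _ h3 =>
      (frac_mod_eq (m := gTop n σ + 1) (r := g) (by omega) (by omega)
        (small (by omega) (by omega))).mono le_rfl fun x₄ _ h4 =>
      (frac_mod_eq (m := g + 1) (r := e) (by omega) (by omega)
        (small (by omega) (by omega))).mono le_rfl fun x₅ _ h5 =>
      h.mono le_rfl fun x₆ _ h6 =>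
      (frac_mod_eq (m := n + 1) (r := c) (by omega) (by omega)
        (small (by omega) (by omega))).mono le_rfl fun x₇ _ h7 => ⟨h3, h4, h5, h7, h6⟩)
  have hM : (2 ^ (16 * n)) ^ 8 = 2 ^ (128 * n) := by
    rw [← pow_mul]
    congr 1
    ring
  rw [hM] at key
  refine key.mono le_rfl fun R _ h => ?_
  obtain ⟨h3, h4, h5, h7, h6⟩ := h
  have hg' : drawG n σ R = g := h4
  have hq : modulus n σ (R / (2 ^ (16 * n)) ^ 0 % 2 ^ (16 * n)) = modulus n σ R := by
    simp [modulus]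
  rw [hq] at h6
  refine ⟨hg', ?_⟩
  unfold drawSearch draw
  rw [hg', h3, h5, h7]
  exact h6

section
variable {n s g : ℕ} {a : Fin n → ℕ} {M₁ M₂ : Finset (Fin n)}

/-- What the draws have to satisfy for the algorithm to succeed. -/
def Lucky {n : ℕ} (a : Fin n → ℕ) (s g R : ℕ) : Prop :=
  drawG n (∑ i, a i) R = g ∧ (drawSearch n (∑ i, a i) s R (extend a)).P₁.treeSize n 0 ≤
    2000 * n * n * n * 2 ^ g ∧ (drawSearch n (∑ i, a i) s R (extend a)).P₂.treeSize n 0 ≤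
    2000 * n * n * n * 2 ^ g ∧ (drawSearch n (∑ i, a i) s R (extend a)).Good ∧
    GoodMod a s (modulus n (∑ i, a i) R)

theorem frac_modulus (hn : 0 < n) (hs : s < ∑ i, a i) : Frac (2 ^ (16 * n)) (1 / (128 * n))
    fun x => GoodMod a s (modulus n (∑ i, a i) x) := by
  have hb := bigFlag_eq n (∑ i, a i)
  split_ifs at hb with h
  · refine (Frac.of_forall fun x _ => goodMod_of_large a s hs ?_).mono ?_ fun _ _ h => h
    · unfold modulus
      rw [hb]
      omega
    · have hn1 : (1 : ℝ) ≤ n := by exact_mod_cast hn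
      rw [div_le_one (by positivity)]
      linarith
  · refine (frac_goodMod a s hn hs (not_le.1 h)).mono le_rfl fun x hx h => ?_
    unfold modulus
    rw [hb, Nat.mod_eq_of_lt hx, zero_mul, zero_add, Nat.sub_zero, one_mul]
    exact h

theorem lucky_of_residue {e : ℕ} (hn : 0 < n) (hs : s < ∑ i, a i)
    (hσ : ∑ i, a i < 2 ^ 2 ^ n) (hmax : IsMaxPair a s M₁ M₂) (hg : g ≤ gTop n (∑ i, a i))
    (heg : e + g = n) (heg' : e ≤ g) (he : e + (M₁.card + M₂.card) ≤ n) :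
    Frac (2 ^ (128 * n)) (drawProb n) (Lucky a s g) := by
  have hn1 : (1 : ℝ) ≤ n := by exact_mod_cast hn
  refine (frac_params (s := s) (m := extend a) (md := 1) (e := e) (c := 0) (g := g)
    (Q := fun q A => A.P₁.treeSize n 0 ≤ 2000 * n * n * n * 2 ^ g ∧
      A.P₂.treeSize n 0 ≤ 2000 * n * n * n * 2 ^ g ∧ A.Good ∧ GoodMod a s q) hn hg one_lt_two heg'
    (by omega) ?_).mono le_rfl fun R _ h => h
  refine (frac_modulus hn hs).mono le_rfl fun x₀ hx₀ hgood => ?_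
  have hq := modulus_pos n (∑ i, a i) x₀
  have hqle : modulus n (∑ i, a i) x₀ ≤ 2 ^ (16 * n) := by
    have hb := bigFlag_eq n (∑ i, a i)
    rw [if_neg (not_le.2 hσ)] at hb
    unfold modulus
    rw [hb, Nat.mod_eq_of_lt hx₀]
    omega
  obtain ⟨j₀, hj₀, h⟩ := frac_residue hn hmax hq hqle hgood heg he
  refine h.mono le_rfl fun x₁ _ h => h.mono le_rfl fun x₂ _ h => ?_
  refine (frac_mod_eq hj₀ ?_ ?_).mono le_rfl fun x₆ _ hx₆ => ?_
  · have h1 : n < 2 ^ n := n.lt_two_pow_self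
    have h2 : 2 ^ n * 2 ^ 1 ≤ 2 ^ (16 * n) := by
      rw [← pow_add]
      exact Nat.pow_le_pow_right two_pos (by omega)
    omega
  · push_cast
    rw [div_div, div_le_div_iff₀ (by positivity) (by positivity)]
    linarith
  · obtain ⟨h1, h2, h3⟩ := h x₆ 0 hx₆
    exact ⟨h1, h2, h3, hgood⟩

/-- The draws `x₁` and `e` play no role in the split search; the weak bounds are kept to reach the
same `drawProb` as for the residue search. -/
theorem lucky_of_split (hn : 0 < n) (hs : s < ∑ i, a i) (hsol : IsSolution a s M₁ M₂)
    (hd : Disjoint M₁ M₂) (hg : g ≤ gTop n (∑ i, a i))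
    (hW : n.choose (M₁.card + M₂.card) * 2 ^ (M₁.card + M₂.card) ≤ 2 ^ g * 2 ^ g) :
    Frac (2 ^ (128 * n)) (drawProb n) (Lucky a s g) := by
  have hn1 : (1 : ℝ) ≤ n := by exact_mod_cast hn
  obtain ⟨c, hc, k₁, hk₁, k₂, hk₂, h⟩ := exists_split_search hn hsol hd hW
  refine (frac_params (s := s) (m := extend a) (md := 0) (e := 0) (c := c) (g := g)
    (Q := fun q A => A.P₁.treeSize n 0 ≤ 2000 * n * n * n * 2 ^ g ∧
      A.P₂.treeSize n 0 ≤ 2000 * n * n * n * 2 ^ g ∧ A.Good ∧ GoodMod a s q) hn hg two_pos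
    (Nat.zero_le _) hc ?_).mono le_rfl fun R _ h => h
  refine (frac_modulus hn hs).mono le_rfl fun x₀ hx₀ hgood => ?_
  have hnM : n + 1 ≤ 2 ^ (16 * n) := by
    have h1 : n < 2 ^ n := n.lt_two_pow_self
    have h2 : 2 ^ n ≤ 2 ^ (16 * n) := Nat.pow_le_pow_right two_pos (by omega)
    omega
  have b1 : 1 / (16 * (n : ℝ)) ≤ 1 := by
    rw [div_le_one (by positivity)]
    linarith
  have b2 : 1 / (6 * (n : ℝ)) ≤ 1 / (n + 1 : ℕ) / 2 := by
    push_cast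
    rw [div_div, div_le_div_iff₀ (by positivity) (by positivity)]
    linarith
  have b3 : 1 / (584 * (n : ℝ) ^ 2) ≤ 1 / (n + 1 : ℕ) / 2 := by
    refine le_trans ?_ b2
    rw [div_le_div_iff₀ (by positivity) (by positivity)]
    nlinarith
  refine (Frac.of_forall fun x₁ _ => ?_).mono b1 fun _ _ h => h
  refine (frac_mod_eq hk₂ hnM b3).mono le_rfl fun x₂ _ hx₂ => ?_
  refine (frac_mod_eq hk₁ hnM b2).mono le_rfl fun x₆ _ hx₆ => ?_
  obtain ⟨h1, h2, h3⟩ := h _ 0 x₁ x₂ x₆ (modulus_pos n (∑ i, a i) x₀) hx₂ hx₆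
  exact ⟨h1, h2, h3, hgood⟩

end

/-! ### Entropy and the thresholds -/

theorem entropy₂_eq (x : ℝ) : entropy₂ x = Real.binEntropy x / Real.log 2 := by
  unfold entropy₂ Real.binEntropy Real.logb
  rw [Real.log_inv, Real.log_inv]
  ring

theorem entropy₂_one_sub (x : ℝ) : entropy₂ (1 - x) = entropy₂ x := by
  rw [entropy₂_eq, entropy₂_eq, Real.binEntropy_one_sub]

theorem mul_log_le {x y : ℝ} (hx : 0 ≤ x) (hy : 0 < y) :
    x * Real.log y - x * Real.log x ≤ y - x := by
  rcases hx.eq_or_lt with rfl | hx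
  · simp [hy.le]
  · have h := Real.log_le_sub_one_of_pos (div_pos hy hx)
    rw [Real.log_div hy.ne' hx.ne'] at h
    have h2 := mul_le_mul_of_nonneg_left h hx.le
    have h3 : x * (y / x - 1) = y - x := by field_simp
    rw [h3] at h2
    linarith

/-- Gibbs' inequality. -/
theorem entropy₂_le {x y : ℝ} (hx0 : 0 ≤ x) (hx1 : x ≤ 1) (hy0 : 0 < y) (hy1 : y < 1) :
    entropy₂ x ≤ -x * Real.logb 2 y - (1 - x) * Real.logb 2 (1 - y) := by
  have h1 := mul_log_le hx0 hy0
  have h2 := mul_log_le (sub_nonneg.2 hx1) (sub_pos.2 hy1)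
  have hlog : 0 < Real.log 2 := Real.log_pos (by norm_num)
  unfold entropy₂ Real.logb
  rw [← sub_nonneg]
  have h3 : -x * (Real.log y / Real.log 2) - (1 - x) * (Real.log (1 - y) / Real.log 2) -
      (-x * (Real.log x / Real.log 2) - (1 - x) * (Real.log (1 - x) / Real.log 2)) =
      (x * Real.log x - x * Real.log y + ((1 - x) * Real.log (1 - x) -
        (1 - x) * Real.log (1 - y))) / Real.log 2 := by ring
  rw [h3]
  exact div_nonneg (by linarith) hlog.le

/-- `entropy₂ x + x` decreases for `x ≥ 2 / 3`. -/
theorem entropy₂_add_le_of_ge {x y : ℝ} (hy : 2 / 3 ≤ y) (hy1 : y < 1) (hxy : y ≤ x)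
    (hx : x ≤ 1) : entropy₂ x + x ≤ entropy₂ y + y := by
  have h := entropy₂_le (by linarith) hx (by linarith : 0 < y) hy1
  -- For fixed `y`, Gibbs' inequality bounds `entropy₂ x + x` by an affine function of `x` that
  -- agrees with it at `y` and has slope `logb 2 (1 - y) - logb 2 y + 1`. This slope is nonpositive
  -- when `2 * (1 - y) ≤ y`, that is, from 2/3 on.
  have h1 : Real.logb 2 (1 - y) + 1 ≤ Real.logb 2 y := by
    have h2 : Real.logb 2 (1 - y) + 1 = Real.logb 2 ((1 - y) * 2) := by
      rw [Real.logb_mul (by linarith) (by norm_num), Real.logb_self_eq_one (by norm_num)]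
    rw [h2]
    exact Real.logb_le_logb_of_le (by norm_num) (by linarith) (by linarith)
  have h3 : entropy₂ y = -y * Real.logb 2 y - (1 - y) * Real.logb 2 (1 - y) := rfl
  nlinarith [mul_nonneg (sub_nonneg.2 hxy) (sub_nonneg.2 h1)]

/-- `entropy₂ x + x` increases for `x ≤ 2 / 3`. -/
theorem entropy₂_add_le_of_le {x y : ℝ} (hy0 : 0 < y) (hy : y ≤ 2 / 3) (hxy : x ≤ y)
    (hx : 0 ≤ x) : entropy₂ x + x ≤ entropy₂ y + y := by
  have h := entropy₂_le hx (by linarith) hy0 (by linarith : y < 1)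
  have h1 : Real.logb 2 y ≤ Real.logb 2 (1 - y) + 1 := by
    have h2 : Real.logb 2 (1 - y) + 1 = Real.logb 2 ((1 - y) * 2) := by
      rw [Real.logb_mul (by linarith) (by norm_num), Real.logb_self_eq_one (by norm_num)]
    rw [h2]
    exact Real.logb_le_logb_of_le (by norm_num) (by linarith) (by linarith)
  have h3 : entropy₂ y = -y * Real.logb 2 y - (1 - y) * Real.logb 2 (1 - y) := rfl
  nlinarith [mul_nonneg (sub_nonneg.2 hxy) (sub_nonneg.2 h1)]

/-- The entropy at a rational point as a logarithm. -/
theorem mul_entropy₂_div {k m : ℕ} (hk : 0 < k) (hm : 0 < m) :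
    ((k + m : ℕ) : ℝ) * entropy₂ (k / (k + m : ℕ)) =
      Real.logb 2 ((k + m : ℕ) ^ (k + m)) - Real.logb 2 (k ^ k * m ^ m) := by
  have hk' : (0 : ℝ) < k := by exact_mod_cast hk
  have hm' : (0 : ℝ) < m := by exact_mod_cast hm
  have hkm : (0 : ℝ) < (k + m : ℕ) := by positivity
  have h1 : (1 : ℝ) - k / (k + m : ℕ) = m / (k + m : ℕ) := by
    field_simp
    push_cast
    ring
  unfold entropy₂
  rw [h1, Real.logb_div hk'.ne' hkm.ne', Real.logb_div hm'.ne' hkm.ne', Real.logb_pow,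
    Real.logb_mul (by positivity) (by positivity), Real.logb_pow, Real.logb_pow]
  field_simp
  push_cast
  ring

/-- At a rational point with denominator `N` the sign of `N * (entropy₂ x - x)` is decided by
comparing integer powers. The value 17/22 lies below the root; 143/185 lies above it and still below
0.773. -/
theorem exists_threshold : ∃ x : ℝ, 17 / 22 < x ∧ x < 143 / 185 ∧ entropy₂ x = x := by
  have hc : Continuous fun x => entropy₂ x - x := by
    have : entropy₂ = fun x => Real.binEntropy x / Real.log 2 := funext entropy₂_eq
    rw [this]
    exact (Real.binEntropy_continuous.div_const _).sub continuous_id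
  have h1 : 0 < entropy₂ (17 / 22) - 17 / 22 := by
    have h := mul_entropy₂_div (k := 17) (m := 5) (by norm_num) (by norm_num)
    have h2 : Real.logb 2 (2 ^ 17 * (17 ^ 17 * 5 ^ 5)) < Real.logb 2 (22 ^ 22) :=
      Real.logb_lt_logb (by norm_num) (by norm_num) (by norm_num)
    rw [Real.logb_mul (by norm_num) (by norm_num), Real.logb_pow,
      Real.logb_self_eq_one (by norm_num)] at h2
    norm_num at h h2
    linarith
  have h2 : entropy₂ (143 / 185) - 143 / 185 < 0 := by
    have h := mul_entropy₂_div (k := 143) (m := 42) (by norm_num) (by norm_num)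
    have h2 : Real.logb 2 (185 ^ 185) < Real.logb 2 (2 ^ 143 * (143 ^ 143 * 42 ^ 42)) :=
      Real.logb_lt_logb (by norm_num) (by norm_num) (by norm_num)
    rw [Real.logb_mul (by norm_num) (by norm_num), Real.logb_pow 2 2,
      Real.logb_self_eq_one (by norm_num)] at h2
    push_cast at h h2
    generalize Real.logb 2 (185 ^ 185) = A at h h2
    generalize Real.logb 2 (143 ^ 143 * 42 ^ 42) = B at h h2
    linarith
  obtain ⟨x, ⟨hx1, hx2⟩, hx⟩ := intermediate_value_Ioo' (by norm_num) hc.continuousOn ⟨h2, h1⟩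
  exact ⟨x, hx1, hx2, sub_eq_zero.1 hx⟩

/-- The number of subsets of a given size. -/
theorem choose_le_two_rpow {n m : ℕ} (hn : 0 < n) (hm : m ≤ n) :
    (n.choose m : ℝ) ≤ 2 ^ (entropy₂ (m / n) * n) := by
  have hn' : (0 : ℝ) < n := by exact_mod_cast hn
  rcases Nat.eq_zero_or_pos m with rfl | hm0
  · simp [entropy₂]
  rcases hm.eq_or_lt with rfl | hmn
  · simp [entropy₂, hn'.ne']
  have hm' : (0 : ℝ) < m := by exact_mod_cast hm0
  obtain ⟨k, rfl⟩ := Nat.exists_eq_add_of_lt hmn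
  have hk' : (0 : ℝ) < (k + 1 : ℕ) := by positivity
  have h := mul_entropy₂_div hm0 (Nat.succ_pos k)
  rw [Nat.succ_eq_add_one, ← add_assoc] at h
  have h1 : ((m + k + 1).choose m : ℝ) * ((m : ℝ) ^ m * (k + 1 : ℕ) ^ (k + 1)) ≤
      (m + k + 1 : ℕ) ^ (m + k + 1) := by
    -- The binomial coefficient is bounded through one term of the expansion of `(m + (n - m)) ^ n`.
    have h2 := add_pow m (k + 1) (m + (k + 1))
    have h3 : m ^ m * (k + 1) ^ (m + (k + 1) - m) * (m + (k + 1)).choose m ≤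
        (m + (k + 1)) ^ (m + (k + 1)) := by
      rw [h2]
      exact Finset.single_le_sum (f := fun i => m ^ i * (k + 1) ^ (m + (k + 1) - i) *
        (m + (k + 1)).choose i) (fun _ _ => Nat.zero_le _) (by simp)
    rw [Nat.add_sub_cancel_left, ← add_assoc] at h3
    have h4 : ((m + k + 1).choose m) * (m ^ m * (k + 1) ^ (k + 1)) ≤ (m + k + 1) ^ (m + k + 1) := by
      rw [mul_comm]
      exact h3
    exact_mod_cast h4
  rw [mul_comm, h, Real.rpow_sub two_pos, Real.rpow_logb two_pos (by norm_num) (by positivity),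
    Real.rpow_logb two_pos (by norm_num) (by positivity), le_div_iff₀ (by positivity)]
  exact h1

/-! ### The exponent reached for each solution ratio -/

section
variable {n s : ℕ} {a : Fin n → ℕ} {M₁ M₂ : Finset (Fin n)}

/-- Removing the common elements makes any solution disjoint and keeps the two sets distinct; so
disjoint solutions exist and there is a largest one. -/
theorem exists_isMaxPair {S₁ S₂ : Finset (Fin n)} (h : IsSolution a s S₁ S₂) :
    ∃ M₁ M₂, IsMaxPair a s M₁ M₂ := by
  classical
  have e1 := Finset.sum_inter_add_sum_sdiff S₁ S₂ a
  have e2 := Finset.sum_inter_add_sum_sdiff S₂ S₁ a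
  rw [Finset.inter_comm] at e2
  have hd : IsSolution a s (S₁ \ S₂) (S₂ \ S₁) := by
    constructor
    · intro he
      have h1 : Disjoint (S₁ \ S₂) (S₂ \ S₁) := disjoint_sdiff_sdiff
      rw [← he, disjoint_self] at h1
      rw [h1] at he
      exact h.1 (Finset.Subset.antisymm (Finset.sdiff_eq_empty_iff_subset.1 h1)
        (Finset.sdiff_eq_empty_iff_subset.1 he.symm))
    · have := h.2
      omega
  obtain ⟨⟨M₁, M₂⟩, hM, hmax⟩ := ((Finset.univ ×ˢ Finset.univ).filter
    fun y : Finset (Fin n) × Finset (Fin n) => IsSolution a s y.1 y.2 ∧ Disjoint y.1 y.2)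
    |>.exists_max_image (fun y => y.1.card + y.2.card)
      ⟨(S₁ \ S₂, S₂ \ S₁), by simpa using ⟨hd, disjoint_sdiff_sdiff⟩⟩
  simp only [Finset.mem_filter, Finset.mem_product, Finset.mem_univ, true_and] at hM hmax
  exact ⟨M₁, M₂, hM.1, hM.2, fun T₁ T₂ hT hTd => hmax (T₁, T₂) ⟨hT, hTd⟩⟩

theorem exists_isMaxPair_of_ratio {ℓ : ℝ} (h : IsMaxSolutionRatio a s ℓ) :
    ∃ M₁ M₂, IsMaxPair a s M₁ M₂ ∧ ℓ * n = (M₁.card + M₂.card : ℕ) := by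
  obtain ⟨⟨M₁, M₂, hs, hd, he⟩, hmax⟩ := h
  refine ⟨M₁, M₂, ⟨hs, hd, fun S₁ S₂ hS hSd => ?_⟩, he⟩
  have := hmax ⟨S₁, S₂, hS, hSd, rfl⟩
  rw [he] at this
  exact_mod_cast this

/-- A value of `g` for which the algorithm is fast and succeeds. -/
theorem exists_lucky {ℓ₂ ℓ : ℝ} (hℓ₂ : 17 / 22 < ℓ₂) (hℓ₂' : ℓ₂ < 143 / 185)
    (heq : entropy₂ ℓ₂ = ℓ₂) (hn : 0 < n) (hs : s < ∑ i, a i) (hmax : IsMaxPair a s M₁ M₂)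
    (hℓ : ℓ * n = (M₁.card + M₂.card : ℕ)) : ∃ g ≤ gTop n (∑ i, a i),
      Frac (2 ^ (128 * n)) (drawProb n) (Lucky a s g) ∧
      (bigFlag n (∑ i, a i) = 0 → (2 : ℝ) ^ g ≤ 2 * 2 ^ (gammaExp (1 - ℓ₂) ℓ₂ ℓ * n)) := by
  obtain ⟨m, hm⟩ : ∃ m, m = M₁.card + M₂.card := ⟨_, rfl⟩
  have hmn : m ≤ n := by
    rw [hm, ← Finset.card_union_of_disjoint hmax.disj]
    exact (Finset.card_le_univ _).trans (by simp)
  have hn' : (0 : ℝ) < n := by exact_mod_cast hn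
  have hmn' : (m : ℝ) ≤ n := by exact_mod_cast hmn
  rw [← hm] at hℓ
  have hm0 : (0 : ℝ) ≤ m := Nat.cast_nonneg _
  have hℓ0 : 0 ≤ ℓ := by
    by_contra h
    have := mul_neg_of_neg_of_pos (not_le.1 h) hn'
    linarith
  have hℓ1 : ℓ ≤ 1 := by
    by_contra h
    have := mul_lt_mul_of_pos_right (not_le.1 h) hn'
    linarith
  have hb := bigFlag_eq n (∑ i, a i)
  have hgt : gTop n (∑ i, a i) = bigFlag n (∑ i, a i) * n + (1 - bigFlag n (∑ i, a i)) *
    (143 * n / 185 + 1) := rfl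
  split_ifs at hb with hbig
  · rw [hb] at hgt
    -- For a huge sum `2 ^ n` is polynomial in the input length, so the split search may use the
    -- trivial bound `4 ^ n` for the number of signed sets.
    refine ⟨n, by omega, lucky_of_split hn hs hmax.sol hmax.disj (by omega) ?_, fun h => by omega⟩
    rw [← hm]
    exact Nat.mul_le_mul (Nat.choose_le_two_pow n m) (Nat.pow_le_pow_right two_pos hmn)
  rw [hb, zero_mul, zero_add, Nat.sub_zero, one_mul] at hgt
  have hpow : ∀ (g : ℕ) (x : ℝ), (g : ℝ) ≤ x + 1 → (2 : ℝ) ^ g ≤ 2 * 2 ^ x := by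
    intro g x h
    rw [← Real.rpow_natCast, mul_comm, ← Real.rpow_add_one two_ne_zero]
    exact Real.rpow_le_rpow_of_exponent_le one_le_two h
  unfold gammaExp
  split_ifs with h1 h2
  · -- short solutions
    have h2m : 2 * m < n := by
      have : (2 : ℝ) * m < n := by nlinarith [h1.2]
      exact_mod_cast this
    -- Here `m < n / 2` leaves more than `n / 2` free items; `e` stops at `n / 2` to keep `e ≤ g`.
    refine ⟨(n + 1) / 2, by omega, lucky_of_residue (e := n / 2) hn hs (not_le.1 hbig) hmax
      (by omega) (by omega) (by omega) (by omega), fun _ => hpow _ _ ?_⟩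
    have : 2 * ((n + 1) / 2) ≤ n + 1 := by omega
    have h3 : (2 : ℝ) * ((n + 1) / 2 : ℕ) ≤ n + 1 := by exact_mod_cast this
    linarith
  · -- long solutions
    have h2m : n ≤ 2 * m := by
      have : (n : ℝ) ≤ 2 * m := by nlinarith [h2.1]
      exact_mod_cast this
    have h3 : 185 * m ≤ 143 * n := by
      have : (185 : ℝ) * m ≤ 143 * n := by nlinarith [h2.2]
      exact_mod_cast this
    -- All `n - m` free items are used, and `m ≥ n / 2` ensures `e ≤ g`.
    refine ⟨m, by omega, lucky_of_residue (e := n - m) hn hs (not_le.1 hbig) hmax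
      (by omega) (by omega) (by omega) (by omega), fun _ => hpow _ _ ?_⟩
    linarith
  · -- very short or very long solutions
    -- Outside the middle range monotonicity compares with the thresholds, where the rates are 1/2
    -- and `ℓ₂`. This keeps `g` within the range from which it is drawn.
    have hrate : (entropy₂ ℓ + ℓ) / 2 ≤ 143 / 185 := by
      rcases lt_or_ge ℓ (1 / 2) with h3 | h3
      · have h4 : ℓ < 1 - ℓ₂ := by
          by_contra h
          exact h1 ⟨not_lt.1 h, h3⟩
        have h5 := entropy₂_add_le_of_le (y := 1 - ℓ₂) (by linarith) (by linarith) h4.le hℓ0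
        rw [entropy₂_one_sub, heq] at h5
        linarith
      · have h4 : ℓ₂ ≤ ℓ := by
          by_contra h
          exact h2 ⟨h3, not_le.1 h⟩
        have h5 := entropy₂_add_le_of_ge (y := ℓ₂) (by linarith) (by linarith) h4 hℓ1
        rw [heq] at h5
        linarith
    obtain ⟨x, hx⟩ : ∃ x, x = (entropy₂ ℓ + ℓ) / 2 * n := ⟨_, rfl⟩
    have hxpos : 0 ≤ x := by
      have h3 : 0 ≤ entropy₂ ℓ := by
        rw [entropy₂_eq]
        exact div_nonneg (Real.binEntropy_nonneg hℓ0 hℓ1) (Real.log_nonneg one_le_two)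
      rw [hx]
      positivity
    have hceil := Nat.ceil_lt_add_one hxpos
    have hg : ⌈x⌉₊ ≤ 143 * n / 185 + 1 := by
      rw [Nat.ceil_le]
      have h3 : 143 * n ≤ 185 * (143 * n / 185 + 1) := by omega
      have h4 : (143 : ℝ) * n ≤ 185 * (143 * n / 185 + 1 : ℕ) := by exact_mod_cast h3
      have h5 : x ≤ 143 / 185 * n := by
        rw [hx]
        exact mul_le_mul_of_nonneg_right hrate hn'.le
      linarith
    rw [← hx]
    refine ⟨⌈x⌉₊, by omega, lucky_of_split hn hs hmax.sol hmax.disj (by omega) ?_,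
      fun _ => hpow _ _ hceil.le⟩
    rw [← hm]
    have h3 := choose_le_two_rpow hn hmn
    rw [show (m : ℝ) / n = ℓ by rw [← hℓ]; field_simp] at h3
    have h4 : ((n.choose m * 2 ^ m : ℕ) : ℝ) ≤ ((2 ^ ⌈x⌉₊ * 2 ^ ⌈x⌉₊ : ℕ) : ℝ) := by
      push_cast
      calc (n.choose m : ℝ) * 2 ^ m ≤ 2 ^ (entropy₂ ℓ * n) * 2 ^ m := by gcongr
        _ = 2 ^ (x + x) := by
          rw [← Real.rpow_natCast, ← Real.rpow_add two_pos, hx, ← hℓ]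
          congr 1
          ring
        _ ≤ 2 ^ ((⌈x⌉₊ : ℝ) + ⌈x⌉₊) := by
          refine Real.rpow_le_rpow_of_exponent_le one_le_two ?_
          have := Nat.le_ceil x
          linarith
        _ = _ := by rw [Real.rpow_add two_pos, Real.rpow_natCast]
    exact_mod_cast h4

end

/-! ### Constants of the final bounds -/

/-- The exponential dominates the polynomial factor. -/
theorem exists_worst_case_bound : ∃ D : ℕ, ∀ n g : ℕ, g ≤ 143 * n / 185 + 1 →
    (n : ℝ) ^ 5 * 2 ^ g ≤ D * 2 ^ ((0.773 : ℝ) * n) := by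
  have hlog : 0 < Real.log 2 := Real.log_pos (by norm_num)
  -- The exact gap is 773/1000 - 143/185 = 1/37000, so `exp (c * n)` is the room left for the factor
  -- `n ^ 5`.
  obtain ⟨c, hc⟩ : ∃ c, c = Real.log 2 / 37000 := ⟨_, rfl⟩
  have hc0 : 0 < c := by rw [hc]; positivity
  obtain ⟨D, hD⟩ := exists_nat_ge (2 * (120 / c ^ 5))
  refine ⟨D, fun n g hg => ?_⟩
  have h1 := Real.pow_div_factorial_le_exp (c * n) (by positivity) 5
  rw [show ((Nat.factorial 5 : ℕ) : ℝ) = 120 by norm_num [Nat.factorial], mul_pow] at h1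
  have h2 : (n : ℝ) ^ 5 ≤ 120 / c ^ 5 * Real.exp (c * n) := by
    rw [div_le_iff₀ (by norm_num)] at h1
    rw [div_mul_eq_mul_div, le_div_iff₀ (by positivity)]
    linarith
  have h3 : Real.exp (c * n) = 2 ^ ((n : ℝ) / 37000) := by
    rw [Real.rpow_def_of_pos two_pos, hc]
    congr 1
    ring
  have h4 : (2 : ℝ) ^ g ≤ 2 * 2 ^ ((143 / 185 : ℝ) * n) := by
    rw [← Real.rpow_natCast, mul_comm, ← Real.rpow_add_one two_ne_zero]
    refine Real.rpow_le_rpow_of_exponent_le one_le_two ?_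
    have h5 : 185 * g ≤ 143 * n + 185 := by omega
    have h6 : (185 : ℝ) * g ≤ 143 * n + 185 := by exact_mod_cast h5
    linarith
  calc (n : ℝ) ^ 5 * 2 ^ g ≤
        120 / c ^ 5 * Real.exp (c * n) * (2 * 2 ^ ((143 / 185 : ℝ) * n)) := by gcongr
    _ = 2 * (120 / c ^ 5) * (2 ^ ((n : ℝ) / 37000) * 2 ^ ((143 / 185 : ℝ) * n)) := by
      rw [h3]
      ring
    _ = 2 * (120 / c ^ 5) * 2 ^ ((0.773 : ℝ) * n) := by
      rw [← Real.rpow_add two_pos]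
      congr 2
      ring
    _ ≤ _ := by gcongr

theorem _root_.HaltsWithin.mono {P : Prog} {n s T T' : ℕ} {a : Fin n → ℕ} {tape : ℕ → Bool}
    (h : HaltsWithin P a s tape T) (hT : T ≤ T') : HaltsWithin P a s tape T' := by
  obtain ⟨t, τ, h1, h2⟩ := h
  exact ⟨t, τ, h1, h2.trans hT⟩

theorem _root_.SolvesWithin.mono {P : Prog} {n s T T' : ℕ} {a : Fin n → ℕ} {tape : ℕ → Bool}
    (h : SolvesWithin P a s tape T) (hT : T ≤ T') : SolvesWithin P a s tape T' := by
  obtain ⟨t, τ, h1, h2, h3⟩ := h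
  exact ⟨t, τ, h1, h2.trans hT, h3⟩

theorem drawProb_ge {n C : ℕ} (hn : 0 < n) (hC : 6300000000 ≤ C) :
    1 / ((C : ℝ) * (n : ℝ) ^ C) ≤ drawProb n := by
  have hn' : (1 : ℝ) ≤ n := by exact_mod_cast hn
  have hC' : (6300000000 : ℝ) ≤ C := by exact_mod_cast hC
  -- The constant is 128 * 16 * 584 * 4 * 6 ^ 4.
  have h : drawProb n = 1 / (6200229888 * 1 * (n : ℝ) ^ 8) := by
    unfold drawProb
    field_simp
    norm_num
  rw [h]
  refine one_div_le_one_div_of_le (by positivity) ?_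
  have h1 : (n : ℝ) ^ 8 ≤ (n : ℝ) ^ C := pow_le_pow_right₀ hn' (by omega)
  have h2 : (0 : ℝ) ≤ (n : ℝ) ^ 8 := by positivity
  nlinarith

theorem time_le_floor {n L K D C g fl : ℕ} {X : ℝ} (hL : 1 ≤ L) (hC : 6 ≤ C) (hK : K ≤ C)
    (hD : K * D ≤ C) (hX : 0 ≤ X) (h : fl = 0 → (n : ℝ) ^ 5 * 2 ^ g ≤ D * X) :
    K * (L ^ 6 + (1 - fl) * (n ^ 5 * 2 ^ g)) ≤ ⌊(C : ℝ) * ((L : ℝ) ^ C + X)⌋₊ := by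
  have hK' : (K : ℝ) ≤ C := by exact_mod_cast hK
  have hD' : (K : ℝ) * D ≤ C := by exact_mod_cast hD
  have h1 : (K : ℝ) * L ^ 6 ≤ C * L ^ C := by
    have : (L : ℝ) ^ 6 ≤ L ^ C := pow_le_pow_right₀ (by exact_mod_cast hL) hC
    gcongr
  have h2 : ((K * ((1 - fl) * (n ^ 5 * 2 ^ g)) : ℕ) : ℝ) ≤ C * X := by
    rcases Nat.eq_zero_or_pos fl with h0 | h0
    · rw [h0, Nat.sub_zero, one_mul]
      push_cast
      calc (K : ℝ) * ((n : ℝ) ^ 5 * 2 ^ g) ≤ K * (D * X) :=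
          mul_le_mul_of_nonneg_left (h h0) (Nat.cast_nonneg _)
        _ = K * D * X := by ring
        _ ≤ C * X := by gcongr
    · rw [show 1 - fl = 0 by omega, zero_mul, mul_zero, Nat.cast_zero]
      positivity
  refine Nat.le_floor ?_
  rw [mul_add, mul_add, Nat.cast_add]
  refine add_le_add ?_ h2
  push_cast
  exact h1

/-- The success probability is taken over as many coins as the time bound; this ensures that the
`128 * n` coins of a run are among them. -/
theorem le_time_floor {n L C : ℕ} {X : ℝ} (hL : 1 ≤ L) (hn : n ≤ L) (hC : 128 ≤ C) (hX : 0 ≤ X) :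
    128 * n ≤ ⌊(C : ℝ) * ((L : ℝ) ^ C + X)⌋₊ := by
  refine Nat.le_floor ?_
  have h1 : (L : ℝ) ≤ L ^ C := le_self_pow₀ (by exact_mod_cast hL) (by omega)
  have h2 : (n : ℝ) ≤ L := by exact_mod_cast hn
  have h3 : (128 : ℝ) ≤ C := by exact_mod_cast hC
  push_cast
  gcongr
  linarith

theorem drawG_le (n σ R : ℕ) : drawG n σ R ≤ gTop n σ :=
  Nat.lt_succ_iff.1 (Nat.mod_lt _ (Nat.succ_pos _))

theorem gTop_of_bigFlag_eq_zero {n σ : ℕ} (h : bigFlag n σ = 0) :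
    gTop n σ = 143 * n / 185 + 1 := by
  rw [gTop, h, zero_mul, zero_add, Nat.sub_zero, one_mul]

end ShiftedSums

theorem mainTheorem9 :
    ∃ ℓ₁ ℓ₂ : ℝ,
      |ℓ₁ - 0.227| < 0.0005 ∧ |ℓ₂ - 0.773| < 0.0005 ∧
      (entropy₂ ℓ₁ + ℓ₁) / 2 = 1 / 2 ∧ (entropy₂ ℓ₂ + ℓ₂) / 2 = ℓ₂ ∧
      ∃ (P : Prog) (C : ℕ), 0 < C ∧
        ∀ (n : ℕ) (a : Fin n → ℕ) (s : ℕ), (∀ i, 0 < a i) → s < ∑ i, a i →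
          -- running time and success probability in terms of the maximum solution ratio
          (∀ ℓ : ℝ, IsMaxSolutionRatio a s ℓ →
            1 / ((C : ℝ) * (n : ℝ) ^ C) ≤
              successProb P a s ⌊(C : ℝ) * ((inputLength a s : ℝ) ^ C +
                (n : ℝ) ^ C * (2 : ℝ) ^ (gammaExp ℓ₁ ℓ₂ ℓ * n))⌋₊) ∧
          -- worst case
          ((∃ S₁ S₂ : Finset (Fin n), IsSolution a s S₁ S₂) →
            1 / ((C : ℝ) * (n : ℝ) ^ C) ≤
              successProb P a s ⌊(C : ℝ) * ((inputLength a s : ℝ) ^ C +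
                (2 : ℝ) ^ ((0.773 : ℝ) * n))⌋₊) ∧
          (∀ tape : ℕ → Bool,
            HaltsWithin P a s tape ⌊(C : ℝ) * ((inputLength a s : ℝ) ^ C +
              (2 : ℝ) ^ ((0.773 : ℝ) * n))⌋₊) := by
  obtain ⟨ℓ₂, hℓ₂, hℓ₂', heq⟩ := ShiftedSums.exists_threshold
  obtain ⟨P, K, hP⟩ := ShiftedSums.algorithm_spec
  obtain ⟨D, hD⟩ := ShiftedSums.exists_worst_case_bound
  -- The summands serve the success probability, the ratio-dependent time bound with its factor 2
  -- from rounding `g`, and the worst-case bound with its factor `D`.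
  obtain ⟨C, hCdef⟩ : ∃ C, C = 6300000000 + 2 * K + K * D := ⟨_, rfl⟩
  refine ⟨1 - ℓ₂, ℓ₂, abs_lt.2 ⟨by linarith, by linarith⟩, abs_lt.2 ⟨by linarith, by linarith⟩,
    by rw [ShiftedSums.entropy₂_one_sub, heq]; ring, by rw [heq]; ring, P, C, by omega, ?_⟩
  intro n a s _ hs
  have hn : 0 < n := by
    rcases Nat.eq_zero_or_pos n with rfl | h
    · simp at hs
    · exact h
  have hnL : n ≤ inputLength a s := by
    unfold inputLength
    omega
  have hL : 1 ≤ inputLength a s := hn.trans_le hnL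
  have hn' : (1 : ℝ) ≤ n := by exact_mod_cast hn
  have success : ∀ {g : ℕ} {X : ℝ}, 0 ≤ X →
      ShiftedSums.Frac (2 ^ (128 * n)) (ShiftedSums.drawProb n) (ShiftedSums.Lucky a s g) →
      K * (inputLength a s ^ 6 + (1 - ShiftedSums.bigFlag n (∑ i, a i)) * (n ^ 5 * 2 ^ g)) ≤
        ⌊(C : ℝ) * ((inputLength a s : ℝ) ^ C + X)⌋₊ →
      1 / ((C : ℝ) * (n : ℝ) ^ C) ≤
        successProb P a s ⌊(C : ℝ) * ((inputLength a s : ℝ) ^ C + X)⌋₊ := by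
    intro g X hX hg hT
    refine (ShiftedSums.drawProb_ge hn (by omega)).trans (ShiftedSums.successProb_ge
      (ShiftedSums.le_time_floor hL hnL (by omega) hX) hg fun r ⟨hg, h1, h2, h3, h4⟩ => ?_)
    rw [← hg] at hT h1 h2
    exact ((hP hs rfl).2 h1 h2 h3 h4).mono hT
  refine ⟨?_, ?_, ?_⟩
  · intro ℓ hℓ
    obtain ⟨M₁, M₂, hM, hm⟩ := ShiftedSums.exists_isMaxPair_of_ratio hℓ
    obtain ⟨g, -, hg, hsmall⟩ := ShiftedSums.exists_lucky hℓ₂ hℓ₂' heq hn hs hM hm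
    refine success (by positivity) hg (ShiftedSums.time_le_floor (D := 2) hL (by omega) (by omega)
      (by omega) (by positivity) fun h => ?_)
    have h5 : (n : ℝ) ^ 5 ≤ n ^ C := pow_le_pow_right₀ hn' (by omega)
    calc (n : ℝ) ^ 5 * 2 ^ g ≤
          (n : ℝ) ^ C * (2 * 2 ^ (gammaExp (1 - ℓ₂) ℓ₂ ℓ * n)) := by gcongr; exact hsmall h
      _ = _ := by push_cast; ring
  · rintro ⟨S₁, S₂, hS⟩
    obtain ⟨M₁, M₂, hM⟩ := ShiftedSums.exists_isMaxPair hS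
    -- In the worst case the ratio is unspecified, so the one of a largest pair is inserted, and
    -- only `g ≤ gTop` is used.
    obtain ⟨g, hgt, hg, -⟩ := ShiftedSums.exists_lucky (ℓ := (M₁.card + M₂.card : ℕ) / n)
      hℓ₂ hℓ₂' heq hn hs hM (div_mul_cancel₀ _ (by positivity))
    refine success (by positivity) hg (ShiftedSums.time_le_floor (D := D) hL (by omega) (by omega)
      (by omega) (by positivity) fun h => hD n g ?_)
    rwa [ShiftedSums.gTop_of_bigFlag_eq_zero h] at hgt
  · intro tape
    refine (hP hs rfl).1.mono (ShiftedSums.time_le_floor (D := D) hL (by omega) (by omega)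
      (by omega) (by positivity) fun h => hD n _ ?_)
    -- Every run is bounded, lucky or not, because `g` is drawn from the numbers up to `gTop`.
    have := ShiftedSums.drawG_le n (∑ i, a i) (ShiftedSums.bitsVal tape (128 * n))
    rwa [ShiftedSums.gTop_of_bigFlag_eq_zero h] at this
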